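/- **Conventions.** The scalar field $\mathbb F$ is $\mathbb R$ or $\mathbb C$. For sequences, $\alpha_i\lesssim\beta_i$ means $\alpha_i\le C\beta_i$ with $C$ independent of $i$, and $\approx$ means $\lesssim$ and $\gtrsim$. A *quasi-Banach space* is a vector space complete for a quasi-norm; it is *locally convex* if its quasi-norm is equivalent to a norm. A *basis* of $\mathbb X$ is a sequence $\mathcal X=(x_n)_{n\ge1}$ with $[\mathcal X]=\mathbb X$ ($[\cdot]$ is the closed linear span) that has a (unique) *dual basis* $(x_n^*)$ in $\mathbb X^*$, $x_n^*(x_k)=\delta_{k,n}$; it is *total* if the coefficient transform $f\mapsto(x_n^*(f))_n$ is one-to-one, *semi-normalized* if $0<\inf_n\|x_n\|\le\sup_n\|x_n\|<\infty$, and *$M$-bounded* if $\sup_n\|x_n\|\|x_n^*\|<\infty$. Put $\mathbb 1_{\varepsilon,A}=\sum_{n\in A}\varepsilon_nx_n$ for a finite set $A$ and $|\varepsilon_n|=1$. A basis is *UCC* if $\|\mathbb 1_{\varepsilon,A}\|\le C\|\mathbb 1_{\varepsilon,B}\|$ for all finite $B$, $A\subseteq B$ and $\varepsilon$; it is *truncation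 quasi-greedy* if $\min_{n\in A}|x_n^*(f)|\,\|\mathbb 1_{\varepsilon(f),A}\|\le C\|f\|$ for all $f$ and all finite $A$ with $|x_n^*(f)|\ge|x_k^*(f)|$ for $n\in A$, $k\notin A$, where $\varepsilon(f)_n=\operatorname{sgn}(x_n^*(f))$, $\operatorname{sgn}0=1$. Let $\tilde{\boldsymbol k}_m[\mathcal X,\mathbb X]$ be the supremum of $\|\sum_{n\in A}x_n^*(f)x_n\|$ over $\|f\|\le1$, $f\in[x_j:j\le m]$, $A\subseteq\mathbb N$. A *sequence space* is a quasi-Banach space $\mathbb S$ of scalar sequences that contains the space $c_{00}$ of eventually null sequences densely and has continuous coordinate functionals. It is *symmetric* if $\|\sum\varepsilon_na_ne_{\pi(n)}\|=\|\sum a_ne_n\|$ for all $(a_n)\in c_{00}$, $|\varepsilon_n|=1$ and permutations $\pi$ of $\mathbb N$; then $\Lambda_m[\mathbb S]$ is the common value of $\|\mathbb 1_A\|_{\mathbb S}$ over $|A|=m$, and $\Lambda_0=0$. A basis is *squeeze-symmetric* if there are symmetric sequence spaces $\mathbb S_1,\mathbb S_2$ with $\Lambda_m[\mathbb S_1]\approx\Lambda_m[\mathbb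 S_2]$ such that the series transform $(a_n)\mapsto\sum a_nx_n$ is bounded from $\mathbb S_1$ into $\mathbb X$ and the coefficient transform is bounded from $\mathbb X$ into $\mathbb S_2$. For a sequence $w$ with $s_n=\sum_{k\le n}w_k>0$, $d_1(w)$ and $d_\infty(w)$ are the spaces of all $f\in c_0$ with non-increasing rearrangement $(a_n^*)$ such that, respectively, $\|f\|_{d_1(w)}=\sum_na_n^*w_n<\infty$ (for $w_n\ge0$) and $\|f\|_{d_\infty(w)}=\sup_na_n^*s_n<\infty$. **The construction.** Let $\mathbb S$ be a locally convex symmetric sequence space, $\Lambda_m=\Lambda_m[\mathbb S]$. Let $\sigma=(\sigma_n)_{n\ge1}$ be an ordered partition of $\mathbb N$ (a partition into non-empty finite sets with $\max\sigma_n<\min\sigma_{n+1}$) with $|\sigma_n|\ge2$ for all $n$, and put $M_n=\sum_{k=1}^n|\sigma_k|$, $M_0=0$. Let $\mathcal X=(x_n)$ be a linearly independent sequence in a quasi-Banach space $\mathbb X$ with $[\mathcal X]=\mathbb X$. For $f=(a_k)\in c_{00}$ let $\operatorname{Ave}(f,A)=|A|^{-1}\sum_{k\in A}a_k$, $v_n^*(f)=\Lambda_{|\sigma_n|}\operatorname{Ave}(f,\sigma_n)$,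 let $P_\sigma f$ be the sequence equal to $\operatorname{Ave}(f,\sigma_n)$ on each $\sigma_n$, $Q_\sigma f=f-P_\sigma f$, and $$\|f\|_{\mathcal X,\mathbb S,\sigma}=\|Q_\sigma f\|_{\mathbb S}+\Big\|\sum_nv_n^*(f)\,x_n\Big\|_{\mathbb X}.$$ Let $\mathbb Y=\mathbb Y[\mathcal X,\mathbb S,\sigma]$ be the completion of $c_{00}$ with this quasi-norm, and $\mathcal E=(e_k)$ the unit vector system. (The same definition is used below with $\mathbb S^*$, whose norm on $c_{00}$ is the one dual to $\|\cdot\|_{\mathbb S}$ under $\langle f,g\rangle=\sum_nf_ng_n$, in place of $\mathbb S$.) **Proposition.** $\mathcal E$ is a basis of $\mathbb Y$ if and only if $\mathcal X$ is a basis of $\mathbb X$. Moreover, if $\mathcal X$ is a basis of $\mathbb X$, the following hold. 1. $\mathcal E$ is a total basis of $\mathbb Y$ if and only if $\mathcal X$ is a total basis of $\mathbb X$. 2. The dual basis $(e_k^*)$ of $\mathcal E$ is equivalent to the unit vector system of $\mathbb Y[\mathcal B,\mathbb S^*,\sigma]$, where $\mathcal B=(x_n^*/\|v_n^*\|_{\mathbb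 S^*})_n$; that is, $\|\sum_ka_ke_k^*\|_{\mathbb Y^*}\approx\|(a_k)\|_{\mathcal B,\mathbb S^*,\sigma}$ for $(a_k)\in c_{00}$. 3. $\|e_k\|_{\mathbb Y}\approx\max\{1,\|x_n\|\Lambda_{|\sigma_n|}/|\sigma_n|\}$ for $n\in\mathbb N$ and $k\in\sigma_n$. 4. $\|e_k^*\|_{\mathbb Y^*}\approx\max\{1,\|x_n^*\|/\Lambda_{|\sigma_n|}\}$ for $n\in\mathbb N$ and $k\in\sigma_n$. 5. $\mathcal E$ is semi-normalized and $M$-bounded if and only if $\|x_n\|\lesssim|\sigma_n|/\Lambda_{|\sigma_n|}$ and $\|x_n^*\|\lesssim\Lambda_{|\sigma_n|}$ for $n\in\mathbb N$. 6. $\tilde{\boldsymbol k}_{M_n}[\mathcal E,\mathbb Y]\gtrsim\tilde{\boldsymbol k}_n[\mathcal X,\mathbb X]$ for $n\in\mathbb N$. 7. $\mathcal X$ is a Schauder basis of $\mathbb X$ if and only if the subspaces $\mathbb Y_n=[e_k:k\in\sigma_n]$ form a Schauder decomposition of $\mathbb Y$. 8. If $\mathcal E$ is a UCC basis of $\mathbb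 Y$, then $\mathcal X$ is semi-normalized. 9. The block basic sequence $(\sum_{k\in\sigma_n}e_k)_n$ is isometrically equivalent to $(t_nx_n)_n$ for some non-zero scalars $t_n$. 10. Suppose that $\mathbb X$ is locally convex, that $\mathcal X$ is semi-normalized and $M$-bounded, and that $1+M_{n-1}\lesssim|\sigma_n|$ for $n\in\mathbb N$. Put $w=(\Lambda_n-\Lambda_{n-1})_{n\ge1}$ and $u=(\Lambda_n/n)_{n\ge1}$. Then $d_1(u)\subseteq\mathbb Y\subseteq d_\infty(w)$ continuously, in the sense that the series $\sum_kf_ke_k$ converges in $\mathbb Y$ for $f\in d_1(u)$, its sum has coefficients $e_k^*$ equal to $f_k$ and quasi-norm $\lesssim\|f\|_{d_1(u)}$, and that the coefficient transform maps $\mathbb Y$ boundedly into $d_\infty(w)$ and is one-to-one if $\mathcal X$ is total. 11. Suppose that $\mathbb X$ is locally convex, that $(\Lambda_m)$ has the lower regularity property (there is an integer $b\ge1$ with $2\Lambda_m\le\Lambda_{bm}$ for all $m\ge1$), and that $M_n\lesssim|\sigma_n|$ for $n\in\mathbb N$. Then the following are equivalent: (a) $\mathcal E$ is a squeeze-symmetric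 basis of $\mathbb Y$; (b) $\mathcal E$ is a truncation quasi-greedy basis of $\mathbb Y$; (c) $\mathcal X$ is a semi-normalized $M$-bounded basis of $\mathbb X$. -/

import Mathlib

open Filter Topology

noncomputable section

namespace DKK

/-! ## Quasi-norms -/

/-- A quasi-norm on a vector space over the real or complex field. No continuity of the quasi-norm
with respect to the topology that it defines is required. -/
structure QuasiNorm (𝕜 E : Type*) [RCLike 𝕜] [AddCommGroup E] [Module 𝕜 E] where
  toFun : E → ℝ
  nonneg' : ∀ x, 0 ≤ toFun x
  eq_zero' : ∀ x, toFun x = 0 → x = 0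
  smul' : ∀ (c : 𝕜) (x : E), toFun (c • x) = ‖c‖ * toFun x
  add_le' : ∃ κ : ℝ, 1 ≤ κ ∧ ∀ x y, toFun (x + y) ≤ κ * (toFun x + toFun y)

namespace QuasiNorm

variable {𝕜 E F : Type*} [RCLike 𝕜] [AddCommGroup E] [Module 𝕜 E] [AddCommGroup F] [Module 𝕜 F]

instance : CoeFun (QuasiNorm 𝕜 E) (fun _ => E → ℝ) := ⟨toFun⟩

theorem map_zero (N : QuasiNorm 𝕜 E) : N 0 = 0 := by
  have h := N.smul' 0 0
  simpa using h

theorem map_neg (N : QuasiNorm 𝕜 E) (x : E) : N (-x) = N x := by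
  have h := N.smul' (-1) x
  simpa using h

/-- Convergence of a sequence for the topology defined by the quasi-norm. -/
def ConvergesTo (N : QuasiNorm 𝕜 E) (u : ℕ → E) (x : E) : Prop :=
  Tendsto (fun n => N (u n - x)) atTop (𝓝 0)

/-- A quasi-normed space is a quasi-Banach space if every Cauchy sequence converges. -/
def IsComplete (N : QuasiNorm 𝕜 E) : Prop :=
  ∀ u : ℕ → E, (∀ ε > 0, ∃ n₀, ∀ m ≥ n₀, ∀ n ≥ n₀, N (u m - u n) < ε) → ∃ x, N.ConvergesTo u x

/-- Local convexity: the quasi-norm is equivalent to a norm. -/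
def IsLocallyConvex (N : QuasiNorm 𝕜 E) : Prop :=
  ∃ (q : Seminorm 𝕜 E) (C : ℝ), ∀ x, N x ≤ C * q x ∧ q x ≤ C * N x

/-- The closure of a linear subspace. -/
def closure (N : QuasiNorm 𝕜 E) (W : Submodule 𝕜 E) : Submodule 𝕜 E where
  carrier := {y | ∀ ε > 0, ∃ z ∈ W, N (y - z) < ε}
  zero_mem' := fun ε hε => ⟨0, W.zero_mem, by simpa [N.map_zero] using hε⟩
  add_mem' := by
    rintro a b ha hb ε hε
    obtain ⟨κ, hκ, hadd⟩ := N.add_le'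
    have hκ0 : 0 < κ := by linarith
    obtain ⟨z, hz, hz'⟩ := ha (ε / (2 * κ)) (by positivity)
    obtain ⟨w, hw, hw'⟩ := hb (ε / (2 * κ)) (by positivity)
    refine ⟨z + w, W.add_mem hz hw, ?_⟩
    have e : a + b - (z + w) = (a - z) + (b - w) := by abel
    rw [e]
    refine (hadd _ _).trans_lt ?_
    have : κ * (N (a - z) + N (b - w)) < κ * (ε / (2 * κ) + ε / (2 * κ)) := by gcongr
    refine this.trans_eq ?_
    field_simp
    ring
  smul_mem' := by
    rintro c a ha ε hε
    obtain ⟨z, hz, hz'⟩ := ha (ε / (‖c‖ + 1)) (by positivity)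
    refine ⟨c • z, W.smul_mem c hz, ?_⟩
    rw [← smul_sub, N.smul']
    have h0 := N.nonneg' (a - z)
    have h1 : (‖c‖ + 1) * N (a - z) < ε := by
      rw [lt_div_iff₀ (by positivity)] at hz'
      linarith
    linarith

/-- The closed linear span `[s]`. -/
def closedSpan (N : QuasiNorm 𝕜 E) (s : Set E) : Submodule 𝕜 E :=
  N.closure (Submodule.span 𝕜 s)

/-- A linear functional is bounded if it is continuous for the quasi-norm. -/
def IsBounded (N : QuasiNorm 𝕜 E) (φ : E →ₗ[𝕜] 𝕜) : Prop :=
  ∃ C : ℝ, ∀ x, ‖φ x‖ ≤ C * N x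

/-- The norm in the dual space of a bounded functional: the supremum over the closed unit ball. -/
def dualNorm (N : QuasiNorm 𝕜 E) (φ : E →ₗ[𝕜] 𝕜) : ℝ :=
  sSup {r | ∃ x, N x ≤ 1 ∧ r = ‖φ x‖}

end QuasiNorm

/-! ## Bases -/

section Bases

variable {𝕜 E : Type*} [RCLike 𝕜] [AddCommGroup E] [Module 𝕜 E]

/-- `x` is a basis whose dual basis is `xs`: `x` generates the whole space, and the functionals `xs`
are bounded and biorthogonal to `x`. Such functionals are unique. -/
structure IsBasisWithDual (N : QuasiNorm 𝕜 E) (x : ℕ → E) (xs : ℕ → E →ₗ[𝕜] 𝕜) : Prop where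
  generates : N.closedSpan (Set.range x) = ⊤
  bounded : ∀ n, N.IsBounded (xs n)
  biorthogonal : ∀ n k, xs n (x k) = if k = n then 1 else 0

def IsBasis (N : QuasiNorm 𝕜 E) (x : ℕ → E) : Prop :=
  ∃ xs, IsBasisWithDual N x xs

/-- A basis is total if its coefficient transform is one-to-one. -/
def IsTotalBasis (N : QuasiNorm 𝕜 E) (x : ℕ → E) : Prop :=
  ∃ xs, IsBasisWithDual N x xs ∧ Function.Injective (fun (f : E) (n : ℕ) => xs n f)

/-- Every vector has a unique expansion as a convergent series. -/
def IsSchauderBasis (N : QuasiNorm 𝕜 E) (x : ℕ → E) : Prop :=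
  ∀ f, ∃! a : ℕ → 𝕜, N.ConvergesTo (fun m => ∑ n ∈ Finset.range m, a n • x n) f

/-- Closed subspaces such that every vector has a unique expansion as a convergent series with
terms in the subspaces, and such that the associated coordinate projections are continuous. -/
structure IsSchauderDecomposition (N : QuasiNorm 𝕜 E) (W : ℕ → Submodule 𝕜 E) : Prop where
  closed : ∀ n, N.closure (W n) = W n
  expansion : ∀ f, ∃! y : ℕ → E, (∀ n, y n ∈ W n) ∧
    N.ConvergesTo (fun m => ∑ n ∈ Finset.range m, y n) f
  continuous : ∀ n, ∃ C : ℝ, ∀ (f : E) (y : ℕ → E), (∀ k, y k ∈ W k) →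
    N.ConvergesTo (fun m => ∑ k ∈ Finset.range m, y k) f → N (y n) ≤ C * N f

def IsSemiNormalized (N : QuasiNorm 𝕜 E) (x : ℕ → E) : Prop :=
  ∃ c C : ℝ, 0 < c ∧ ∀ n, c ≤ N (x n) ∧ N (x n) ≤ C

def IsMBounded (N : QuasiNorm 𝕜 E) (x : ℕ → E) (xs : ℕ → E →ₗ[𝕜] 𝕜) : Prop :=
  ∃ C : ℝ, ∀ n, N (x n) * N.dualNorm (xs n) ≤ C

/-- The coordinate projection `S_A`. -/
def coordProj (x : ℕ → E) (xs : ℕ → E →ₗ[𝕜] 𝕜) (A : Finset ℕ) (f : E) : E :=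
  ∑ n ∈ A, xs n f • x n

/-- The unconditionality-type parameter
`k̃_m = sup {‖S_A f‖ : ‖f‖ ≤ 1, f ∈ [x_j : j among the first m indices], A ⊆ ℕ}`.
Only finitely many coordinates of such an `f` are non-zero, so finite sets `A` suffice. -/
def ktilde (N : QuasiNorm 𝕜 E) (x : ℕ → E) (xs : ℕ → E →ₗ[𝕜] 𝕜) (m : ℕ) : ENNReal :=
  ⨆ (f : E) (_ : N f ≤ 1) (_ : f ∈ N.closedSpan (x '' {j | j < m})) (A : Finset ℕ),
    ENNReal.ofReal (N (coordProj x xs A f))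

/-- The vector `1_{ε,A} = ∑_{n ∈ A} ε_n x_n`. -/
def signedSum (x : ℕ → E) (ε : ℕ → 𝕜) (A : Finset ℕ) : E :=
  ∑ n ∈ A, ε n • x n

/-- Unconditionality for constant coefficients. -/
def IsUCC (N : QuasiNorm 𝕜 E) (x : ℕ → E) : Prop :=
  ∃ C : ℝ, ∀ A B : Finset ℕ, A ⊆ B → ∀ ε : ℕ → 𝕜, (∀ n, ‖ε n‖ = 1) →
    N (signedSum x ε A) ≤ C * N (signedSum x ε B)

/-- The sign function, with the convention `sgn 0 = 1`. -/
def sgn (z : 𝕜) : 𝕜 := if z = 0 then 1 else z / (‖z‖ : 𝕜)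

/-- `A` is a greedy set of `f`. -/
def IsGreedySet (xs : ℕ → E →ₗ[𝕜] 𝕜) (f : E) (A : Finset ℕ) : Prop :=
  ∀ n ∈ A, ∀ k ∉ A, ‖xs k f‖ ≤ ‖xs n f‖

def IsTruncationQuasiGreedy (N : QuasiNorm 𝕜 E) (x : ℕ → E) (xs : ℕ → E →ₗ[𝕜] 𝕜) : Prop :=
  ∃ C : ℝ, ∀ (f : E) (A : Finset ℕ) (hA : A.Nonempty), IsGreedySet xs f A →
    A.inf' hA (fun n => ‖xs n f‖) * N (signedSum x (fun n => sgn (xs n f)) A) ≤ C * N f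

end Bases

/-! ## Sequence spaces. The space `c₀₀` of eventually null sequences is `ℕ →₀ 𝕜`. -/

/-- A sequence space: a quasi-Banach space of scalar sequences that contains `c₀₀` as a dense
subspace and has continuous coordinate functionals. -/
structure SequenceSpace (𝕜 : Type*) [RCLike 𝕜] where
  carrier : Submodule 𝕜 (ℕ → 𝕜)
  qnorm : QuasiNorm 𝕜 carrier
  complete : qnorm.IsComplete
  c00_mem : ∀ f : ℕ →₀ 𝕜, (f : ℕ → 𝕜) ∈ carrier
  dense : ∀ (f : carrier), ∀ ε > 0, ∃ g : ℕ →₀ 𝕜, qnorm (f - ⟨g, c00_mem g⟩) < ε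
  coord_bounded : ∀ n, ∃ C : ℝ, ∀ f : carrier, ‖f.1 n‖ ≤ C * qnorm f

/-- The vector `1_A` of `c₀₀`. -/
def ind (𝕜 : Type*) [RCLike 𝕜] (A : Finset ℕ) : ℕ →₀ 𝕜 :=
  ∑ k ∈ A, Finsupp.single k 1

namespace SequenceSpace

variable {𝕜 : Type*} [RCLike 𝕜]

/-- The quasi-norm of `S` on `c₀₀`. -/
def norm00 (S : SequenceSpace 𝕜) (f : ℕ →₀ 𝕜) : ℝ := S.qnorm ⟨f, S.c00_mem f⟩

/-- Symmetric sequence spaces: the unit vector system is 1-symmetric. -/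
def IsSymmetric (S : SequenceSpace 𝕜) : Prop :=
  ∀ (a : ℕ →₀ 𝕜) (ε : ℕ → 𝕜) (π : Equiv.Perm ℕ), (∀ n, ‖ε n‖ = 1) →
    S.norm00 (a.sum fun n c => Finsupp.single (π n) (ε n * c)) = S.norm00 a

/-- The norm of `S^*` on `c₀₀`, under the pairing `⟨f, g⟩ = ∑ f_n g_n` (the supremum runs over the
dense subspace `c₀₀` of `S`). -/
def dualNorm00 (S : SequenceSpace 𝕜) (g : ℕ →₀ 𝕜) : ℝ :=
  sSup {r | ∃ f : ℕ →₀ 𝕜, S.norm00 f ≤ 1 ∧ r = ‖f.sum fun n c => c * g n‖}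

end SequenceSpace

/-- The fundamental function `Λ_m = ‖1_A‖`, `|A| = m`, of a symmetric quasi-norm on `c₀₀`. -/
def fundamental {𝕜 : Type*} [RCLike 𝕜] (NS : (ℕ →₀ 𝕜) → ℝ) (m : ℕ) : ℝ :=
  NS (ind 𝕜 (Finset.range m))

/-- The lower regularity property of `(Γ_m)_{m ≥ 1}`. -/
def HasLRP (Γ : ℕ → ℝ) : Prop :=
  ∃ b : ℕ, 0 < b ∧ ∀ m, 1 ≤ m → 2 * Γ m ≤ Γ (b * m)

/-- Squeeze-symmetric bases. -/
def IsSqueezeSymmetric {𝕜 E : Type*} [RCLike 𝕜] [AddCommGroup E] [Module 𝕜 E]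
    (N : QuasiNorm 𝕜 E) (x : ℕ → E) (xs : ℕ → E →ₗ[𝕜] 𝕜) : Prop :=
  ∃ S₁ S₂ : SequenceSpace 𝕜, S₁.IsSymmetric ∧ S₂.IsSymmetric ∧
    (∃ C : ℝ, ∀ a : S₁.carrier, ∃ f : E,
      N.ConvergesTo (fun m => ∑ n ∈ Finset.range m, a.1 n • x n) f ∧ N f ≤ C * S₁.qnorm a) ∧
    (∃ C : ℝ, ∀ f : E, ∃ h : (fun n => xs n f) ∈ S₂.carrier,
      S₂.qnorm ⟨fun n => xs n f, h⟩ ≤ C * N f) ∧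
    ∃ c C : ℝ, 0 < c ∧ ∀ m, 1 ≤ m →
      c * fundamental S₁.norm00 m ≤ fundamental S₂.norm00 m ∧
      fundamental S₂.norm00 m ≤ C * fundamental S₁.norm00 m

/-! ## Lorentz sequence spaces -/

section Lorentz

variable {𝕜 : Type*} [RCLike 𝕜]

/-- Non-increasing rearrangement of `(|f_n|)`, for `f ∈ c₀`; the largest term has index `0`. -/
def rearrangement (f : ℕ → 𝕜) (n : ℕ) : ℝ :=
  sInf {t : ℝ | 0 ≤ t ∧ {k | t < ‖f k‖}.encard ≤ n}

/-- The primitive sequence of a weight: `s_n` is the sum of the terms up to and including `w_n`. -/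
def primitive (w : ℕ → ℝ) (n : ℕ) : ℝ := ∑ k ∈ Finset.range (n + 1), w k

/-- The quasi-norm of the Lorentz sequence space `d_q(w)`, `0 < q < ∞`. -/
def lorentzNorm (q : ℝ) (w : ℕ → ℝ) (f : ℕ → 𝕜) : ENNReal :=
  (∑' n, ENNReal.ofReal ((primitive w n * rearrangement f n) ^ q * (w n / primitive w n))) ^ (1 / q)

/-- The quasi-norm of the weak Lorentz sequence space `d_∞(w)`. -/
def weakLorentzNorm (w : ℕ → ℝ) (f : ℕ → 𝕜) : ENNReal :=
  ⨆ n, ENNReal.ofReal (rearrangement f n * primitive w n)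

/-- Membership in `d_q(w)`. -/
def MemLorentz (q : ℝ) (w : ℕ → ℝ) (f : ℕ → 𝕜) : Prop :=
  Tendsto f atTop (𝓝 0) ∧ lorentzNorm q w f < ⊤

/-- Membership in `d_∞(w)`. -/
def MemWeakLorentz (w : ℕ → ℝ) (f : ℕ → 𝕜) : Prop :=
  Tendsto f atTop (𝓝 0) ∧ weakLorentzNorm w f < ⊤

end Lorentz

/-! ## The Dilworth–Kalton–Kutzarova construction -/

/-- An ordered partition of `ℕ`: a partition into finite non-empty sets with
`max σ_m < min σ_n` for `m < n`. -/
structure IsOrderedPartition (σ : ℕ → Finset ℕ) : Prop where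
  nonempty : ∀ n, (σ n).Nonempty
  cover : ∀ k, ∃ n, k ∈ σ n
  ordered : ∀ m n, m < n → ∀ i ∈ σ m, ∀ j ∈ σ n, i < j

section Construction

variable {𝕜 E : Type*} [RCLike 𝕜] [AddCommGroup E] [Module 𝕜 E]

/-- The average of `f` on `A`. -/
def ave (f : ℕ →₀ 𝕜) (A : Finset ℕ) : 𝕜 := (A.card : 𝕜)⁻¹ * ∑ k ∈ A, f k

/-- The averaging projection `P_σ` on `c₀₀`, which replaces `f` by its average on each `σ_n`. -/
def avgProj (σ : ℕ → Finset ℕ) (f : ℕ →₀ 𝕜) : ℕ →₀ 𝕜 := ∑ᶠ n, ave f (σ n) • ind 𝕜 (σ n)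

/-- `v_n^*(f) = Λ_{|σ_n|} Ave(f, σ_n)`. -/
def vstar (NS : (ℕ →₀ 𝕜) → ℝ) (σ : ℕ → Finset ℕ) (n : ℕ) (f : ℕ →₀ 𝕜) : 𝕜 :=
  (fundamental NS (σ n).card : 𝕜) * ave f (σ n)

/-- The linear combination `∑ v_n^*(f) x_n` (a finite sum). -/
def blockSum (NS : (ℕ →₀ 𝕜) → ℝ) (σ : ℕ → Finset ℕ) (x : ℕ → E) (f : ℕ →₀ 𝕜) : E :=
  ∑ᶠ n, vstar NS σ n f • x n

/-- The quasi-norm `‖f‖_{X,S,σ} = ‖Q_σ f‖_S + ‖∑ v_n^*(f) x_n‖` on `c₀₀`, where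
`Q_σ f = f - P_σ f`. It depends on the space `S` only through its quasi-norm `NS` on `c₀₀`. -/
def dkkNorm (NS : (ℕ →₀ 𝕜) → ℝ) (σ : ℕ → Finset ℕ) (N : E → ℝ) (x : ℕ → E) (f : ℕ →₀ 𝕜) : ℝ :=
  NS (f - avgProj σ f) + N (blockSum NS σ x f)

/-- `(Y, NY)`, with the map `ι` from `c₀₀`, is a completion of `c₀₀` endowed with `N₀`. -/
structure IsCompletion {Y : Type*} [AddCommGroup Y] [Module 𝕜 Y] (N₀ : (ℕ →₀ 𝕜) → ℝ)
    (NY : QuasiNorm 𝕜 Y) (ι : (ℕ →₀ 𝕜) →ₗ[𝕜] Y) : Prop where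
  complete : NY.IsComplete
  isometric : ∀ f, NY (ι f) = N₀ f
  dense : ∀ y, ∀ ε > 0, ∃ f, NY (y - ι f) < ε

/-- The unit vector system, seen in a completion of `c₀₀`. -/
def unitVec {Y : Type*} [AddCommGroup Y] [Module 𝕜 Y] (ι : (ℕ →₀ 𝕜) →ₗ[𝕜] Y) (k : ℕ) : Y :=
  ι (Finsupp.single k 1)

/-- `B_n = x_n^* / ‖v_n^*‖`, the norm of `v_n^* = (Λ_{|σ_n|} / |σ_n|) 1_{σ_n}` being that of `S^*`. -/
def dualBlocks (S : SequenceSpace 𝕜) (σ : ℕ → Finset ℕ) (xs : ℕ → E →ₗ[𝕜] 𝕜) (n : ℕ) :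
    E →ₗ[𝕜] 𝕜 :=
  ((S.dualNorm00 (((fundamental S.norm00 (σ n).card / (σ n).card : ℝ) : 𝕜) • ind 𝕜 (σ n)) : ℝ)
    : 𝕜)⁻¹ • xs n

end Construction

/-! ## Completions of `c₀₀` for the quasi-norm above do exist -/

section Existence

variable {𝕜 E F : Type*} [RCLike 𝕜] [AddCommGroup E] [Module 𝕜 E] [AddCommGroup F] [Module 𝕜 F]

/-- The sum quasi-norm on a direct sum. -/
def QuasiNorm.prod (N : QuasiNorm 𝕜 E) (M : QuasiNorm 𝕜 F) : QuasiNorm 𝕜 (E × F) where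
  toFun p := N p.1 + M p.2
  nonneg' p := add_nonneg (N.nonneg' _) (M.nonneg' _)
  eq_zero' p h := by
    have h1 := N.nonneg' p.1
    have h2 := M.nonneg' p.2
    exact Prod.ext (N.eq_zero' _ (by linarith)) (M.eq_zero' _ (by linarith))
  smul' c p := by simp [N.smul', M.smul', mul_add]
  add_le' := by
    obtain ⟨κ, hκ, h⟩ := N.add_le'
    obtain ⟨μ, hμ, h'⟩ := M.add_le'
    refine ⟨max κ μ, le_max_of_le_left hκ, fun x y => ?_⟩
    have a1 := add_nonneg (N.nonneg' x.1) (N.nonneg' y.1)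
    have a2 := add_nonneg (M.nonneg' x.2) (M.nonneg' y.2)
    have b1 := mul_le_mul_of_nonneg_right (le_max_left κ μ) a1
    have b2 := mul_le_mul_of_nonneg_right (le_max_right κ μ) a2
    have c1 := h x.1 y.1
    have c2 := h' x.2 y.2
    simp only [Prod.fst_add, Prod.snd_add]
    nlinarith

/-- The restriction of a quasi-norm to a subspace. -/
def QuasiNorm.restrict (N : QuasiNorm 𝕜 E) (W : Submodule 𝕜 E) : QuasiNorm 𝕜 W where
  toFun x := N x
  nonneg' x := N.nonneg' _
  eq_zero' x h := Subtype.ext (N.eq_zero' _ h)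
  smul' c x := N.smul' _ _
  add_le' := by
    obtain ⟨κ, hκ, h⟩ := N.add_le'
    exact ⟨κ, hκ, fun x y => h _ _⟩

theorem QuasiNorm.prod_isComplete {N : QuasiNorm 𝕜 E} {M : QuasiNorm 𝕜 F} (hN : N.IsComplete)
    (hM : M.IsComplete) : (N.prod M).IsComplete := by
  intro u hu
  obtain ⟨x, hx⟩ := hN (fun n => (u n).1) (fun ε hε => by
    obtain ⟨n₀, h⟩ := hu ε hε
    refine ⟨n₀, fun m hm n hn => lt_of_le_of_lt ?_ (h m hm n hn)⟩
    exact le_add_of_nonneg_right (M.nonneg' _))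
  obtain ⟨y, hy⟩ := hM (fun n => (u n).2) (fun ε hε => by
    obtain ⟨n₀, h⟩ := hu ε hε
    refine ⟨n₀, fun m hm n hn => lt_of_le_of_lt ?_ (h m hm n hn)⟩
    exact le_add_of_nonneg_left (N.nonneg' _))
  refine ⟨(x, y), ?_⟩
  have := Tendsto.add hx hy
  simpa [QuasiNorm.ConvergesTo, QuasiNorm.prod] using this

theorem QuasiNorm.closure_isComplete {N : QuasiNorm 𝕜 E} (hN : N.IsComplete)
    (W : Submodule 𝕜 E) : (N.restrict (N.closure W)).IsComplete := by
  intro u hu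
  obtain ⟨x, hx⟩ := hN (fun n => (u n : E)) hu
  obtain ⟨κ, hκ, hadd⟩ := N.add_le'
  have hκ0 : 0 < κ := by linarith
  have hxW : x ∈ N.closure W := by
    intro ε hε
    obtain ⟨n, hn⟩ := (hx.eventually (gt_mem_nhds (show 0 < ε / (2 * κ) by positivity))).exists
    obtain ⟨z, hz, hz'⟩ := (u n).2 (ε / (2 * κ)) (by positivity)
    refine ⟨z, hz, ?_⟩
    have e : x - z = -((u n : E) - x) + ((u n : E) - z) := by abel
    rw [e]
    refine (hadd _ _).trans_lt ?_
    rw [N.map_neg]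
    have : κ * (N ((u n : E) - x) + N ((u n : E) - z)) < κ * (ε / (2 * κ) + ε / (2 * κ)) := by
      gcongr
    refine this.trans_eq ?_
    field_simp
    ring
  exact ⟨⟨x, hxW⟩, hx⟩

theorem ave_add (f g : ℕ →₀ 𝕜) (A : Finset ℕ) : ave (f + g) A = ave f A + ave g A := by
  simp [ave, Finset.sum_add_distrib, mul_add]

theorem ave_smul (c : 𝕜) (f : ℕ →₀ 𝕜) (A : Finset ℕ) : ave (c • f) A = c * ave f A := by
  simp only [ave, Finsupp.smul_apply, smul_eq_mul, ← Finset.mul_sum]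
  ring

theorem IsOrderedPartition.finite_ave {σ : ℕ → Finset ℕ} (hσ : IsOrderedPartition σ)
    (f : ℕ →₀ 𝕜) : {n | ave f (σ n) ≠ 0}.Finite := by
  choose b hb using hσ.cover
  refine (f.support.image b).finite_toSet.subset fun n hn => ?_
  have : ∃ k ∈ σ n, f k ≠ 0 := by
    by_contra! h
    exact hn (by simp [ave, Finset.sum_eq_zero h])
  obtain ⟨k, hk, hfk⟩ := this
  simp only [Finset.coe_image, Set.mem_image, Finset.mem_coe, Finsupp.mem_support_iff]
  refine ⟨k, hfk, ?_⟩
  rcases lt_trichotomy (b k) n with h | h | h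
  · exact absurd (hσ.ordered _ _ h k (hb k) k hk) (lt_irrefl _)
  · exact h
  · exact absurd (hσ.ordered _ _ h k hk k (hb k)) (lt_irrefl _)

/-- Any finite sum of averages times fixed vectors is linear in `f`. -/
theorem isLinearMap_finsum {σ : ℕ → Finset ℕ} (hσ : IsOrderedPartition σ) (y : ℕ → E) :
    IsLinearMap 𝕜 (fun f : ℕ →₀ 𝕜 => ∑ᶠ n, ave f (σ n) • y n) := by
  have hfin : ∀ f : ℕ →₀ 𝕜, (Function.support fun n => ave f (σ n) • y n).Finite := fun f =>
    (hσ.finite_ave f).subset fun n hn h => hn (by simp [h])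
  constructor
  · intro f g
    rw [← finsum_add_distrib (hfin f) (hfin g)]
    simp only [ave_add, add_smul]
  · intro c f
    rw [smul_finsum' c (hfin f)]
    simp only [ave_smul, mul_smul]

/-- The completion exists: it is the closure of the isometric copy
`{(Q_σ f, ∑ v_n^*(f) x_n) : f ∈ c₀₀}` of `c₀₀` in the direct sum of the two spaces. -/
theorem exists_completion (S : SequenceSpace 𝕜) {σ : ℕ → Finset ℕ} (hσ : IsOrderedPartition σ)
    (N : QuasiNorm 𝕜 E) (hN : N.IsComplete) (x : ℕ → E) :
    ∃ (W : Submodule 𝕜 (S.carrier × E)) (NY : QuasiNorm 𝕜 W) (ι : (ℕ →₀ 𝕜) →ₗ[𝕜] W),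
      IsCompletion (dkkNorm S.norm00 σ N x) NY ι := by
  have h1 : IsLinearMap 𝕜 (avgProj (𝕜 := 𝕜) σ) := isLinearMap_finsum hσ _
  have h2 : IsLinearMap 𝕜 (blockSum (𝕜 := 𝕜) S.norm00 σ x) := by
    have := isLinearMap_finsum (𝕜 := 𝕜) hσ
      (fun n => (fundamental S.norm00 (σ n).card : 𝕜) • x n)
    have e : blockSum (𝕜 := 𝕜) S.norm00 σ x = fun f : ℕ →₀ 𝕜 =>
        ∑ᶠ n, ave f (σ n) • ((fundamental S.norm00 (σ n).card : 𝕜) • x n) := by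
      funext f
      simp only [blockSum, vstar, smul_smul, mul_comm]
    rwa [e]
  let j : (ℕ →₀ 𝕜) →ₗ[𝕜] S.carrier × E :=
    { toFun := fun f => (⟨⇑(f - avgProj σ f), S.c00_mem _⟩, blockSum S.norm00 σ x f)
      map_add' := by
        intro f g
        refine Prod.ext (Subtype.ext ?_) (h2.map_add f g)
        funext k
        simp only [h1.map_add, Finsupp.coe_sub, Finsupp.coe_add, Prod.fst_add, Submodule.coe_add,
          Pi.add_apply, Pi.sub_apply]
        ring
      map_smul' := by
        intro c f
        refine Prod.ext (Subtype.ext ?_) (h2.map_smul c f)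
        funext k
        simp only [h1.map_smul, Finsupp.coe_sub, Finsupp.coe_smul, Prod.smul_fst,
          Submodule.coe_smul, Pi.smul_apply, Pi.sub_apply, RingHom.id_apply, smul_eq_mul]
        ring }
  have hj : ∀ f, j f ∈ (S.qnorm.prod N).closure (LinearMap.range j) := fun f ε hε =>
    ⟨j f, ⟨f, rfl⟩, by simpa [QuasiNorm.map_zero] using hε⟩
  refine ⟨(S.qnorm.prod N).closure (LinearMap.range j), (S.qnorm.prod N).restrict _,
    j.codRestrict _ hj, QuasiNorm.closure_isComplete (QuasiNorm.prod_isComplete S.complete hN) _,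
    fun f => rfl, fun y ε hε => ?_⟩
  obtain ⟨z, ⟨f, rfl⟩, hf⟩ := y.2 ε hε
  exact ⟨f, hf⟩

end Existence

end DKK

end

/-!
Up to equivalence of quasi-norms, the completion `Y` is the direct sum of a complemented copy of
`X` and of a space of sequences measured by `S`. Three bounded maps make this precise (structure
`DKK.Frame`, existence in `DKK.exists_frame`), all obtained by density: `Q : Y → S` extends
`f ↦ f - P_σ f`, `T : Y → X` extends `f ↦ ∑ v_n^*(f) x_n`, and `J : X → Y` sends `x_n` to
`Λ_{|σ_n|}⁻¹ 1_{σ_n}`. Here `T J = id`, `Q J = 0`, and `NY y ≈ ‖Q y‖_S + NX (T y)`.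

If `x` has the dual basis `x^*`, the functionals `y ↦ (Q y)_k + Λ_{|σ_n|}⁻¹ x_n^*(T y)`, `k ∈ σ_n`,
are dual to the unit vectors (`DKK.Frame.dualVec`), and every question on the unit vector system
splits into one in `S` and one in `X`. Since `S` is locally convex, the projections `P_σ` are bounded
on `c₀₀`: on a given vector, `P_σ` is the mean of finitely many permutations
(`DKK.QuasiNorm.IsSymmetric.exists_avgProj_le`). This gives the norms of the unit vectors and of their
duals, and the description of the dual norm. The unconditionality parameters are compared through
`J`. The partial sums of the block expansion of `y` have as `Q`-component truncations of `Q y`, which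
always converge, and as `T`-component the partial sums of the expansion of `T y`.

If the unit vectors are UCC, then a half of `1_{σ_n}` is compared with a signed sum that has mean
zero on `σ_n` and so is measured in `S` alone; two halves and at most one more element make up the
block, which bounds `NX (x_n)` above. Comparing a half with the whole block bounds it below
(`DKK.Frame.isSemiNormalized_of_isUCC`).

For the Lorentz embeddings, `Λ` is replaced by an equivalent quasi-concave sequence `Φ`. When each
block is at least comparable to all the preceding ones together, signed sums over `m` indices have
norm `≲ ∑_{j ≤ m} Φ_j / j`, and summation by parts along a non-increasing enumeration of the
coefficients bounds the quasi-norm of `Y` by that of the Lorentz space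
(`DKK.Frame.exists_upper_lorentz`). Conversely, if the coefficients of `y` are at least `t` on `A`, then
either `Q y` is large on half of `A`, and `S` gives the estimate, or some `x_n^*(T y)` is large with
`|A| ≲ |σ_n|` (`DKK.Frame.exists_lower_weakLorentz`).

The lower regularity property gives the Lorentz and the weak Lorentz space equivalent fundamental
functions, so that the two estimates squeeze `Y` between symmetric spaces. Both are built as closures
of `c₀₀` for a gauge with the Fatou property (`DKK.IsFatouGauge`). A squeeze implies truncation
quasi-greediness, and the latter implies UCC, hence `NX (x_n) ≈ 1`. Applied to `J g` and to the greedy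
set of all its coefficients at least as large as those on `σ_n`, it also bounds the functionals `x_n^*`.
-/

noncomputable section

namespace DKK

/-! ### Quasi-norms, bounded maps and their extension by density -/

namespace QuasiNorm

variable {𝕜 E F G V : Type*} [RCLike 𝕜] [AddCommGroup E] [Module 𝕜 E] [AddCommGroup F]
  [Module 𝕜 F] [AddCommGroup G] [Module 𝕜 G] [AddCommGroup V] [Module 𝕜 V]

/-- A chosen modulus of concavity of a quasi-norm. -/
def modulus (N : QuasiNorm 𝕜 E) : ℝ := N.add_le'.choose

theorem one_le_modulus (N : QuasiNorm 𝕜 E) : 1 ≤ N.modulus := N.add_le'.choose_spec.1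

theorem modulus_pos (N : QuasiNorm 𝕜 E) : 0 < N.modulus := one_pos.trans_le N.one_le_modulus

theorem add_le (N : QuasiNorm 𝕜 E) (x y : E) : N (x + y) ≤ N.modulus * (N x + N y) :=
  N.add_le'.choose_spec.2 x y

theorem sub_le (N : QuasiNorm 𝕜 E) (x y : E) : N (x - y) ≤ N.modulus * (N x + N y) := by
  simpa [sub_eq_add_neg, N.map_neg] using N.add_le x (-y)

theorem sub_comm (N : QuasiNorm 𝕜 E) (x y : E) : N (x - y) = N (y - x) := by
  rw [← N.map_neg, neg_sub]

theorem le_add_sub (N : QuasiNorm 𝕜 E) (x y : E) : N x ≤ N.modulus * (N y + N (x - y)) := by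
  simpa using N.add_le y (x - y)

theorem sub_le_sub_add_sub (N : QuasiNorm 𝕜 E) (x y z : E) :
    N (x - z) ≤ N.modulus * (N (x - y) + N (y - z)) := by
  simpa using N.add_le (x - y) (y - z)

theorem pos_of_ne_zero (N : QuasiNorm 𝕜 E) {x : E} (hx : x ≠ 0) : 0 < N x :=
  lt_of_le_of_ne (N.nonneg' x) fun h => hx (N.eq_zero' x h.symm)

/-- The inequality `‖∑ f_i‖ ≤ C ∑ ‖f_i‖`, with a constant that depends on the number of terms. -/
theorem sum_le (N : QuasiNorm 𝕜 E) {α : Type*} (s : Finset α) (f : α → E) :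
    N (∑ i ∈ s, f i) ≤ N.modulus ^ s.card * ∑ i ∈ s, N (f i) := by
  classical
  induction s using Finset.induction_on with
  | empty => simp [N.map_zero]
  | insert a s ha ih =>
    rw [Finset.sum_insert ha, Finset.sum_insert ha, Finset.card_insert_of_notMem ha]
    refine (N.add_le _ _).trans ?_
    have h1 : 1 ≤ N.modulus ^ s.card := one_le_pow₀ N.one_le_modulus
    have h2 := N.modulus_pos
    have h3 : N (f a) ≤ N.modulus ^ s.card * N (f a) := le_mul_of_one_le_left (N.nonneg' _) h1
    calc N.modulus * (N (f a) + N (∑ i ∈ s, f i))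
        ≤ N.modulus * (N.modulus ^ s.card * N (f a) + N.modulus ^ s.card * ∑ i ∈ s, N (f i)) := by
          gcongr
      _ = _ := by ring

/-- The absolute value as a quasi-norm on the scalar field. -/
def scalar (𝕜 : Type*) [RCLike 𝕜] : QuasiNorm 𝕜 𝕜 where
  toFun z := ‖z‖
  nonneg' _ := norm_nonneg _
  eq_zero' _ h := norm_eq_zero.1 h
  smul' _ _ := norm_mul _ _
  add_le' := ⟨1, le_rfl, fun x y => by simpa using norm_add_le x y⟩

/-- Boundedness of a linear map between quasi-normed spaces. -/
def BoundedMap (N : QuasiNorm 𝕜 E) (M : QuasiNorm 𝕜 F) (L : E →ₗ[𝕜] F) : Prop :=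
  ∃ C : ℝ, ∀ x, M (L x) ≤ C * N x

theorem BoundedMap.exists_pos {N : QuasiNorm 𝕜 E} {M : QuasiNorm 𝕜 F} {L : E →ₗ[𝕜] F}
    (h : BoundedMap N M L) : ∃ C : ℝ, 0 < C ∧ ∀ x, M (L x) ≤ C * N x := by
  obtain ⟨C, hC⟩ := h
  exact ⟨max C 1, by positivity, fun x => (hC x).trans
    (mul_le_mul_of_nonneg_right (le_max_left _ _) (N.nonneg' _))⟩

theorem BoundedMap.comp {N : QuasiNorm 𝕜 E} {M : QuasiNorm 𝕜 F} {P : QuasiNorm 𝕜 G}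
    {L : E →ₗ[𝕜] F} {K : F →ₗ[𝕜] G} (hK : BoundedMap M P K) (hL : BoundedMap N M L) :
    BoundedMap N P (K ∘ₗ L) := by
  obtain ⟨C, h0, hC⟩ := hK.exists_pos
  obtain ⟨D, hD⟩ := hL
  refine ⟨C * D, fun x => (hC _).trans ?_⟩
  rw [mul_assoc]
  exact mul_le_mul_of_nonneg_left (hD x) h0.le

theorem BoundedMap.id (N : QuasiNorm 𝕜 E) : BoundedMap N N LinearMap.id :=
  ⟨1, fun x => by simp⟩

theorem BoundedMap.add {N : QuasiNorm 𝕜 E} {M : QuasiNorm 𝕜 F} {L K : E →ₗ[𝕜] F}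
    (hL : BoundedMap N M L) (hK : BoundedMap N M K) : BoundedMap N M (L + K) := by
  obtain ⟨C, hC⟩ := hL
  obtain ⟨D, hD⟩ := hK
  refine ⟨M.modulus * (C + D), fun x => (M.add_le _ _).trans ?_⟩
  rw [mul_assoc]
  refine mul_le_mul_of_nonneg_left ?_ M.modulus_pos.le
  rw [add_mul]
  exact add_le_add (hC x) (hD x)

theorem BoundedMap.smul {N : QuasiNorm 𝕜 E} {M : QuasiNorm 𝕜 F} {L : E →ₗ[𝕜] F}
    (hL : BoundedMap N M L) (c : 𝕜) : BoundedMap N M (c • L) := by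
  obtain ⟨C, hC⟩ := hL
  refine ⟨‖c‖ * C, fun x => ?_⟩
  rw [LinearMap.smul_apply, M.smul', mul_assoc]
  exact mul_le_mul_of_nonneg_left (hC x) (norm_nonneg _)

theorem BoundedMap.zero (N : QuasiNorm 𝕜 E) (M : QuasiNorm 𝕜 F) : BoundedMap N M 0 :=
  ⟨0, fun x => by simp [M.map_zero]⟩

theorem BoundedMap.sum {N : QuasiNorm 𝕜 E} {M : QuasiNorm 𝕜 F} {α : Type*} (s : Finset α)
    (L : α → E →ₗ[𝕜] F) (h : ∀ i ∈ s, BoundedMap N M (L i)) : BoundedMap N M (∑ i ∈ s, L i) := by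
  classical
  induction s using Finset.induction_on with
  | empty => simpa using BoundedMap.zero N M
  | insert a s ha ih =>
    rw [Finset.sum_insert ha]
    exact (h a (by simp)).add (ih fun i hi => h i (by simp [hi]))

theorem BoundedMap.smulRight {N : QuasiNorm 𝕜 E} {φ : E →ₗ[𝕜] 𝕜} (h : N.IsBounded φ)
    (M : QuasiNorm 𝕜 F) (v : F) : BoundedMap N M (φ.smulRight v) := by
  obtain ⟨C, hC⟩ := h
  refine ⟨C * M v, fun x => ?_⟩
  rw [LinearMap.smulRight_apply, M.smul', mul_right_comm]
  exact mul_le_mul_of_nonneg_right (hC x) (M.nonneg' _)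

theorem isBounded_iff {N : QuasiNorm 𝕜 E} {φ : E →ₗ[𝕜] 𝕜} :
    N.IsBounded φ ↔ BoundedMap N (scalar 𝕜) φ := Iff.rfl

theorem ConvergesTo.unique {N : QuasiNorm 𝕜 E} {u : ℕ → E} {x y : E} (hx : N.ConvergesTo u x)
    (hy : N.ConvergesTo u y) : x = y := by
  have h : Tendsto (fun n => N.modulus * (N (u n - x) + N (u n - y))) atTop (𝓝 0) := by
    simpa using (Tendsto.add hx hy).const_mul N.modulus
  have h2 : N (x - y) ≤ 0 := ge_of_tendsto h (Eventually.of_forall fun n => by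
    have := N.sub_le_sub_add_sub x (u n) y
    rwa [N.sub_comm x (u n)] at this)
  exact sub_eq_zero.1 (N.eq_zero' _ (le_antisymm h2 (N.nonneg' _)))

theorem ConvergesTo.add {N : QuasiNorm 𝕜 E} {u v : ℕ → E} {x y : E} (hx : N.ConvergesTo u x)
    (hy : N.ConvergesTo v y) : N.ConvergesTo (fun n => u n + v n) (x + y) := by
  have h : Tendsto (fun n => N.modulus * (N (u n - x) + N (v n - y))) atTop (𝓝 0) := by
    simpa using (Tendsto.add hx hy).const_mul N.modulus
  refine squeeze_zero (fun n => N.nonneg' _) (fun n => ?_) h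
  have := N.add_le (u n - x) (v n - y)
  rwa [sub_add_sub_comm] at this

theorem ConvergesTo.smul {N : QuasiNorm 𝕜 E} {u : ℕ → E} {x : E} (hx : N.ConvergesTo u x)
    (c : 𝕜) : N.ConvergesTo (fun n => c • u n) (c • x) := by
  have h := Tendsto.const_mul ‖c‖ hx
  simpa [ConvergesTo, ← smul_sub, N.smul'] using h

theorem convergesTo_of_eventually_eq {N : QuasiNorm 𝕜 E} {u : ℕ → E} {x : E}
    (h : ∀ᶠ n in atTop, u n = x) : N.ConvergesTo u x := by
  refine tendsto_const_nhds.congr' (h.mono fun n hn => ?_)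
  simp [hn, N.map_zero]

theorem BoundedMap.convergesTo {N : QuasiNorm 𝕜 E} {M : QuasiNorm 𝕜 F} {L : E →ₗ[𝕜] F}
    (h : BoundedMap N M L) {u : ℕ → E} {x : E} (hu : N.ConvergesTo u x) :
    M.ConvergesTo (fun n => L (u n)) (L x) := by
  obtain ⟨C, hC⟩ := h
  have h2 := Tendsto.const_mul C hu
  rw [mul_zero] at h2
  refine squeeze_zero (fun n => M.nonneg' _) (fun n => ?_) h2
  rw [← map_sub]
  exact hC _

/-- A quasi-norm is lower semicontinuous up to its modulus of concavity. -/
theorem ConvergesTo.le {N : QuasiNorm 𝕜 E} {u : ℕ → E} {x : E} (hx : N.ConvergesTo u x)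
    {b : ℕ → ℝ} {B : ℝ} (hb : Tendsto b atTop (𝓝 B)) (h : ∀ᶠ n in atTop, N (u n) ≤ b n) :
    N x ≤ N.modulus * B := by
  have h2 : Tendsto (fun n => N.modulus * (b n + N (u n - x))) atTop (𝓝 (N.modulus * B)) := by
    simpa using (Tendsto.add hb hx).const_mul N.modulus
  refine ge_of_tendsto h2 (h.mono fun n hn => ?_)
  refine (N.le_add_sub x (u n)).trans ?_
  rw [N.sub_comm x]
  have := N.modulus_pos
  gcongr

theorem exists_seq_of_dense {ι : Type*} {N : QuasiNorm 𝕜 E} {i : ι → E}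
    (hd : ∀ y, ∀ ε > 0, ∃ v, N (y - i v) < ε) (y : E) :
    ∃ u : ℕ → ι, N.ConvergesTo (fun n => i (u n)) y := by
  choose u hu using fun n : ℕ => hd y (1 / ((n : ℝ) + 1)) (by positivity)
  refine ⟨u, squeeze_zero (fun n => N.nonneg' _) (fun n => ?_)
    tendsto_one_div_add_atTop_nhds_zero_nat⟩
  rw [N.sub_comm]
  exact (hu n).le

/-- Two bounded maps that agree on a dense set are equal. -/
theorem BoundedMap.ext_of_dense {N : QuasiNorm 𝕜 E} {M : QuasiNorm 𝕜 F} {L K : E →ₗ[𝕜] F}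
    (hL : BoundedMap N M L) (hK : BoundedMap N M K) {ι : Type*} {i : ι → E}
    (hd : ∀ y, ∀ ε > 0, ∃ v, N (y - i v) < ε) (h : ∀ v, L (i v) = K (i v)) : L = K := by
  ext y
  obtain ⟨u, hu⟩ := exists_seq_of_dense hd y
  have h1 := hL.convergesTo hu
  simp only [h] at h1
  exact h1.unique (hK.convergesTo hu)

/-- An estimate on a dense set extends to the whole space, with a worse constant. -/
theorem BoundedMap.le_of_dense {N : QuasiNorm 𝕜 E} {M : QuasiNorm 𝕜 F} {L : E →ₗ[𝕜] F}
    (hL : BoundedMap N M L) {ι : Type*} {i : ι → E} (hd : ∀ y, ∀ ε > 0, ∃ v, N (y - i v) < ε)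
    {D : ℝ} (hD : 0 ≤ D) (h : ∀ v, M (L (i v)) ≤ D * N (i v)) (y : E) :
    M (L y) ≤ M.modulus * N.modulus * D * N y := by
  obtain ⟨u, hu⟩ := exists_seq_of_dense hd y
  have h1 : Tendsto (fun n => D * (N.modulus * (N y + N (i (u n) - y)))) atTop
      (𝓝 (D * (N.modulus * (N y + 0)))) := ((tendsto_const_nhds.add hu).const_mul _).const_mul _
  have h2 := (hL.convergesTo hu).le h1 (Eventually.of_forall fun n => (h _).trans
    (mul_le_mul_of_nonneg_left (N.le_add_sub _ _) hD))
  refine h2.trans_eq ?_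
  ring

theorem ConvergesTo.cauchy {N : QuasiNorm 𝕜 E} {u : ℕ → E} {x : E} (hx : N.ConvergesTo u x) :
    ∀ ε > 0, ∃ n₀, ∀ m ≥ n₀, ∀ n ≥ n₀, N (u m - u n) < ε := by
  intro ε hε
  have hκ := N.modulus_pos
  obtain ⟨n₀, h⟩ := eventually_atTop.1
    (hx.eventually (gt_mem_nhds (show 0 < ε / (2 * N.modulus) by positivity)))
  refine ⟨n₀, fun m hm n hn => ?_⟩
  refine (N.sub_le_sub_add_sub (u m) x (u n)).trans_lt ?_
  rw [N.sub_comm x]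
  have h1 := h m hm
  have h2 := h n hn
  calc N.modulus * (N (u m - x) + N (u n - x))
      < N.modulus * (ε / (2 * N.modulus) + ε / (2 * N.modulus)) := by gcongr
    _ = ε := by field_simp; ring

/-- A bounded linear map on a dense subspace, given as the image of `i`, extends to a bounded linear
map into a complete space. -/
theorem exists_extension (N : QuasiNorm 𝕜 E) {M : QuasiNorm 𝕜 F} (hM : M.IsComplete)
    (i : V →ₗ[𝕜] E) (hd : ∀ y, ∀ ε > 0, ∃ v, N (y - i v) < ε) (L : V →ₗ[𝕜] F)
    (hL : ∃ C, ∀ v, M (L v) ≤ C * N (i v)) :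
    ∃ L' : E →ₗ[𝕜] F, (∀ v, L' (i v) = L v) ∧ BoundedMap N M L' := by
  obtain ⟨C, hC⟩ : ∃ C : ℝ, 0 < C ∧ ∀ v, M (L v) ≤ C * N (i v) := by
    obtain ⟨C, hC⟩ := hL
    exact ⟨max C 1, by positivity, fun x => (hC x).trans
      (mul_le_mul_of_nonneg_right (le_max_left _ _) (N.nonneg' _))⟩
  have key : ∀ y, ∃ z, ∀ u : ℕ → V, N.ConvergesTo (fun n => i (u n)) y →
      M.ConvergesTo (fun n => L (u n)) z := by
    intro y
    obtain ⟨u, hu⟩ := exists_seq_of_dense hd y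
    obtain ⟨z, hz⟩ := hM (fun n => L (u n)) fun ε hε => by
      obtain ⟨n₀, h⟩ := hu.cauchy (ε / C) (by have := hC.1; positivity)
      refine ⟨n₀, fun m hm n hn => ?_⟩
      have h1 := h m hm n hn
      rw [lt_div_iff₀' hC.1, ← map_sub] at h1
      rw [← map_sub]
      exact (hC.2 _).trans_lt h1
    refine ⟨z, fun v hv => ?_⟩
    have h0 : N.ConvergesTo (fun n => i (v n - u n)) 0 := by
      have := hv.add (hu.smul (-1))
      simpa [sub_eq_add_neg] using this
    have h1 : M.ConvergesTo (fun n => L (v n - u n)) 0 := by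
      have h2 := Tendsto.const_mul C h0
      rw [mul_zero] at h2
      refine squeeze_zero (fun n => M.nonneg' _) (fun n => ?_) h2
      simpa using hC.2 (v n - u n)
    simpa using h1.add hz
  choose g hg using key
  have hgi : ∀ v, g (i v) = L v := fun v =>
    (hg _ (fun _ => v) (convergesTo_of_eventually_eq (by simp))).unique
      (convergesTo_of_eventually_eq (by simp))
  refine ⟨{ toFun := g, map_add' := fun x y => ?_, map_smul' := fun c x => ?_ }, hgi, ?_⟩
  · obtain ⟨u, hu⟩ := exists_seq_of_dense hd x
    obtain ⟨v, hv⟩ := exists_seq_of_dense hd y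
    have h := hg (x + y) (fun n => u n + v n) (by simpa using hu.add hv)
    exact h.unique (by simpa using (hg x u hu).add (hg y v hv))
  · obtain ⟨u, hu⟩ := exists_seq_of_dense hd x
    have h := hg (c • x) (fun n => c • u n) (by simpa using hu.smul c)
    exact h.unique (by simpa using (hg x u hu).smul c)
  · refine ⟨M.modulus * (C * N.modulus), fun y => ?_⟩
    obtain ⟨u, hu⟩ := exists_seq_of_dense hd y
    have h1 : Tendsto (fun n => C * (N.modulus * (N y + N (i (u n) - y)))) atTop
        (𝓝 (C * (N.modulus * (N y + 0)))) :=
      ((Tendsto.add tendsto_const_nhds hu).const_mul _).const_mul _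
    have h2 := (hg y u hu).le h1 (Eventually.of_forall fun n => (hC.2 _).trans
      (mul_le_mul_of_nonneg_left (N.le_add_sub _ _) hC.1.le))
    refine h2.trans_eq ?_
    ring

/-! #### Closed subspaces -/

theorem le_closure (N : QuasiNorm 𝕜 E) (W : Submodule 𝕜 E) : W ≤ N.closure W :=
  fun y hy ε hε => ⟨y, hy, by simpa [N.map_zero] using hε⟩

theorem subset_closedSpan (N : QuasiNorm 𝕜 E) {s : Set E} {y : E} (hy : y ∈ s) :
    y ∈ N.closedSpan s :=
  N.le_closure _ (Submodule.subset_span hy)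

theorem closure_closure (N : QuasiNorm 𝕜 E) (W : Submodule 𝕜 E) :
    N.closure (N.closure W) = N.closure W := by
  refine le_antisymm (fun y hy ε hε => ?_) (N.le_closure _)
  have hκ := N.modulus_pos
  obtain ⟨z, hz, hz'⟩ := hy (ε / (2 * N.modulus)) (by positivity)
  obtain ⟨w, hw, hw'⟩ := hz (ε / (2 * N.modulus)) (by positivity)
  refine ⟨w, hw, (N.sub_le_sub_add_sub y z w).trans_lt ?_⟩
  calc N.modulus * (N (y - z) + N (z - w))
      < N.modulus * (ε / (2 * N.modulus) + ε / (2 * N.modulus)) := by gcongr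
    _ = ε := by field_simp; ring

/-- A bounded map sends a closed linear span into a closed subspace that contains the images of the
generators. -/
theorem BoundedMap.map_closedSpan {N : QuasiNorm 𝕜 E} {M : QuasiNorm 𝕜 F} {L : E →ₗ[𝕜] F}
    (hL : BoundedMap N M L) {s : Set E} {W : Submodule 𝕜 F} (h : ∀ y ∈ s, L y ∈ M.closure W)
    {y : E} (hy : y ∈ N.closedSpan s) : L y ∈ M.closure W := by
  obtain ⟨C, hC0, hC⟩ := hL.exists_pos
  rw [← M.closure_closure]
  intro ε hε
  obtain ⟨z, hz, hz'⟩ := hy (ε / C) (by positivity)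
  refine ⟨L z, ?_, ?_⟩
  · exact (Submodule.span_le.2 (show s ⊆ (M.closure W).comap L from h)) hz
  · rw [← map_sub]
    refine (hC _).trans_lt ?_
    rwa [lt_div_iff₀' hC0] at hz'

/-- Bounded maps that agree on generators agree on the closed linear span. -/
theorem BoundedMap.eqOn_closedSpan {N : QuasiNorm 𝕜 E} {M : QuasiNorm 𝕜 F} {L K : E →ₗ[𝕜] F}
    (hL : BoundedMap N M L) (hK : BoundedMap N M K) {s : Set E} (h : ∀ y ∈ s, L y = K y)
    {y : E} (hy : y ∈ N.closedSpan s) : L y = K y := by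
  have h1 := (hL.add (hK.smul (-1))).map_closedSpan (s := s) (W := ⊥)
    (fun z hz => by simp [h z hz]) hy
  refine sub_eq_zero.1 (M.eq_zero' _ (le_antisymm (le_of_forall_pos_le_add fun ε hε => ?_)
    (M.nonneg' _)))
  obtain ⟨z, hz, hz'⟩ := h1 ε hε
  rw [Submodule.mem_bot] at hz
  subst hz
  simpa [sub_eq_add_neg] using hz'.le

theorem dense_span_of_closedSpan_eq_top {N : QuasiNorm 𝕜 E} {s : Set E}
    (h : N.closedSpan s = ⊤) (y : E) : ∀ ε > 0, ∃ v : Submodule.span 𝕜 s, N (y - v) < ε := by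
  intro ε hε
  have hy : y ∈ N.closedSpan s := h ▸ Submodule.mem_top
  obtain ⟨z, hz, hz'⟩ := hy ε hε
  exact ⟨⟨z, hz⟩, hz'⟩

/-! #### Dual norms -/

theorem IsBounded.bddAbove {N : QuasiNorm 𝕜 E} {φ : E →ₗ[𝕜] 𝕜} (h : N.IsBounded φ) :
    BddAbove {r | ∃ x, N x ≤ 1 ∧ r = ‖φ x‖} := by
  obtain ⟨C, hC0, hC⟩ := BoundedMap.exists_pos (isBounded_iff.1 h)
  refine ⟨C, ?_⟩
  rintro r ⟨x, hx, rfl⟩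
  exact (hC x).trans (by simpa using mul_le_mul_of_nonneg_left hx hC0.le)

theorem dualNorm_nonneg (N : QuasiNorm 𝕜 E) (φ : E →ₗ[𝕜] 𝕜) : 0 ≤ N.dualNorm φ :=
  Real.sSup_nonneg (by rintro r ⟨x, -, rfl⟩; exact norm_nonneg _)

theorem dualNorm_le {N : QuasiNorm 𝕜 E} {φ : E →ₗ[𝕜] 𝕜} {D : ℝ} (hD : 0 ≤ D)
    (h : ∀ x, ‖φ x‖ ≤ D * N x) : N.dualNorm φ ≤ D := by
  refine Real.sSup_le ?_ hD
  rintro r ⟨x, hx, rfl⟩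
  exact (h x).trans (by simpa using mul_le_mul_of_nonneg_left hx hD)

theorem IsBounded.le_dualNorm {N : QuasiNorm 𝕜 E} {φ : E →ₗ[𝕜] 𝕜} (h : N.IsBounded φ) (x : E) :
    ‖φ x‖ ≤ N.dualNorm φ * N x := by
  rcases eq_or_ne x 0 with rfl | hx
  · simp [N.map_zero]
  have h0 := N.pos_of_ne_zero hx
  have h1 : ‖φ (((N x)⁻¹ : 𝕜) • x)‖ ≤ N.dualNorm φ := by
    refine le_csSup h.bddAbove ⟨_, ?_, rfl⟩
    rw [N.smul', norm_inv, RCLike.norm_ofReal, abs_of_pos h0, inv_mul_cancel₀ h0.ne']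
  rw [map_smul, norm_smul, norm_inv, RCLike.norm_ofReal, abs_of_pos h0, inv_mul_le_iff₀ h0] at h1
  linarith

theorem IsBounded.smul {N : QuasiNorm 𝕜 E} {φ : E →ₗ[𝕜] 𝕜} (h : N.IsBounded φ) (c : 𝕜) :
    N.IsBounded (c • φ) := BoundedMap.smul (M := scalar 𝕜) h c

theorem dualNorm_smul {N : QuasiNorm 𝕜 E} {φ : E →ₗ[𝕜] 𝕜} (h : N.IsBounded φ) (c : 𝕜) :
    N.dualNorm (c • φ) = ‖c‖ * N.dualNorm φ := by
  refine le_antisymm (dualNorm_le (mul_nonneg (norm_nonneg _) (N.dualNorm_nonneg _)) fun x => ?_) ?_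
  · rw [LinearMap.smul_apply, norm_smul, mul_assoc]
    exact mul_le_mul_of_nonneg_left (h.le_dualNorm x) (norm_nonneg _)
  · rcases eq_or_ne c 0 with rfl | hc
    · simpa using N.dualNorm_nonneg _
    have h0 : 0 < ‖c‖ := norm_pos_iff.2 hc
    rw [mul_comm, ← le_div_iff₀ h0]
    refine dualNorm_le (div_nonneg (N.dualNorm_nonneg _) h0.le) fun x => ?_
    rw [div_mul_eq_mul_div, le_div_iff₀ h0]
    have := (h.smul c).le_dualNorm x
    rw [LinearMap.smul_apply, norm_smul] at this
    linarith

end QuasiNorm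

/-- The dual basis of a basis is unique. -/
theorem IsBasisWithDual.eq {𝕜 E : Type*} [RCLike 𝕜] [AddCommGroup E] [Module 𝕜 E]
    {N : QuasiNorm 𝕜 E} {x : ℕ → E} {xs ys : ℕ → E →ₗ[𝕜] 𝕜} (h : IsBasisWithDual N x xs)
    (h' : IsBasisWithDual N x ys) : xs = ys := by
  funext n
  ext f
  refine QuasiNorm.BoundedMap.eqOn_closedSpan (M := QuasiNorm.scalar 𝕜) (s := Set.range x)
    (h.bounded n) (h'.bounded n) ?_ (h.generates ▸ Submodule.mem_top)
  rintro _ ⟨k, rfl⟩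
  rw [h.biorthogonal, h'.biorthogonal]

/-- The coefficients of a convergent expansion are given by the dual basis. -/
theorem schauder_coeff {𝕜 E : Type*} [RCLike 𝕜] [AddCommGroup E] [Module 𝕜 E]
    {N : QuasiNorm 𝕜 E} {e : ℕ → E} {es : ℕ → E →ₗ[𝕜] 𝕜} (he : IsBasisWithDual N e es) {f : E} {a : ℕ → 𝕜}
    (ha : N.ConvergesTo (fun m => ∑ n ∈ Finset.range m, a n • e n) f) (n : ℕ) : es n f = a n := by
  have h1 := QuasiNorm.BoundedMap.convergesTo (M := QuasiNorm.scalar 𝕜) (he.bounded n) ha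
  refine h1.unique (QuasiNorm.convergesTo_of_eventually_eq ?_)
  filter_upwards [eventually_gt_atTop n] with m hm
  rw [map_sum]
  simp only [map_smul, he.biorthogonal, smul_eq_mul, mul_ite, mul_one, mul_zero]
  simp [hm]

theorem isSchauderBasis_iff_convergesTo {𝕜 E : Type*} [RCLike 𝕜] [AddCommGroup E]
    [Module 𝕜 E]
    {N : QuasiNorm 𝕜 E} {e : ℕ → E} {es : ℕ → E →ₗ[𝕜] 𝕜} (he : IsBasisWithDual N e es) :
    IsSchauderBasis N e ↔
      ∀ f, N.ConvergesTo (fun m => ∑ n ∈ Finset.range m, es n f • e n) f := by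
  constructor
  · intro h f
    obtain ⟨a, ha, -⟩ := h f
    simpa only [schauder_coeff he ha] using ha
  · intro h f
    exact ⟨fun n => es n f, h f, fun a ha => funext fun n => (schauder_coeff he ha n).symm⟩

section Symmetric

variable {𝕜 : Type*} [RCLike 𝕜]

/-! ### Symmetric quasi-norms on `c₀₀` -/

/-- The quasi-norm that a sequence space induces on `c₀₀`. -/
def SequenceSpace.qnorm00 (S : SequenceSpace 𝕜) : QuasiNorm 𝕜 (ℕ →₀ 𝕜) where
  toFun := S.norm00
  nonneg' f := S.qnorm.nonneg' _
  eq_zero' f h := by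
    have := congrArg Subtype.val (S.qnorm.eq_zero' _ h)
    exact DFunLike.coe_injective this
  smul' c f := S.qnorm.smul' c ⟨f, S.c00_mem f⟩
  add_le' := by
    obtain ⟨κ, hκ, h⟩ := S.qnorm.add_le'
    exact ⟨κ, hκ, fun f g => h ⟨f, S.c00_mem f⟩ ⟨g, S.c00_mem g⟩⟩

/-- Invariance of a quasi-norm on `c₀₀` under permutations and changes of signs. -/
def QuasiNorm.IsSymmetric (N : QuasiNorm 𝕜 (ℕ →₀ 𝕜)) : Prop :=
  ∀ (a : ℕ →₀ 𝕜) (ε : ℕ → 𝕜) (π : Equiv.Perm ℕ), (∀ n, ‖ε n‖ = 1) →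
    N (a.sum fun n c => Finsupp.single (π n) (ε n * c)) = N a

theorem SequenceSpace.IsSymmetric.qnorm00 {S : SequenceSpace 𝕜} (h : S.IsSymmetric) :
    S.qnorm00.IsSymmetric := h

theorem ind_apply (A : Finset ℕ) (k : ℕ) : ind 𝕜 A k = if k ∈ A then 1 else 0 := by
  simp [ind, Finsupp.finsetSum_apply, Finsupp.single_apply]

theorem sum_single_perm_apply (a : ℕ →₀ 𝕜) (ε : ℕ → 𝕜) (π : Equiv.Perm ℕ) (k : ℕ) :
    (a.sum fun n c => Finsupp.single (π n) (ε n * c)) (π k) = ε k * a k := by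
  rw [Finsupp.sum, Finsupp.finsetSum_apply, Finset.sum_eq_single k]
  · simp
  · intro b _ hb
    rw [Finsupp.single_apply, if_neg]
    simpa using hb
  · intro h
    simp [Finsupp.notMem_support_iff.1 h]

theorem exists_perm_mem_iff {A B : Finset ℕ} (h : A.card = B.card) :
    ∃ π : Equiv.Perm ℕ, ∀ k, π k ∈ B ↔ k ∈ A := by
  have hA : Infinite {k // ¬ k ∈ A} := (Finset.finite_toSet A).infinite_compl.to_subtype
  have hB : Infinite {k // ¬ k ∈ B} := (Finset.finite_toSet B).infinite_compl.to_subtype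
  obtain ⟨f⟩ := nonempty_equiv_of_countable (α := {k // ¬ k ∈ A}) (β := {k // ¬ k ∈ B})
  have e : {k // k ∈ A} ≃ {k // k ∈ B} := Finset.equivOfCardEq h
  refine ⟨Equiv.subtypeCongr e f, fun k => ?_⟩
  by_cases hk : k ∈ A
  · simp [Equiv.subtypeCongr, Equiv.sumCompl_symm_apply_of_pos (p := (· ∈ A)) hk, hk]
  · simp [Equiv.subtypeCongr, Equiv.sumCompl_symm_apply_of_neg (p := (· ∈ A)) hk, hk]
    exact (f ⟨k, hk⟩).2

namespace QuasiNorm.IsSymmetric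

variable {N : QuasiNorm 𝕜 (ℕ →₀ 𝕜)}

theorem eq_of_perm (hN : N.IsSymmetric) {f g : ℕ →₀ 𝕜} (π : Equiv.Perm ℕ)
    (h : ∀ k, ‖g (π k)‖ = ‖f k‖) :
    N g = N f := by
  classical
  rw [← hN f (fun k => if f k = 0 then 1 else g (π k) / f k) π]
  · congr 1
    ext k
    obtain ⟨k, rfl⟩ := π.surjective k
    rw [sum_single_perm_apply]
    by_cases hk : f k = 0
    · have := h k
      simp only [hk, norm_zero, norm_eq_zero] at this
      simp [hk, this]
    · simp [hk]
  · intro k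
    by_cases hk : f k = 0
    · simp [hk]
    · simp [hk, h k]

theorem congr_norm (hN : N.IsSymmetric) {f g : ℕ →₀ 𝕜} (h : ∀ k, ‖f k‖ = ‖g k‖) : N f = N g :=
  hN.eq_of_perm (Equiv.refl ℕ) h

theorem ind_eq (hN : N.IsSymmetric) (A : Finset ℕ) : N (ind 𝕜 A) = fundamental N A.card := by
  obtain ⟨π, hπ⟩ := exists_perm_mem_iff (A := Finset.range A.card) (B := A) (by simp)
  refine hN.eq_of_perm π fun k => ?_
  simp [ind_apply, hπ k]

end QuasiNorm.IsSymmetric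

section Lattice

variable {N : QuasiNorm 𝕜 (ℕ →₀ 𝕜)}

/-- Truncation of the binary expansion of a real multiplier with entries in `[-1, 1]`: up to a
remainder of the same kind multiplied by `2⁻ʳ`, it is a combination of `r` sign changes. -/
theorem QuasiNorm.IsSymmetric.exists_binary_expansion (hN : N.IsSymmetric) (r : ℕ) :
    ∃ K : ℝ, 0 ≤ K ∧ ∀ (l : ℕ → ℝ), (∀ k, |l k| ≤ 1) → ∀ g : ℕ →₀ 𝕜, ∃ l' : ℕ → ℝ,
      (∀ k, |l' k| ≤ 1) ∧ N ((fun k => (l k : 𝕜)) • g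
        - (((1 / 2) ^ r : ℝ) : 𝕜) • (fun k => (l' k : 𝕜)) • g) ≤ K * N g := by
  induction r with
  | zero =>
    refine ⟨0, le_rfl, fun l hl g => ⟨l, hl, ?_⟩⟩
    simp [N.map_zero]
  | succ r ih =>
    obtain ⟨K, hK, ih⟩ := ih
    refine ⟨N.modulus * (K + (1 / 2) ^ (r + 1)), by have := N.modulus_pos; positivity,
      fun l hl g => ?_⟩
    obtain ⟨l', hl', h⟩ := ih l hl g
    set s : ℕ → ℝ := fun k => if 0 ≤ l' k then 1 else -1 with hs
    have hs1 : ∀ k, |s k| = 1 := fun k => by simp only [hs]; split_ifs <;> simp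
    refine ⟨fun k => 2 * l' k - s k, fun k => ?_, ?_⟩
    · have := abs_le.1 (hl' k)
      simp only [hs]
      rw [abs_le]
      split_ifs <;> constructor <;> linarith
    · have e : (fun k => (l k : 𝕜)) • g - (((1 / 2) ^ (r + 1) : ℝ) : 𝕜) •
          (fun k => ((2 * l' k - s k : ℝ) : 𝕜)) • g =
          ((fun k => (l k : 𝕜)) • g - (((1 / 2) ^ r : ℝ) : 𝕜) • (fun k => (l' k : 𝕜)) • g) +
          (((1 / 2) ^ (r + 1) : ℝ) : 𝕜) • (fun k => (s k : 𝕜)) • g := by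
        ext k
        simp only [Finsupp.coe_sub, Finsupp.coe_add, Finsupp.coe_smul, Finsupp.coe_pointwise_smul,
          Pi.sub_apply, Pi.add_apply, Pi.smul_apply, Pi.mul_apply, smul_eq_mul]
        push_cast
        ring
      rw [e]
      refine (N.add_le _ _).trans ?_
      have e2 : N ((((1 / 2) ^ (r + 1) : ℝ) : 𝕜) • (fun k => (s k : 𝕜)) • g)
          = (1 / 2) ^ (r + 1) * N g := by
        rw [N.smul', RCLike.norm_ofReal, abs_of_pos (by positivity)]
        congr 1
        refine hN.congr_norm fun k => ?_
        simp [hs1]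
      rw [e2]
      have := N.modulus_pos
      calc _ ≤ N.modulus * (K * N g + (1 / 2) ^ (r + 1) * N g) := by gcongr
        _ = _ := by ring

/-- A quasi-norm on `c₀₀` that is invariant under changes of signs is a lattice quasi-norm up to a
constant. The binary expansion of the multiplier is truncated where its remainder gets small with
respect to the modulus of concavity. -/
theorem QuasiNorm.IsSymmetric.exists_lattice (hN : N.IsSymmetric) :
    ∃ C : ℝ, 0 < C ∧ ∀ f g : ℕ →₀ 𝕜, (∀ k, ‖f k‖ ≤ ‖g k‖) → N f ≤ C * N g := by
  have hκ := N.modulus_pos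
  obtain ⟨r, hr⟩ := exists_pow_lt_of_lt_one (show 0 < 1 / (2 * N.modulus) by positivity)
    (show (1 / 2 : ℝ) < 1 by norm_num)
  obtain ⟨K, hK, hexp⟩ := hN.exists_binary_expansion r
  refine ⟨2 * N.modulus * K + 1, by positivity, fun f g hfg => ?_⟩
  -- the supremum over all multipliers is finite since `g` has finite support
  set D : Set ℝ := {t | ∃ l : ℕ → ℝ, (∀ k, |l k| ≤ 1) ∧ t = N ((fun k => (l k : 𝕜)) • g)} with hD
  have hbdd : BddAbove D := by
    refine ⟨N.modulus ^ g.support.card * ∑ k ∈ g.support, N (Finsupp.single k (g k)), ?_⟩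
    rintro t ⟨l, hl, rfl⟩
    have e : (fun k => (l k : 𝕜)) • g = ∑ k ∈ g.support, (l k : 𝕜) • Finsupp.single k (g k) := by
      ext k
      simp only [Finsupp.coe_pointwise_smul, Pi.smul_apply', smul_eq_mul,
        Finsupp.finsetSum_apply, Finsupp.smul_apply, Finsupp.single_apply]
      by_cases hk : g k = 0
      · simp [hk]
      · simp [hk]
    rw [e]
    refine (N.sum_le _ _).trans (mul_le_mul_of_nonneg_left (Finset.sum_le_sum fun k _ => ?_)
      (by positivity))
    rw [N.smul', RCLike.norm_ofReal]
    exact mul_le_of_le_one_left (N.nonneg' _) (hl k)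
  have hne : D.Nonempty := ⟨_, fun _ => 0, by simp, rfl⟩
  have h0 : 0 ≤ sSup D := Real.sSup_nonneg (by rintro t ⟨l, -, rfl⟩; exact N.nonneg' _)
  have hsup : sSup D ≤ N.modulus * (K * N g) + sSup D / 2 := by
    refine csSup_le hne ?_
    rintro t ⟨l, hl, rfl⟩
    obtain ⟨l', hl', h⟩ := hexp l hl g
    have h1 : N ((fun k => (l' k : 𝕜)) • g) ≤ sSup D := le_csSup hbdd ⟨l', hl', rfl⟩
    have h2 := N.le_add_sub ((fun k => (l k : 𝕜)) • g)
      ((((1 / 2) ^ r : ℝ) : 𝕜) • (fun k => (l' k : 𝕜)) • g)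
    rw [N.smul', RCLike.norm_ofReal, abs_of_pos (by positivity)] at h2
    refine h2.trans ?_
    have h3 : N.modulus * (1 / 2) ^ r ≤ 1 / 2 := by
      rw [lt_div_iff₀ (by positivity)] at hr
      linarith
    have h4 : N.modulus * (1 / 2) ^ r * N ((fun k => (l' k : 𝕜)) • g) ≤ 1 / 2 * sSup D :=
      mul_le_mul h3 h1 (N.nonneg' _) (by norm_num)
    have h5 := mul_le_mul_of_nonneg_left h hκ.le
    linarith
  have hmem : N f ≤ sSup D := by
    refine le_csSup hbdd ⟨fun k => ‖f k‖ / ‖g k‖, fun k => ?_, hN.congr_norm fun k => ?_⟩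
    · rw [abs_of_nonneg (by positivity)]
      exact div_le_one_of_le₀ (hfg k) (norm_nonneg _)
    · by_cases hk : ‖g k‖ = 0
      · have := hfg k
        rw [hk] at this
        simp [hk, le_antisymm this (norm_nonneg _)]
      · simp [hk]
  have := N.nonneg' g
  linarith

end Lattice

/-! ### Averaging projections -/

/-- The finite sets `σ n` are the fibres of the function `b`. -/
def IsFibres (σ : ℕ → Finset ℕ) (b : ℕ → ℕ) : Prop := ∀ k n, k ∈ σ n ↔ b k = n

theorem ave_eq_zero {σ : ℕ → Finset ℕ} {b : ℕ → ℕ} (hb : IsFibres σ b) (f : ℕ →₀ 𝕜) {n : ℕ}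
    (hn : n ∉ f.support.image b) : ave f (σ n) = 0 := by
  rw [ave, Finset.sum_eq_zero, mul_zero]
  intro k hk
  by_contra h
  exact hn (Finset.mem_image.2 ⟨k, Finsupp.mem_support_iff.2 h, (hb k n).1 hk⟩)

theorem finsum_ave_smul_eq {E : Type*} [AddCommGroup E] [Module 𝕜 E] {σ : ℕ → Finset ℕ}
    {b : ℕ → ℕ} (hb : IsFibres σ b) (f : ℕ →₀ 𝕜) (y : ℕ → E) :
    ∑ᶠ n, ave f (σ n) • y n = ∑ n ∈ f.support.image b, ave f (σ n) • y n := by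
  refine finsum_eq_sum_of_support_subset _ fun n hn => ?_
  by_contra h
  exact hn (by simp [ave_eq_zero hb f h])

theorem avgProj_apply {σ : ℕ → Finset ℕ} {b : ℕ → ℕ} (hb : IsFibres σ b) (f : ℕ →₀ 𝕜) (k : ℕ) :
    avgProj σ f k = ave f (σ (b k)) := by
  rw [avgProj, finsum_ave_smul_eq hb, Finsupp.finsetSum_apply]
  simp only [Finsupp.smul_apply, ind_apply, hb k, smul_eq_mul, mul_ite, mul_one, mul_zero,
    Finset.sum_ite_eq]
  split_ifs with h
  · rfl
  · exact (ave_eq_zero hb f h).symm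

theorem sum_range_mul_of_periodic {M : Type*} [AddCommMonoid M] (g : ℕ → M) (s : ℕ)
    (hg : ∀ i, g (i + s) = g i) (c : ℕ) :
    ∑ i ∈ Finset.range (c * s), g i = c • ∑ i ∈ Finset.range s, g i := by
  have h : ∀ c i, g (c * s + i) = g i := by
    intro c i
    induction c with
    | zero => simp
    | succ c ih => rw [← ih, ← hg (c * s + i)]; congr 1; ring
  induction c with
  | zero => simp
  | succ c ih => rw [add_mul, one_mul, Finset.sum_range_add, ih, succ_nsmul]; simp [h]

theorem sum_range_card_of_isCycleOn {M : Type*} [AddCommMonoid M] {A : Finset ℕ}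
    {π : Equiv.Perm ℕ} (h : π.IsCycleOn (A : Set ℕ)) {k : ℕ} (hk : k ∈ A) (f : ℕ → M) :
    ∑ i ∈ Finset.range A.card, f ((π ^ i) k) = ∑ j ∈ A, f j := by
  refine Finset.sum_bij (fun i _ => (π ^ i) k) ?_ ?_ ?_ ?_
  · intro i _
    have := (h.1.perm_pow i).mapsTo hk
    exact this
  · intro i hi j hj hij
    have := (h.pow_apply_eq_pow_apply hk).1 hij
    rw [Finset.mem_range] at hi hj
    exact Nat.ModEq.eq_of_lt_of_lt this hi hj
  · intro j hj
    obtain ⟨i, hi, rfl⟩ := h.exists_pow_eq hk hj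
    exact ⟨i, Finset.mem_range.2 hi, rfl⟩
  · intros; rfl

/-- There is a permutation that runs cyclically through each of the fibres. -/
theorem exists_perm_isCycleOn_fibres {σ : ℕ → Finset ℕ} {b : ℕ → ℕ} (hb : IsFibres σ b) :
    ∃ π : Equiv.Perm ℕ, ∀ n, π.IsCycleOn (σ n : Set ℕ) := by
  choose c hc using fun n => (σ n).countable_toSet.exists_cycleOn
  have hmem : ∀ n k, c n k ∈ σ n ↔ k ∈ σ n := fun n k => by simpa using (hc n).1.apply_mem_iff
  have hbk : ∀ k, k ∈ σ (b k) := fun k => (hb k _).2 rfl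
  have hb1 : ∀ k, b (c (b k) k) = b k := fun k => (hb _ _).1 ((hmem _ _).2 (hbk k))
  have hb2 : ∀ k, b ((c (b k)).symm k) = b k := fun k => by
    refine (hb _ _).1 ((hmem _ _).1 ?_)
    simpa using hbk k
  let π : Equiv.Perm ℕ :=
    { toFun := fun k => c (b k) k
      invFun := fun k => (c (b k)).symm k
      left_inv := fun k => by simp [hb1]
      right_inv := fun k => by simp [hb2] }
  have hpow : ∀ n, ∀ k ∈ σ n, ∀ i : ℕ, (π ^ i) k = (c n ^ i) k ∧ (π ^ i) k ∈ σ n := by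
    intro n k hk i
    induction i with
    | zero => simpa using hk
    | succ i ih =>
      have h1 : (π ^ (i + 1)) k = c n ((π ^ i) k) := by
        rw [pow_succ', Equiv.Perm.mul_apply]
        change c (b ((π ^ i) k)) ((π ^ i) k) = _
        rw [(hb _ _).1 ih.2]
      refine ⟨?_, ?_⟩
      · rw [h1, ih.1, pow_succ', Equiv.Perm.mul_apply]
      · rw [h1, hmem]; exact ih.2
  refine ⟨π, fun n => ⟨⟨fun k hk => by simpa using (hpow n k hk 1).2, π.injective.injOn, ?_⟩, ?_⟩⟩
  · intro k hk
    refine ⟨(c n).symm k, ?_, ?_⟩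
    · have := (hmem n ((c n).symm k)).1 (by simpa using hk)
      exact this
    · have h3 : (c n).symm k ∈ σ n := (hmem n ((c n).symm k)).1 (by simpa using hk)
      simpa using (hpow n _ h3 1).1
  · intro k hk j hj
    obtain ⟨i, -, hi⟩ := (hc n).1.exists_pow_eq hk hj
    exact ⟨i, by rw [zpow_natCast, (hpow n k hk i).1, hi]⟩

/-- Averaging projections are uniformly bounded for a symmetric quasi-norm that is equivalent to a
norm, since they are averages of permutation operators. -/
theorem QuasiNorm.IsSymmetric.exists_avgProj_le {N : QuasiNorm 𝕜 (ℕ →₀ 𝕜)} (hN : N.IsSymmetric)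
    (hconv : N.IsLocallyConvex) :
    ∃ C : ℝ, 0 < C ∧ ∀ (σ : ℕ → Finset ℕ) (b : ℕ → ℕ), IsFibres σ b →
      ∀ f, N (avgProj σ f) ≤ C * N f := by
  obtain ⟨q, C, hC⟩ := hconv
  have hC0 : 0 < C := by
    have h1 : 0 < N (Finsupp.single 0 1) := N.pos_of_ne_zero (by simp)
    by_contra! h
    have := (hC (Finsupp.single 0 1)).1
    have := mul_nonpos_of_nonpos_of_nonneg h (apply_nonneg q (Finsupp.single 0 1))
    linarith
  refine ⟨C * C, by positivity, fun σ b hb f => ?_⟩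
  obtain ⟨π, hπ⟩ := exists_perm_isCycleOn_fibres hb
  set F := f.support.image b
  set L := ∏ n ∈ F, (σ n).card
  have hL : L ≠ 0 := by
    refine Finset.prod_ne_zero_iff.2 fun n hn => ?_
    obtain ⟨k, -, rfl⟩ := Finset.mem_image.1 hn
    exact (Finset.card_pos.2 ⟨k, (hb k _).2 rfl⟩).ne'
  have e : avgProj σ f = ((L : ℝ) : 𝕜)⁻¹ •
      ∑ r ∈ Finset.range L, Finsupp.equivMapDomain ((π ^ r).symm) f := by
    ext k
    rw [avgProj_apply hb]
    simp only [Finsupp.smul_apply, Finsupp.finsetSum_apply, Finsupp.equivMapDomain_apply,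
      Equiv.symm_symm, smul_eq_mul]
    have hk : k ∈ σ (b k) := (hb k _).2 rfl
    by_cases hF : b k ∈ F
    · obtain ⟨c, hc⟩ := Finset.dvd_prod_of_mem (fun n => (σ n).card) hF
      have hc' : L = c * (σ (b k)).card := by rw [mul_comm]; exact hc
      rw [hc', sum_range_mul_of_periodic, sum_range_card_of_isCycleOn (hπ (b k)) hk (fun j => f j),
        ave, nsmul_eq_mul]
      · have h1 : ((σ (b k)).card : 𝕜) ≠ 0 := by
          have := (Finset.card_pos.2 ⟨k, hk⟩).ne'
          exact_mod_cast this
        have h2 : (c : 𝕜) ≠ 0 := by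
          rintro h
          have : c = 0 := by exact_mod_cast h
          rw [this, zero_mul] at hc'
          exact hL hc'
        push_cast
        field_simp
      · intro i
        rw [pow_add, Equiv.Perm.mul_apply, (hπ (b k)).pow_card_apply hk]
    · rw [ave_eq_zero hb f hF, Finset.sum_eq_zero, mul_zero]
      intro r _
      by_contra h
      have h1 : (π ^ r) k ∈ σ (b k) := ((hπ (b k)).1.perm_pow r).mapsTo hk
      exact hF (Finset.mem_image.2 ⟨_, Finsupp.mem_support_iff.2 h, (hb _ _).1 h1⟩)
  have hperm : ∀ r, N (Finsupp.equivMapDomain ((π ^ r).symm) f) = N f := fun r =>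
    hN.eq_of_perm (π ^ r).symm fun k => by simp [Finsupp.equivMapDomain_apply]
  have hL0 : (0 : ℝ) < L := by exact_mod_cast Nat.pos_of_ne_zero hL
  refine (hC _).1.trans ?_
  rw [mul_assoc]
  refine mul_le_mul_of_nonneg_left ?_ hC0.le
  rw [e, map_smul_eq_mul, norm_inv, RCLike.norm_ofReal, abs_of_pos hL0, inv_mul_le_iff₀ hL0]
  refine (Finset.le_sum_of_subadditive q (_root_.map_zero q).le (map_add_le_add q) _ _).trans ?_
  have : ∀ r ∈ Finset.range L, q (Finsupp.equivMapDomain ((π ^ r).symm) f) ≤ C * N f :=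
    fun r _ => by rw [← hperm r]; exact (hC _).2
  refine (Finset.sum_le_sum this).trans_eq ?_
  simp

/-! ### The fundamental function -/

namespace QuasiNorm.IsSymmetric

variable {N : QuasiNorm 𝕜 (ℕ →₀ 𝕜)}

theorem single_eq (hN : N.IsSymmetric) (k : ℕ) (c : 𝕜) :
    N (Finsupp.single k c) = ‖c‖ * fundamental N 1 := by
  have h : (Finsupp.single k c : ℕ →₀ 𝕜) = c • ind 𝕜 {k} := by simp [ind]
  rw [h, N.smul', hN.ind_eq, Finset.card_singleton]

end QuasiNorm.IsSymmetric

theorem fundamental_zero (N : QuasiNorm 𝕜 (ℕ →₀ 𝕜)) : fundamental N 0 = 0 := by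
  simp [fundamental, ind, N.map_zero]

theorem fundamental_pos (N : QuasiNorm 𝕜 (ℕ →₀ 𝕜)) {m : ℕ} (hm : 1 ≤ m) : 0 < fundamental N m := by
  refine N.pos_of_ne_zero fun h => ?_
  have := DFunLike.congr_fun h 0
  rw [ind_apply, if_pos (Finset.mem_range.2 hm)] at this
  simp at this

namespace QuasiNorm.IsSymmetric

variable {N : QuasiNorm 𝕜 (ℕ →₀ 𝕜)}

theorem exists_fundamental_mono (hN : N.IsSymmetric) :
    ∃ C : ℝ, 0 < C ∧ ∀ j m, j ≤ m → fundamental N j ≤ C * fundamental N m := by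
  obtain ⟨C, hC0, hC⟩ := hN.exists_lattice
  refine ⟨C, hC0, fun j m hjm => hC _ _ fun k => ?_⟩
  simp only [ind_apply, Finset.mem_range]
  by_cases h : k < j
  · simp [h, h.trans_le hjm]
  · simp [h]

theorem exists_mul_fundamental_le (hN : N.IsSymmetric) :
    ∃ C : ℝ, 0 < C ∧ ∀ (A : Finset ℕ) (f : ℕ →₀ 𝕜) (t : ℝ), 0 ≤ t → (∀ k ∈ A, t ≤ ‖f k‖) →
      t * fundamental N A.card ≤ C * N f := by
  obtain ⟨C, hC0, hC⟩ := hN.exists_lattice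
  refine ⟨C, hC0, fun A f t ht h => ?_⟩
  have h1 : t * fundamental N A.card = N ((t : 𝕜) • ind 𝕜 A) := by
    rw [N.smul', hN.ind_eq, RCLike.norm_ofReal, abs_of_nonneg ht]
  rw [h1]
  refine hC _ _ fun k => ?_
  rw [Finsupp.smul_apply, ind_apply]
  split_ifs with hk
  · simpa [abs_of_nonneg ht] using h k hk
  · simp

theorem exists_coord_le (hN : N.IsSymmetric) :
    ∃ C : ℝ, 0 < C ∧ ∀ (f : ℕ →₀ 𝕜) (k : ℕ), ‖f k‖ ≤ C * N f := by
  obtain ⟨C, hC0, hC⟩ := hN.exists_mul_fundamental_le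
  have h1 := fundamental_pos N le_rfl
  refine ⟨C / fundamental N 1, by positivity, fun f k => ?_⟩
  have := hC {k} f ‖f k‖ (norm_nonneg _) (by simp)
  rw [Finset.card_singleton] at this
  rw [div_mul_eq_mul_div, le_div_iff₀ h1]
  exact this

/-- The estimate `|Ave(f, A)| Λ_{|A|} ≤ C ‖f‖`: the functionals `v_n^*` are uniformly bounded. -/
theorem exists_ave_mul_fundamental_le (hN : N.IsSymmetric) (hconv : N.IsLocallyConvex) :
    ∃ C : ℝ, 0 < C ∧ ∀ (A : Finset ℕ) (f : ℕ →₀ 𝕜),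
      ‖ave f A‖ * fundamental N A.card ≤ C * N f := by
  classical
  obtain ⟨C, hC0, hC⟩ := hN.exists_avgProj_le hconv
  obtain ⟨D, hD0, hD⟩ := hN.exists_mul_fundamental_le
  refine ⟨D * C, by positivity, fun A f => ?_⟩
  -- a partition into finite sets one of which is `A`
  let σ : ℕ → Finset ℕ := fun n => if n = 0 then A else if n - 1 ∈ A then ∅ else {n - 1}
  let b : ℕ → ℕ := fun k => if k ∈ A then 0 else k + 1
  have hb : IsFibres σ b := by
    intro k n
    rcases n with _ | n
    · by_cases hk : k ∈ A <;> simp [σ, b, hk]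
    · by_cases hn : n ∈ A
      · by_cases hk : k ∈ A
        · simp [σ, b, hk, hn]
        · simp only [σ, b, hk]
          simp only [Nat.add_eq_zero_iff, one_ne_zero, and_false, ↓reduceIte, add_tsub_cancel_right,
            hn, Finset.notMem_empty, Nat.add_right_cancel_iff, false_iff]
          rintro rfl; exact hk hn
      · by_cases hk : k ∈ A
        · simp [σ, b, hk, hn]
          rintro rfl; exact hn hk
        · simp [σ, b, hk, hn]
  rw [mul_assoc]
  refine (hD A (avgProj σ f) ‖ave f A‖ (norm_nonneg _) fun k hk => ?_).trans
    (mul_le_mul_of_nonneg_left (hC σ b hb f) hD0.le)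
  rw [avgProj_apply hb]
  simp [σ, b, hk]

theorem exists_fundamental_div_le (hN : N.IsSymmetric) (hconv : N.IsLocallyConvex) :
    ∃ C : ℝ, 0 < C ∧ ∀ j m : ℕ, j ≤ m →
      j * fundamental N m ≤ C * (m * fundamental N j) := by
  obtain ⟨C, hC0, hC⟩ := hN.exists_ave_mul_fundamental_le hconv
  refine ⟨C, hC0, fun j m hjm => ?_⟩
  rcases Nat.eq_zero_or_pos m with rfl | hm
  · simp [Nat.le_zero.1 hjm]
  have h := hC (Finset.range m) (ind 𝕜 (Finset.range j))
  have e : ave (ind 𝕜 (Finset.range j)) (Finset.range m) = ((j : ℝ) / m : ℝ) := by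
    have : ∑ k ∈ Finset.range m, ind 𝕜 (Finset.range j) k = j := by
      simp only [ind_apply, Finset.mem_range]
      rw [← Finset.sum_filter, Finset.sum_const, nsmul_eq_mul, mul_one]
      congr 1
      rw [← Finset.card_range j]
      congr 1
      ext k
      simp only [Finset.mem_filter, Finset.mem_range, Finset.card_range]
      omega
    rw [ave, this, Finset.card_range]
    push_cast
    field_simp
  have hm' : (0 : ℝ) < m := by exact_mod_cast hm
  rw [e, RCLike.norm_ofReal, abs_of_nonneg (by positivity), Finset.card_range,
    div_mul_eq_mul_div, div_le_iff₀ hm', hN.ind_eq, Finset.card_range] at h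
  linarith

/-- The projections `Q_σ` are uniformly bounded. -/
theorem exists_sub_avgProj_le (hN : N.IsSymmetric) (hconv : N.IsLocallyConvex) :
    ∃ C : ℝ, 0 < C ∧ ∀ (σ : ℕ → Finset ℕ) (b : ℕ → ℕ), IsFibres σ b →
      ∀ f, N (f - avgProj σ f) ≤ C * N f := by
  obtain ⟨C, hC0, hC⟩ := hN.exists_avgProj_le hconv
  have hκ := N.modulus_pos
  refine ⟨N.modulus * (1 + C), by positivity, fun σ b hb f => (N.sub_le _ _).trans ?_⟩
  rw [mul_assoc, add_mul, one_mul]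
  have := hC σ b hb f
  gcongr

end QuasiNorm.IsSymmetric

/-! ### Quasi-concave sequences -/

/-- `Φ` is non-decreasing, `Φ_m / m` is non-increasing, and `Φ_0 = 0`. -/
structure IsQuasiconcave (Φ : ℕ → ℝ) : Prop where
  zero : Φ 0 = 0
  mono : Monotone Φ
  div : ∀ j m : ℕ, j ≤ m → j * Φ m ≤ m * Φ j

namespace IsQuasiconcave

variable {Φ : ℕ → ℝ}

theorem nonneg (h : IsQuasiconcave Φ) (m : ℕ) : 0 ≤ Φ m := h.zero ▸ h.mono (Nat.zero_le m)

theorem add_le (h : IsQuasiconcave Φ) (i j : ℕ) : Φ (i + j) ≤ Φ i + Φ j := by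
  rcases Nat.eq_zero_or_pos (i + j) with h0 | h0
  · have h1 : i = 0 := by omega
    have h2 : j = 0 := by omega
    simp [h1, h2, h.zero]
  have h1 := h.div i (i + j) (by omega)
  have h2 := h.div j (i + j) (by omega)
  have h0' : (0 : ℝ) < (i + j : ℕ) := by exact_mod_cast h0
  refine le_of_mul_le_mul_left ?_ h0'
  have e : ((i + j : ℕ) : ℝ) * Φ (i + j) = i * Φ (i + j) + j * Φ (i + j) := by push_cast; ring
  rw [e, mul_add]
  exact add_le_add h1 h2

/-- The non-increasing weight `Φ_m / m`, indexed from `0`. -/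
def weight (Φ : ℕ → ℝ) (n : ℕ) : ℝ := Φ (n + 1) / (n + 1)

theorem weight_nonneg (h : IsQuasiconcave Φ) (n : ℕ) : 0 ≤ weight Φ n :=
  div_nonneg (h.nonneg _) (by positivity)

theorem weight_antitone (h : IsQuasiconcave Φ) : Antitone (weight Φ) := by
  intro j m hjm
  have := h.div (j + 1) (m + 1) (by omega)
  rw [weight, weight, div_le_div_iff₀ (by positivity) (by positivity)]
  push_cast at this
  linarith

theorem le_sum_weight (h : IsQuasiconcave Φ) (m : ℕ) : Φ m ≤ ∑ j ∈ Finset.range m, weight Φ j := by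
  induction m with
  | zero => simp [h.zero]
  | succ m ih =>
    rw [Finset.sum_range_succ]
    rcases Nat.eq_zero_or_pos m with rfl | hm
    · simp [weight]
    have h1 := h.div m (m + 1) (by omega)
    have h2 : Φ (m + 1) - Φ m ≤ weight Φ m := by
      rw [weight, le_div_iff₀ (by positivity)]
      push_cast at h1
      linarith
    linarith

/-- Under the lower regularity property, the primitive of the weight `Φ_m / m` is equivalent to
`Φ`. Indeed it grows by at most `2 b Φ_m` between `m / b` and `m`, while `Φ_m` doubles. -/
theorem exists_sum_weight_le (h : IsQuasiconcave Φ) {c : ℕ} (hc : 0 < c)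
    (hlrp : ∀ m, 1 ≤ m → 2 * Φ m ≤ Φ (c * m)) :
    ∃ K : ℝ, 0 < K ∧ ∀ m, ∑ j ∈ Finset.range m, weight Φ j ≤ K * Φ m := by
  have hc' : (0 : ℝ) < c := by exact_mod_cast hc
  refine ⟨4 * c, by positivity, fun m => ?_⟩
  induction m using Nat.strong_induction_on with
  | _ m ih =>
  rcases Nat.lt_or_ge m c with hm | hm
  · rcases Nat.eq_zero_or_pos m with rfl | hm0
    · simp [h.zero]
    have h1 : ∀ j ∈ Finset.range m, weight Φ j ≤ Φ m := fun j _ => by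
      refine (h.weight_antitone (Nat.zero_le j)).trans ?_
      simpa [weight] using h.mono (show 1 ≤ m from hm0)
    refine (Finset.sum_le_card_nsmul _ _ _ h1).trans ?_
    rw [Finset.card_range, nsmul_eq_mul]
    have h2 : (m : ℝ) ≤ c := by exact_mod_cast hm.le
    have h3 := h.nonneg m
    nlinarith
  · set l := m / c with hl
    have hl0 : 1 ≤ l := (Nat.one_le_div_iff hc).2 hm
    have hl1 : c * l ≤ m := Nat.mul_div_le m c
    have hlm : l ≤ m := Nat.div_le_self m c
    rcases Nat.eq_or_lt_of_le hlm with heq | hlt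
    · -- here `c = 1`, which the doubling condition excludes unless `Φ` vanishes
      have h1 := hlrp l hl0
      have h2 := h.mono hl1
      have h3 : Φ m = 0 := le_antisymm (by rw [heq] at h1 h2; linarith) (h.nonneg m)
      have h4 : ∀ j ∈ Finset.range m, weight Φ j ≤ 0 := fun j hj => by
        have : Φ (j + 1) ≤ Φ m := h.mono (by simpa using hj)
        rw [h3] at this
        exact div_nonpos_of_nonpos_of_nonneg this (by positivity)
      rw [h3, mul_zero]
      exact Finset.sum_nonpos h4
    have hm2 : m ≤ 2 * c * l := by
      have := Nat.lt_mul_div_succ m hc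
      rw [← hl] at this
      nlinarith
    have hl' : (0 : ℝ) < l := by exact_mod_cast hl0
    have h1 : ∀ j ∈ Finset.Ico l m, weight Φ j ≤ Φ m / l := fun j hj => by
      rw [Finset.mem_Ico] at hj
      have h2 : (l : ℝ) ≤ j + 1 := by exact_mod_cast hj.1.trans (Nat.le_succ j)
      exact div_le_div₀ (h.nonneg m) (h.mono (by omega)) hl' h2
    have h2 := Finset.sum_le_card_nsmul _ _ _ h1
    rw [Nat.card_Ico, nsmul_eq_mul] at h2
    have h3 := ih l hlt
    have h4 : 2 * Φ l ≤ Φ m := (hlrp l hl0).trans (h.mono hl1)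
    have h5 : ((m - l : ℕ) : ℝ) * (Φ m / l) ≤ 2 * c * Φ m := by
      have h6 : ((m - l : ℕ) : ℝ) ≤ 2 * c * l := by exact_mod_cast (Nat.sub_le _ _).trans hm2
      calc ((m - l : ℕ) : ℝ) * (Φ m / l) ≤ 2 * c * l * (Φ m / l) := by
            gcongr
            exact div_nonneg (h.nonneg m) hl'.le
        _ = 2 * c * Φ m := by field_simp
    rw [← Finset.sum_range_add_sum_Ico _ hlm]
    nlinarith

end IsQuasiconcave

/-- An antitone sequence has its largest sums over initial segments. -/
theorem sum_le_sum_range_card {u : ℕ → ℝ} (hu : Antitone u) (A : Finset ℕ) :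
    ∑ k ∈ A, u k ≤ ∑ k ∈ Finset.range A.card, u k := by
  induction hn : A.card generalizing A with
  | zero => simp [Finset.card_eq_zero.1 hn]
  | succ n ih =>
    have hne : A.Nonempty := Finset.card_pos.1 (by omega)
    have hmax := A.max'_mem hne
    have h1 : (A.erase (A.max' hne)).card = n := by rw [Finset.card_erase_of_mem hmax]; omega
    have h2 : n ≤ A.max' hne := by
      have : A ⊆ Finset.range (A.max' hne + 1) := fun k hk => by
        have := A.le_max' k hk
        simp only [Finset.mem_range]; omega
      have := Finset.card_le_card this
      rw [Finset.card_range] at this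
      omega
    rw [← Finset.sum_erase_add _ _ hmax, Finset.sum_range_succ]
    exact add_le_add (ih _ h1) (hu h2)

/-- A positive sequence that is non-decreasing up to a constant, and such that `Λ_m / m` is
non-increasing up to a constant, is equivalent to a quasi-concave sequence. -/
theorem exists_isQuasiconcave {L : ℕ → ℝ} (h0 : L 0 = 0) (hpos : ∀ m, 1 ≤ m → 0 < L m)
    {C : ℝ} (hmono : ∀ j m, j ≤ m → L j ≤ C * L m)
    (hdiv : ∀ j m : ℕ, j ≤ m → j * L m ≤ C * (m * L j)) :
    ∃ Φ : ℕ → ℝ, IsQuasiconcave Φ ∧ ∀ m, L m ≤ Φ m ∧ Φ m ≤ C * L m := by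
  have hL : ∀ m, 0 ≤ L m := fun m => by
    rcases Nat.eq_zero_or_pos m with rfl | h
    · exact h0.ge
    · exact (hpos m h).le
  have hle : ∀ m j : ℕ, min 1 ((m : ℝ) / (j + 1)) * L (j + 1) ≤ C * L m := by
    intro m j
    rcases Nat.lt_or_ge m (j + 1) with h | h
    · have h1 := hdiv m (j + 1) h.le
      refine (mul_le_mul_of_nonneg_right (min_le_right _ _) (hL _)).trans ?_
      rw [div_mul_eq_mul_div, div_le_iff₀ (by positivity)]
      push_cast at h1
      linarith
    · refine (mul_le_mul_of_nonneg_right (min_le_left _ _) (hL _)).trans ?_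
      rw [one_mul]
      exact hmono _ _ h
  have hbdd : ∀ m : ℕ, BddAbove (Set.range fun j : ℕ => min 1 ((m : ℝ) / (j + 1)) * L (j + 1)) :=
    fun m => ⟨C * L m, by rintro _ ⟨j, rfl⟩; exact hle m j⟩
  refine ⟨fun m => ⨆ j : ℕ, min 1 ((m : ℝ) / (j + 1)) * L (j + 1), ⟨?_, ?_, ?_⟩,
    fun m => ⟨?_, ciSup_le (hle m)⟩⟩
  · simp
  · intro i m him
    refine ciSup_mono (hbdd m) fun j => mul_le_mul_of_nonneg_right ?_ (hL _)
    gcongr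
  · intro i m him
    rcases Nat.eq_zero_or_pos i with rfl | hi
    · simp
    have hi' : (0 : ℝ) < i := by exact_mod_cast hi
    have him' : (i : ℝ) ≤ m := by exact_mod_cast him
    have hm' : (0 : ℝ) < m := hi'.trans_le him'
    rw [mul_comm, ← le_div_iff₀ hi']
    refine ciSup_le fun j => ?_
    rw [le_div_iff₀ hi']
    refine le_trans ?_ (mul_le_mul_of_nonneg_left (le_ciSup (hbdd i) j) hm'.le)
    have h1 : min 1 ((m : ℝ) / (j + 1)) * i ≤ m * min 1 ((i : ℝ) / (j + 1)) := by
      rw [mul_min_of_nonneg _ _ hm'.le, mul_one]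
      refine le_min ?_ ?_
      · exact (mul_le_of_le_one_left hi'.le (min_le_left _ _)).trans him'
      · refine (mul_le_mul_of_nonneg_right (min_le_right _ _) hi'.le).trans_eq ?_
        ring
    have h2 := mul_le_mul_of_nonneg_right h1 (hL (j + 1))
    calc _ = min 1 ((m : ℝ) / (j + 1)) * i * L (j + 1) := by ring
      _ ≤ _ := h2
      _ = _ := by ring
  · rcases m with _ | m
    · rw [h0]; simp
    · refine le_trans ?_ (le_ciSup (hbdd (m + 1)) m)
      have : ((m + 1 : ℕ) : ℝ) / (m + 1) = 1 := by push_cast; field_simp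
      rw [this]
      simp

theorem QuasiNorm.IsSymmetric.exists_isQuasiconcave_fundamental {N : QuasiNorm 𝕜 (ℕ →₀ 𝕜)}
    (hN : N.IsSymmetric) (hconv : N.IsLocallyConvex) :
    ∃ (Φ : ℕ → ℝ) (C : ℝ), IsQuasiconcave Φ ∧ 0 < C ∧
      ∀ m, fundamental N m ≤ Φ m ∧ Φ m ≤ C * fundamental N m := by
  obtain ⟨C, hC0, hC⟩ := hN.exists_fundamental_mono
  obtain ⟨D, hD0, hD⟩ := hN.exists_fundamental_div_le hconv
  have hpos : ∀ m, 0 ≤ fundamental N m := fun m => N.nonneg' _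
  obtain ⟨Φ, h1, h2⟩ := exists_isQuasiconcave (L := fundamental N) (C := max C D)
    (fundamental_zero N) (fun m hm => fundamental_pos N hm)
    (fun j m hjm => (hC j m hjm).trans
      (mul_le_mul_of_nonneg_right (le_max_left _ _) (hpos m)))
    (fun j m hjm => (hD j m hjm).trans (mul_le_mul_of_nonneg_right (le_max_right _ _)
      (mul_nonneg (by positivity) (hpos j))))
  exact ⟨Φ, max C D, h1, by positivity, h2⟩

/-! ### Ordered partitions -/

namespace IsOrderedPartition

variable {σ : ℕ → Finset ℕ}

theorem exists_isFibres (hσ : IsOrderedPartition σ) : ∃ b, IsFibres σ b := by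
  choose b hb using hσ.cover
  refine ⟨b, fun k n => ⟨fun h => ?_, fun h => h ▸ hb k⟩⟩
  rcases lt_trichotomy (b k) n with h1 | h1 | h1
  · exact absurd (hσ.ordered _ _ h1 k (hb k) k h) (lt_irrefl _)
  · exact h1
  · exact absurd (hσ.ordered _ _ h1 k h k (hb k)) (lt_irrefl _)

theorem fibre_mono (hσ : IsOrderedPartition σ) {b : ℕ → ℕ} (hb : IsFibres σ b) : Monotone b := by
  intro i j hij
  by_contra! h
  have := hσ.ordered _ _ h j ((hb _ _).2 rfl) i ((hb _ _).2 rfl)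
  omega

/-- The first `n` blocks fill an initial segment of `ℕ`. -/
theorem fibre_lt_iff (hσ : IsOrderedPartition σ) {b : ℕ → ℕ} (hb : IsFibres σ b) (k n : ℕ) :
    b k < n ↔ k < ∑ j ∈ Finset.range n, (σ j).card := by
  classical
  set D := (Finset.range n).biUnion σ with hD
  have hmem : ∀ k, k ∈ D ↔ b k < n := fun k => by
    simp only [hD, Finset.mem_biUnion, Finset.mem_range, hb k]
    exact ⟨by rintro ⟨j, hj, rfl⟩; exact hj, fun h => ⟨_, h, rfl⟩⟩
  have hcard : D.card = ∑ j ∈ Finset.range n, (σ j).card := by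
    refine Finset.card_biUnion fun i _ j _ hij => Finset.disjoint_left.2 fun k hk hk' => hij ?_
    rw [← (hb _ _).1 hk, ← (hb _ _).1 hk']
  have hsub : D ⊆ Finset.range D.card := by
    intro k hk
    have h1 : Finset.range (k + 1) ⊆ D := fun j hj => by
      rw [hmem] at hk ⊢
      have hjk : j ≤ k := by simpa [Nat.lt_succ_iff] using hj
      exact (hσ.fibre_mono hb hjk).trans_lt hk
    have := Finset.card_le_card h1
    rw [Finset.card_range] at this
    simp only [Finset.mem_range]; omega
  have heq := Finset.eq_of_subset_of_card_le hsub (by simp)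
  rw [← hmem, ← hcard]
  conv_lhs => rw [heq]
  simp

theorem fibre_card_pos (hσ : IsOrderedPartition σ) (n : ℕ) : 0 < (σ n).card :=
  Finset.card_pos.2 (hσ.nonempty n)

end IsOrderedPartition

end Symmetric

section Frames

variable {𝕜 X Y : Type*} [RCLike 𝕜] [AddCommGroup X] [Module 𝕜 X] [AddCommGroup Y] [Module 𝕜 Y]

/-! ### Sequence spaces -/

namespace SequenceSpace

variable (S : SequenceSpace 𝕜)

/-- The inclusion of `c₀₀` into a sequence space. -/
def incl : (ℕ →₀ 𝕜) →ₗ[𝕜] S.carrier where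
  toFun f := ⟨f, S.c00_mem f⟩
  map_add' _ _ := rfl
  map_smul' _ _ := rfl

/-- The coordinate functionals of a sequence space. -/
def coord (k : ℕ) : S.carrier →ₗ[𝕜] 𝕜 where
  toFun f := f.1 k
  map_add' _ _ := rfl
  map_smul' _ _ := rfl

theorem coord_isBounded (k : ℕ) : S.qnorm.IsBounded (S.coord k) := S.coord_bounded k

theorem incl_dense : ∀ f, ∀ ε > 0, ∃ g, S.qnorm (f - S.incl g) < ε := S.dense

theorem qnorm_incl (f : ℕ →₀ 𝕜) : S.qnorm (S.incl f) = S.qnorm00 f := rfl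

variable {S}

theorem ext_coord {f g : S.carrier} (h : ∀ k, f.1 k = g.1 k) : f = g :=
  Subtype.ext (funext h)

theorem qnorm00_isLocallyConvex (h : S.qnorm.IsLocallyConvex) : S.qnorm00.IsLocallyConvex := by
  obtain ⟨q, C, hC⟩ := h
  exact ⟨q.comp S.incl, C, fun f => hC (S.incl f)⟩

/-- If `|f| ≥ t` on `A`, then `t Λ_{|A|} ≲ ‖f‖`. -/
theorem IsSymmetric.exists_mul_fundamental_le (hS : S.IsSymmetric) :
    ∃ C : ℝ, 0 < C ∧ ∀ (A : Finset ℕ) (f : S.carrier) (t : ℝ), 0 ≤ t → (∀ k ∈ A, t ≤ ‖f.1 k‖) →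
      t * fundamental S.norm00 A.card ≤ C * S.qnorm f := by
  obtain ⟨C, hC0, hC⟩ := hS.qnorm00.exists_mul_fundamental_le
  refine ⟨C * S.qnorm.modulus, by have := S.qnorm.modulus_pos; positivity, fun A f t ht h => ?_⟩
  obtain ⟨u, hu⟩ := QuasiNorm.exists_seq_of_dense S.incl_dense f
  -- the vectors of `c₀₀` that approximate `f` have almost the same coordinates
  have hcoord : ∀ k, Tendsto (fun n => ‖u n k - f.1 k‖) atTop (𝓝 0) := fun k =>
    (QuasiNorm.isBounded_iff.1 (S.coord_isBounded k)).convergesTo hu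
  have h1 : Tendsto (fun n => ∑ k ∈ A, ‖u n k - f.1 k‖) atTop (𝓝 0) := by
    simpa using tendsto_finsetSum A fun k _ => hcoord k
  have h2 : Tendsto (fun n => (t - ∑ k ∈ A, ‖u n k - f.1 k‖) * fundamental S.norm00 A.card)
      atTop (𝓝 ((t - 0) * fundamental S.norm00 A.card)) := (tendsto_const_nhds.sub h1).mul_const _
  have h3 : Tendsto (fun n => C * (S.qnorm.modulus * (S.qnorm f + S.qnorm (S.incl (u n) - f))))
      atTop (𝓝 (C * (S.qnorm.modulus * (S.qnorm f + 0)))) :=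
    ((tendsto_const_nhds.add hu).const_mul _).const_mul _
  rw [sub_zero] at h2
  rw [add_zero, ← mul_assoc] at h3
  refine le_of_tendsto_of_tendsto' h2 h3 fun n => ?_
  have hpos : 0 ≤ fundamental S.norm00 A.card := S.qnorm00.nonneg' _
  have h4 : S.qnorm00 (u n) ≤ S.qnorm.modulus * (S.qnorm f + S.qnorm (S.incl (u n) - f)) :=
    S.qnorm.le_add_sub (S.incl (u n)) f
  refine le_trans ?_ (mul_le_mul_of_nonneg_left h4 hC0.le)
  rcases le_or_gt 0 (t - ∑ k ∈ A, ‖u n k - f.1 k‖) with h5 | h5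
  · refine hC A (u n) _ h5 fun k hk => ?_
    have h6 : ‖u n k - f.1 k‖ ≤ ∑ k ∈ A, ‖u n k - f.1 k‖ :=
      Finset.single_le_sum (f := fun k => ‖u n k - f.1 k‖) (fun _ _ => norm_nonneg _) hk
    have h7 := h k hk
    have h8 := norm_sub_norm_le (f.1 k) (u n k)
    rw [norm_sub_rev] at h8
    linarith
  · exact (mul_nonpos_of_nonpos_of_nonneg h5.le hpos).trans
      (mul_nonneg hC0.le (S.qnorm00.nonneg' _))

theorem IsSymmetric.exists_coord_le (hS : S.IsSymmetric) :
    ∃ C : ℝ, 0 < C ∧ ∀ (f : S.carrier) (k : ℕ), ‖f.1 k‖ ≤ C * S.qnorm f := by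
  obtain ⟨C, hC0, hC⟩ := hS.exists_mul_fundamental_le
  have h1 : 0 < fundamental S.norm00 1 := fundamental_pos S.qnorm00 le_rfl
  refine ⟨C / fundamental S.norm00 1, by positivity, fun f k => ?_⟩
  have := hC {k} f ‖f.1 k‖ (norm_nonneg _) (by simp)
  rw [Finset.card_singleton] at this
  rw [div_mul_eq_mul_div, le_div_iff₀ h1]
  exact this

end SequenceSpace

/-! ### Vectors that are constant on the blocks -/

/-- The vector of `c₀₀` that takes the value `a n` on the block `σ n`. -/
def blockVec (𝕜 : Type*) [RCLike 𝕜] (σ : ℕ → Finset ℕ) : (ℕ →₀ 𝕜) →ₗ[𝕜] (ℕ →₀ 𝕜) :=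
  Finsupp.linearCombination 𝕜 fun n => ind 𝕜 (σ n)

theorem blockVec_single (σ : ℕ → Finset ℕ) (n : ℕ) (c : 𝕜) :
    blockVec 𝕜 σ (Finsupp.single n c) = c • ind 𝕜 (σ n) := by
  simp [blockVec]

theorem blockVec_apply {σ : ℕ → Finset ℕ} {b : ℕ → ℕ} (hb : IsFibres σ b) (a : ℕ →₀ 𝕜) (k : ℕ) :
    blockVec 𝕜 σ a k = a (b k) := by
  rw [blockVec, Finsupp.linearCombination_apply, Finsupp.sum, Finsupp.finsetSum_apply]
  simp only [Finsupp.smul_apply, ind_apply, hb k, smul_eq_mul, mul_ite, mul_one, mul_zero,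
    Finset.sum_ite_eq]
  split_ifs with h
  · rfl
  · exact (Finsupp.notMem_support_iff.1 h).symm

theorem ave_eq_of_forall {A : Finset ℕ} (hA : A.Nonempty) {f : ℕ →₀ 𝕜} {c : 𝕜}
    (h : ∀ k ∈ A, f k = c) : ave f A = c := by
  have : (A.card : 𝕜) ≠ 0 := by exact_mod_cast (Finset.card_pos.2 hA).ne'
  rw [ave, Finset.sum_congr rfl h, Finset.sum_const, nsmul_eq_mul]
  field_simp

section Blocks

variable {σ : ℕ → Finset ℕ} (hσ : IsOrderedPartition σ) {b : ℕ → ℕ} (hb : IsFibres σ b)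

theorem ave_blockVec (hσ : IsOrderedPartition σ) (hb : IsFibres σ b) (a : ℕ →₀ 𝕜) (n : ℕ) :
    ave (blockVec 𝕜 σ a) (σ n) = a n :=
  ave_eq_of_forall (hσ.nonempty n) fun k hk => by rw [blockVec_apply hb, (hb _ _).1 hk]

theorem ave_avgProj (hσ : IsOrderedPartition σ) (hb : IsFibres σ b) (f : ℕ →₀ 𝕜) (n : ℕ) :
    ave (avgProj σ f) (σ n) = ave f (σ n) :=
  ave_eq_of_forall (hσ.nonempty n) fun k hk => by rw [avgProj_apply hb, (hb _ _).1 hk]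

theorem avgProj_blockVec (hσ : IsOrderedPartition σ) (hb : IsFibres σ b) (a : ℕ →₀ 𝕜) :
    avgProj σ (blockVec 𝕜 σ a) = blockVec 𝕜 σ a := by
  ext k
  rw [avgProj_apply hb, ave_blockVec hσ hb, blockVec_apply hb]

theorem ave_sub (f g : ℕ →₀ 𝕜) (A : Finset ℕ) : ave (f - g) A = ave f A - ave g A := by
  simp [ave, Finset.sum_sub_distrib, mul_sub]

theorem ave_sub_avgProj (hσ : IsOrderedPartition σ) (hb : IsFibres σ b) (f : ℕ →₀ 𝕜) (n : ℕ) :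
    ave (f - avgProj σ f) (σ n) = 0 := by
  rw [ave_sub, ave_avgProj hσ hb, sub_self]

theorem blockSum_eq_finsum (NS : (ℕ →₀ 𝕜) → ℝ) (σ : ℕ → Finset ℕ) (x : ℕ → X) (f : ℕ →₀ 𝕜) :
    blockSum NS σ x f = ∑ᶠ n, ave f (σ n) • ((fundamental NS (σ n).card : 𝕜) • x n) := by
  simp only [blockSum, vstar, smul_smul, mul_comm]

theorem blockSum_eq_sum (hb : IsFibres σ b) (NS : (ℕ →₀ 𝕜) → ℝ) (x : ℕ → X) (f : ℕ →₀ 𝕜) :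
    blockSum NS σ x f =
      ∑ n ∈ f.support.image b, ave f (σ n) • ((fundamental NS (σ n).card : 𝕜) • x n) := by
  rw [blockSum_eq_finsum, finsum_ave_smul_eq hb]

theorem blockSum_blockVec (hσ : IsOrderedPartition σ) (hb : IsFibres σ b) (NS : (ℕ →₀ 𝕜) → ℝ)
    (x : ℕ → X) (a : ℕ →₀ 𝕜) :
    blockSum NS σ x (blockVec 𝕜 σ a) =
      a.sum fun n c => c • ((fundamental NS (σ n).card : 𝕜) • x n) := by
  rw [blockSum_eq_finsum]
  simp only [ave_blockVec hσ hb]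
  refine finsum_eq_sum_of_support_subset _ fun n hn => ?_
  simp only [Function.mem_support] at hn
  simp only [Finset.mem_coe, Finsupp.mem_support_iff]
  rintro h
  exact hn (by simp [h])

theorem blockSum_of_ave_eq_zero {f : ℕ →₀ 𝕜} (hf : ∀ n, ave f (σ n) = 0) (NS : (ℕ →₀ 𝕜) → ℝ)
    (x : ℕ → X) : blockSum NS σ x f = 0 := by
  simp [blockSum_eq_finsum, hf]

theorem avgProj_of_ave_eq_zero {f : ℕ →₀ 𝕜} (hf : ∀ n, ave f (σ n) = 0) : avgProj σ f = 0 := by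
  simp [avgProj, hf]

/-- `Q_σ` as a linear map on `c₀₀`. -/
def residual (hσ : IsOrderedPartition σ) : (ℕ →₀ 𝕜) →ₗ[𝕜] (ℕ →₀ 𝕜) :=
  LinearMap.id - (isLinearMap_finsum hσ fun n => ind 𝕜 (σ n)).mk' _

theorem residual_apply (hσ : IsOrderedPartition σ) (f : ℕ →₀ 𝕜) :
    residual hσ f = f - avgProj σ f := rfl

/-- The linear map `f ↦ ∑ v_n^*(f) x_n` on `c₀₀`. -/
def blockSumMap (hσ : IsOrderedPartition σ) (NS : (ℕ →₀ 𝕜) → ℝ) (x : ℕ → X) : (ℕ →₀ 𝕜) →ₗ[𝕜] X :=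
  (isLinearMap_finsum hσ fun n => (fundamental NS (σ n).card : 𝕜) • x n).mk' _

theorem blockSumMap_apply (hσ : IsOrderedPartition σ) (NS : (ℕ →₀ 𝕜) → ℝ) (x : ℕ → X)
    (f : ℕ →₀ 𝕜) : blockSumMap hσ NS x f = blockSum NS σ x f :=
  (blockSum_eq_finsum NS σ x f).symm

end Blocks

/-! ### The two components of the space `𝕐` -/

/-- The bounded maps that describe the completion `Y`: extensions `Q` and `T` of `Q_σ` and of
`f ↦ ∑ v_n^*(f) x_n`, which jointly determine the quasi-norm up to a constant, and a section `J` of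
`T` that maps `x_n` to a multiple of the indicator of `σ_n`. -/
structure Frame (S : SequenceSpace 𝕜) (σ : ℕ → Finset ℕ) (b : ℕ → ℕ) (NX : QuasiNorm 𝕜 X)
    (x : ℕ → X) (NY : QuasiNorm 𝕜 Y) (ι : (ℕ →₀ 𝕜) →ₗ[𝕜] Y) where
  Q : Y →ₗ[𝕜] S.carrier
  T : Y →ₗ[𝕜] X
  J : X →ₗ[𝕜] Y
  fibres : IsFibres σ b
  partition : IsOrderedPartition σ
  completion : IsCompletion (dkkNorm S.norm00 σ NX x) NY ι
  Q_ι : ∀ f, Q (ι f) = S.incl (f - avgProj σ f)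
  T_ι : ∀ f, T (ι f) = blockSum S.norm00 σ x f
  J_x : ∀ n, J (x n) = (fundamental S.norm00 (σ n).card : 𝕜)⁻¹ • ι (ind 𝕜 (σ n))
  Q_J : ∀ g, Q (J g) = 0
  T_J : ∀ g, T (J g) = g
  Q_bounded : NY.BoundedMap S.qnorm Q
  T_bounded : NY.BoundedMap NX T
  J_bounded : NX.BoundedMap NY J
  le_add : ∃ C, 0 < C ∧ ∀ y, NY y ≤ C * (S.qnorm (Q y) + NX (T y))

variable {S : SequenceSpace 𝕜} {σ : ℕ → Finset ℕ} {b : ℕ → ℕ} {NX : QuasiNorm 𝕜 X}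
  {x : ℕ → X} {NY : QuasiNorm 𝕜 Y} {ι : (ℕ →₀ 𝕜) →ₗ[𝕜] Y}

theorem fundamental_card_pos (S : SequenceSpace 𝕜) (hσ : IsOrderedPartition σ) (n : ℕ) :
    0 < fundamental S.norm00 (σ n).card :=
  fundamental_pos S.qnorm00 (hσ.fibre_card_pos n)

theorem fundamental_card_ne_zero (S : SequenceSpace 𝕜) (hσ : IsOrderedPartition σ) (n : ℕ) :
    (fundamental S.norm00 (σ n).card : 𝕜) ≠ 0 := by
  exact_mod_cast (fundamental_card_pos S hσ n).ne'

theorem dkkNorm_blockVec (hσ : IsOrderedPartition σ) (hb : IsFibres σ b) (S : SequenceSpace 𝕜)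
    (NX : QuasiNorm 𝕜 X) (x : ℕ → X) (a : ℕ →₀ 𝕜) :
    dkkNorm S.norm00 σ NX x (blockVec 𝕜 σ a) =
      NX (a.sum fun n c => c • ((fundamental S.norm00 (σ n).card : 𝕜) • x n)) := by
  have h : S.norm00 0 = 0 := S.qnorm00.map_zero
  rw [dkkNorm, avgProj_blockVec hσ hb, sub_self, blockSum_blockVec hσ hb, h, zero_add]

/-- `J` is well defined and bounded because the vector with value `Λ_{|σ_n|}⁻¹ a_n` on each `σ_n` has
the same quasi-norm as `∑ a_n x_n`. -/
theorem exists_frame (hσ : IsOrderedPartition σ) (hb : IsFibres σ b)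
    (hX : NX.IsComplete) (hx_gen : NX.closedSpan (Set.range x) = ⊤)
    (hY : IsCompletion (dkkNorm S.norm00 σ NX x) NY ι) : Nonempty (Frame S σ b NX x NY ι) := by
  obtain ⟨Q, hQ, hQb⟩ := NY.exists_extension S.complete ι hY.dense (S.incl ∘ₗ residual hσ)
    ⟨1, fun f => by
      rw [hY.isometric, one_mul]
      exact le_add_of_nonneg_right (NX.nonneg' _)⟩
  obtain ⟨T, hT, hTb⟩ := NY.exists_extension hX ι hY.dense (blockSumMap hσ S.norm00 x)
    ⟨1, fun f => by
      rw [hY.isometric, one_mul, blockSumMap_apply]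
      exact le_add_of_nonneg_left (S.qnorm.nonneg' _)⟩
  have hxd : ∀ g, ∀ ε > 0, ∃ a, NX (g - Finsupp.linearCombination 𝕜 x a) < ε := fun g ε hε => by
    obtain ⟨⟨v, hv⟩, h⟩ := QuasiNorm.dense_span_of_closedSpan_eq_top hx_gen g ε hε
    obtain ⟨a, rfl⟩ := (Finsupp.mem_span_range_iff_exists_finsupp).1 hv
    exact ⟨a, h⟩
  -- the coefficients are divided by `Λ_{|σ_n|}`
  let D : (ℕ →₀ 𝕜) →ₗ[𝕜] (ℕ →₀ 𝕜) := Finsupp.linearCombination 𝕜 fun n =>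
    Finsupp.single n ((fundamental S.norm00 (σ n).card : 𝕜)⁻¹)
  have hD : ∀ n c, D (Finsupp.single n c) =
      Finsupp.single n ((fundamental S.norm00 (σ n).card : 𝕜)⁻¹ * c) := fun n c => by
    simp [D, mul_comm]
  have hTD : blockSumMap hσ S.norm00 x ∘ₗ blockVec 𝕜 σ ∘ₗ D = Finsupp.linearCombination 𝕜 x := by
    ext n
    simp only [LinearMap.comp_apply, Finsupp.lsingle_apply, hD, blockSumMap_apply,
      blockSum_blockVec hσ hb]
    rw [Finsupp.sum_single_index (by simp)]
    simp [smul_smul, inv_mul_cancel₀ (fundamental_card_ne_zero S hσ n)]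
  have hTD' : ∀ a, blockSum S.norm00 σ x (blockVec 𝕜 σ (D a)) = Finsupp.linearCombination 𝕜 x a :=
    fun a => by rw [← hTD]; exact (blockSumMap_apply hσ _ _ _).symm
  obtain ⟨J, hJ, hJb⟩ := NX.exists_extension hY.complete (Finsupp.linearCombination 𝕜 x) hxd
    (ι ∘ₗ blockVec 𝕜 σ ∘ₗ D) ⟨1, fun a => by
      have h : S.norm00 0 = 0 := S.qnorm00.map_zero
      simp only [LinearMap.comp_apply]
      rw [hY.isometric, dkkNorm, avgProj_blockVec hσ hb, sub_self, h, zero_add, one_mul, hTD']⟩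
  refine ⟨⟨Q, T, J, hb, hσ, hY, hQ, fun f => (hT f).trans (blockSumMap_apply _ _ _ _), fun n => ?_,
    fun g => ?_, fun g => ?_, hQb, hTb, hJb, ?_⟩⟩
  · have h := hJ (Finsupp.single n 1)
    simp only [Finsupp.linearCombination_single, one_smul, LinearMap.comp_apply, hD, mul_one,
      blockVec_single, map_smul] at h
    exact h
  · have h : Q ∘ₗ J = 0 := (hQb.comp hJb).ext_of_dense (QuasiNorm.BoundedMap.zero _ _) hxd
      fun a => by
        rw [LinearMap.comp_apply, hJ]
        simp only [LinearMap.comp_apply]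
        rw [hQ, LinearMap.comp_apply, residual_apply, avgProj_blockVec hσ hb, sub_self]
        simp
    exact LinearMap.congr_fun h g
  · have h : T ∘ₗ J = LinearMap.id := (hTb.comp hJb).ext_of_dense (QuasiNorm.BoundedMap.id _) hxd
      fun a => by
        rw [LinearMap.comp_apply, hJ]
        simp only [LinearMap.comp_apply]
        rw [hT, blockSumMap_apply, hTD', LinearMap.id_apply]
    exact LinearMap.congr_fun h g
  · obtain ⟨C, hC0, hC⟩ := hQb.exists_pos
    obtain ⟨D, hD0, hD⟩ := hTb.exists_pos
    have h1 := S.qnorm.modulus_pos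
    have h2 := NX.modulus_pos
    have h3 := NY.modulus_pos
    refine ⟨NY.modulus * (S.qnorm.modulus + NX.modulus), by positivity, fun y => ?_⟩
    obtain ⟨u, hu⟩ := QuasiNorm.exists_seq_of_dense hY.dense y
    have h4 : Tendsto (fun n => S.qnorm.modulus * (S.qnorm (Q y) + S.qnorm (Q (ι (u n)) - Q y)) +
        NX.modulus * (NX (T y) + NX (T (ι (u n)) - T y))) atTop
        (𝓝 (S.qnorm.modulus * (S.qnorm (Q y) + 0) + NX.modulus * (NX (T y) + 0))) :=
      ((tendsto_const_nhds.add (hQb.convergesTo hu)).const_mul _).add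
        ((tendsto_const_nhds.add (hTb.convergesTo hu)).const_mul _)
    have h5 := hu.le h4 (Eventually.of_forall fun n => by
      rw [hY.isometric, dkkNorm]
      have e1 : S.norm00 (u n - avgProj σ (u n)) = S.qnorm (Q (ι (u n))) := by rw [hQ]; rfl
      have e2 : NX (blockSum S.norm00 σ x (u n)) = NX (T (ι (u n))) := by
        rw [hT, blockSumMap_apply]
      rw [e1, e2]
      exact add_le_add (S.qnorm.le_add_sub _ _) (NX.le_add_sub _ _))
    rw [add_zero, add_zero] at h5
    refine h5.trans ?_
    rw [mul_assoc]
    refine mul_le_mul_of_nonneg_left ?_ h3.le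
    have := mul_nonneg h2.le (S.qnorm.nonneg' (Q y))
    have := mul_nonneg h1.le (NX.nonneg' (T y))
    nlinarith

/-! ### The unit vector system and its dual basis -/

theorem map_eq_sum_unitVec (ι : (ℕ →₀ 𝕜) →ₗ[𝕜] Y) (f : ℕ →₀ 𝕜) :
    ι f = ∑ k ∈ f.support, f k • unitVec ι k := by
  conv_lhs => rw [← Finsupp.sum_single f]
  rw [Finsupp.sum, map_sum]
  refine Finset.sum_congr rfl fun k _ => ?_
  rw [unitVec, ← map_smul]
  simp

theorem map_ind (ι : (ℕ →₀ 𝕜) →ₗ[𝕜] Y) (A : Finset ℕ) :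
    ι (ind 𝕜 A) = ∑ k ∈ A, unitVec ι k := by
  simp [ind, unitVec]

theorem closedSpan_unitVec (hd : ∀ y, ∀ ε > 0, ∃ f, NY (y - ι f) < ε) :
    NY.closedSpan (Set.range (unitVec ι)) = ⊤ := by
  refine eq_top_iff.2 fun y _ ε hε => ?_
  obtain ⟨f, hf⟩ := hd y ε hε
  refine ⟨ι f, ?_, hf⟩
  rw [map_eq_sum_unitVec]
  exact Submodule.sum_mem _ fun k _ => Submodule.smul_mem _ _ (Submodule.subset_span ⟨k, rfl⟩)

theorem IsBasisWithDual.apply_map {es : ℕ → Y →ₗ[𝕜] 𝕜} (he : IsBasisWithDual NY (unitVec ι) es)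
    (k : ℕ) (f : ℕ →₀ 𝕜) : es k (ι f) = f k := by
  rw [map_eq_sum_unitVec, map_sum]
  simp only [map_smul, he.biorthogonal, smul_eq_mul, mul_ite, mul_one, mul_zero,
    Finset.sum_ite_eq']
  split_ifs with h
  · rfl
  · exact (Finsupp.notMem_support_iff.1 h).symm

theorem IsBasisWithDual.apply_blockSum {xs : ℕ → X →ₗ[𝕜] 𝕜} (hx : IsBasisWithDual NX x xs)
    (hb : IsFibres σ b) (NS : (ℕ →₀ 𝕜) → ℝ) (n : ℕ) (f : ℕ →₀ 𝕜) :
    xs n (blockSum NS σ x f) = fundamental NS (σ n).card * ave f (σ n) := by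
  rw [blockSum_eq_sum hb, map_sum]
  simp only [map_smul, hx.biorthogonal, smul_eq_mul, mul_ite, mul_one, mul_zero,
    Finset.sum_ite_eq']
  split_ifs with h
  · ring
  · rw [ave_eq_zero hb f h, mul_zero]

namespace Frame

variable (F : Frame S σ b NX x NY ι)

theorem mem_fibre (F : Frame S σ b NX x NY ι) (k : ℕ) : k ∈ σ (b k) := (F.fibres _ _).2 rfl

/-- The vectors `Q y` have mean zero on each block. -/
theorem ave_Q (F : Frame S σ b NX x NY ι) (y : Y) (n : ℕ) : ∑ k ∈ σ n, (F.Q y).1 k = 0 := by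
  have h : (∑ k ∈ σ n, S.coord k ∘ₗ F.Q) = 0 := by
    refine QuasiNorm.BoundedMap.ext_of_dense (N := NY) (M := QuasiNorm.scalar 𝕜)
      (QuasiNorm.BoundedMap.sum _ _ fun k _ => QuasiNorm.BoundedMap.comp (S.coord_isBounded k)
        F.Q_bounded) (QuasiNorm.BoundedMap.zero _ _) F.completion.dense fun f => ?_
    simp only [LinearMap.coe_sum, Finset.sum_apply, LinearMap.comp_apply, F.Q_ι]
    have h1 := ave_sub_avgProj F.partition F.fibres f n
    rw [ave, mul_eq_zero, inv_eq_zero] at h1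
    refine h1.resolve_left ?_
    exact_mod_cast (F.partition.fibre_card_pos n).ne'
  have h2 := LinearMap.congr_fun h y
  rw [LinearMap.sum_apply] at h2
  exact h2

/-- The coordinate functionals of the unit vector system, expressed through the two components. -/
def dualVec (xs : ℕ → X →ₗ[𝕜] 𝕜) (k : ℕ) : Y →ₗ[𝕜] 𝕜 :=
  S.coord k ∘ₗ F.Q + (fundamental S.norm00 (σ (b k)).card : 𝕜)⁻¹ • (xs (b k) ∘ₗ F.T)

variable {xs : ℕ → X →ₗ[𝕜] 𝕜}

theorem dualVec_apply (k : ℕ) (y : Y) : F.dualVec xs k y =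
    (F.Q y).1 k + (fundamental S.norm00 (σ (b k)).card : 𝕜)⁻¹ * xs (b k) (F.T y) := rfl

theorem dualVec_J (k : ℕ) (g : X) : F.dualVec xs k (F.J g) =
    (fundamental S.norm00 (σ (b k)).card : 𝕜)⁻¹ * xs (b k) g := by
  rw [dualVec_apply, F.Q_J, F.T_J]
  exact zero_add _

theorem dualVec_ι (hx : IsBasisWithDual NX x xs) (k : ℕ) (f : ℕ →₀ 𝕜) :
    F.dualVec xs k (ι f) = f k := by
  rw [dualVec_apply, F.T_ι, hx.apply_blockSum F.fibres, F.Q_ι,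
    inv_mul_cancel_left₀ (fundamental_card_ne_zero S F.partition _)]
  change (f - avgProj σ f) k + _ = _
  rw [Finsupp.sub_apply, avgProj_apply F.fibres]
  ring

theorem dualVec_isBounded (hx : IsBasisWithDual NX x xs) (k : ℕ) :
    NY.IsBounded (F.dualVec xs k) :=
  QuasiNorm.BoundedMap.add (M := QuasiNorm.scalar 𝕜)
    (QuasiNorm.BoundedMap.comp (S.coord_isBounded k) F.Q_bounded)
    ((QuasiNorm.BoundedMap.comp (P := QuasiNorm.scalar 𝕜) (hx.bounded _) F.T_bounded).smul _)

theorem isBasisWithDual (hx : IsBasisWithDual NX x xs) :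
    IsBasisWithDual NY (unitVec ι) (F.dualVec xs) where
  generates := closedSpan_unitVec F.completion.dense
  bounded := F.dualVec_isBounded hx
  biorthogonal n k := by
    rw [unitVec, F.dualVec_ι hx, Finsupp.single_apply]

/-- `x` is a basis if and only if so is the unit vector system. -/
theorem isBasis_iff (F : Frame S σ b NX x NY ι) (hx_gen : NX.closedSpan (Set.range x) = ⊤) :
    IsBasis NY (unitVec ι) ↔ IsBasis NX x := by
  refine ⟨?_, fun ⟨xs, hx⟩ => ⟨_, F.isBasisWithDual hx⟩⟩
  rintro ⟨es, he⟩
  choose k hk using F.partition.nonempty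
  refine ⟨fun n => (fundamental S.norm00 (σ n).card : 𝕜) • (es (k n) ∘ₗ F.J), hx_gen, fun n => ?_,
    fun n m => ?_⟩
  · exact (QuasiNorm.BoundedMap.comp (P := QuasiNorm.scalar 𝕜) (he.bounded _) F.J_bounded).smul _
  · rw [LinearMap.smul_apply, LinearMap.comp_apply, F.J_x, map_smul, he.apply_map, ind_apply]
    have h0 := fundamental_card_ne_zero S F.partition n
    by_cases h : m = n
    · subst h
      simp [hk m, h0]
    · have : k n ∉ σ m := fun h' => h (((F.fibres _ _).1 h').symm.trans ((F.fibres _ _).1 (hk n)))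
      simp [this, h]

/-- Vanishing coefficients give `x_n^*(T y) = 0`, since `Q y` has mean zero on `σ_n`. -/
theorem injective_dualVec (hx : Function.Injective fun (f : X) (n : ℕ) => xs n f) :
    Function.Injective fun (y : Y) (k : ℕ) => F.dualVec xs k y := by
  suffices h : ∀ y, (∀ k, F.dualVec xs k y = 0) → y = 0 by
    intro y z hyz
    refine sub_eq_zero.1 (h _ fun k => ?_)
    rw [map_sub, sub_eq_zero]
    exact congrFun hyz k
  intro y hy
  have hT0 : ∀ n, xs n (F.T y) = 0 := fun n => by
    have h1 : ∑ k ∈ σ n, F.dualVec xs k y = 0 := Finset.sum_eq_zero fun k _ => hy k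
    simp only [dualVec_apply, Finset.sum_add_distrib, F.ave_Q, zero_add] at h1
    have h2 : ∀ k ∈ σ n, (fundamental S.norm00 (σ (b k)).card : 𝕜)⁻¹ * xs (b k) (F.T y) =
        (fundamental S.norm00 (σ n).card : 𝕜)⁻¹ * xs n (F.T y) := fun k hk => by
      rw [(F.fibres _ _).1 hk]
    rw [Finset.sum_congr rfl h2, Finset.sum_const, nsmul_eq_mul] at h1
    have h3 : ((σ n).card : 𝕜) ≠ 0 := by exact_mod_cast (F.partition.fibre_card_pos n).ne'
    have h4 := fundamental_card_ne_zero S F.partition n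
    simpa [h3, h4] using h1
  have hT : F.T y = 0 := hx (by funext n; simp [hT0 n])
  have hQ : F.Q y = 0 := by
    refine Subtype.ext (funext fun k => ?_)
    have := hy k
    rw [dualVec_apply, hT0, mul_zero, add_zero] at this
    exact this
  obtain ⟨C, -, hC⟩ := F.le_add
  have := hC y
  rw [hQ, hT, S.qnorm.map_zero, NX.map_zero] at this
  exact NY.eq_zero' _ (le_antisymm (by linarith) (NY.nonneg' _))

theorem isTotalBasis_iff (F : Frame S σ b NX x NY ι) (hx : IsBasisWithDual NX x xs) :
    IsTotalBasis NY (unitVec ι) ↔ IsTotalBasis NX x := by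
  constructor
  · rintro ⟨es, he, hinj⟩
    rw [he.eq (F.isBasisWithDual hx)] at hinj
    refine ⟨xs, hx, fun f g hfg => ?_⟩
    have h : F.J f = F.J g := hinj (funext fun k => by
      simp only [dualVec_J]
      rw [show xs (b k) f = xs (b k) g from congrFun hfg (b k)])
    simpa [F.T_J] using congrArg F.T h
  · rintro ⟨ys, hy, hinj⟩
    rw [hy.eq hx] at hinj
    exact ⟨_, F.isBasisWithDual hx, F.injective_dualVec hinj⟩

theorem qnorm_Q_ι_le (F : Frame S σ b NX x NY ι) (f : ℕ →₀ 𝕜) :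
    S.norm00 (f - avgProj σ f) ≤ NY (ι f) := by
  rw [F.completion.isometric]
  exact le_add_of_nonneg_right (NX.nonneg' _)

theorem norm_blockSum_le (F : Frame S σ b NX x NY ι) (f : ℕ →₀ 𝕜) :
    NX (blockSum S.norm00 σ x f) ≤ NY (ι f) := by
  rw [F.completion.isometric]
  exact le_add_of_nonneg_left (S.qnorm.nonneg' _)

/-- On vectors whose averages on the blocks vanish, the quasi-norm is that of `S`. -/
theorem norm_of_ave_eq_zero (F : Frame S σ b NX x NY ι) {f : ℕ →₀ 𝕜}
    (hf : ∀ n, ave f (σ n) = 0) : NY (ι f) = S.norm00 f := by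
  rw [F.completion.isometric, dkkNorm, avgProj_of_ave_eq_zero hf, blockSum_of_ave_eq_zero hf,
    sub_zero, NX.map_zero, add_zero]

theorem norm_ind (F : Frame S σ b NX x NY ι) (n : ℕ) :
    NY (ι (ind 𝕜 (σ n))) = fundamental S.norm00 (σ n).card * NX (x n) := by
  have h := dkkNorm_blockVec F.partition F.fibres S NX x (Finsupp.single n 1)
  rw [blockVec_single, one_smul, Finsupp.sum_single_index (by simp), one_smul, NX.smul',
    RCLike.norm_ofReal, abs_of_pos (fundamental_card_pos S F.partition n)] at h
  rw [F.completion.isometric, h]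

/-- The blocks `1_{σ_n}` are isometrically equivalent to `(Λ_{|σ_n|} x_n)`. -/
theorem exists_affinity (F : Frame S σ b NX x NY ι) :
    ∃ t : ℕ → 𝕜, (∀ n, t n ≠ 0) ∧ ∀ a : ℕ →₀ 𝕜,
      NY (a.sum fun n c => c • ∑ k ∈ σ n, unitVec ι k) = NX (a.sum fun n c => c • t n • x n) := by
  refine ⟨fun n => fundamental S.norm00 (σ n).card, fundamental_card_ne_zero S F.partition,
    fun a => ?_⟩
  rw [← dkkNorm_blockVec F.partition F.fibres S NX x a, ← F.completion.isometric]
  congr 1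
  rw [blockVec, Finsupp.linearCombination_apply, Finsupp.sum, Finsupp.sum, map_sum]
  refine Finset.sum_congr rfl fun n _ => ?_
  rw [map_smul, map_ind]

end Frame

/-! ### The norms of the unit vectors and of the coordinate functionals -/

theorem avgProj_single (hb : IsFibres σ b) (k : ℕ) (c : 𝕜) :
    avgProj σ (Finsupp.single k c) = (((σ (b k)).card : 𝕜)⁻¹ * c) • ind 𝕜 (σ (b k)) := by
  have hk : k ∈ σ (b k) := (hb _ _).2 rfl
  ext j
  rw [avgProj_apply hb, Finsupp.smul_apply, ind_apply, ave]
  simp only [Finsupp.single_apply, Finset.sum_ite_eq, hb k, hb j]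
  by_cases h : b k = b j
  · simp [h]
  · simp [h, Ne.symm h]

theorem ave_single (hb : IsFibres σ b) (k : ℕ) (c : 𝕜) (n : ℕ) :
    ave (Finsupp.single k c) (σ n) = if b k = n then ((σ n).card : 𝕜)⁻¹ * c else 0 := by
  rw [ave]
  simp only [Finsupp.single_apply, Finset.sum_ite_eq, hb k]
  split_ifs <;> simp

theorem blockSum_single (hb : IsFibres σ b) (NS : (ℕ →₀ 𝕜) → ℝ) (x : ℕ → X) (k : ℕ) :
    blockSum NS σ x (Finsupp.single k 1) =
      ((fundamental NS (σ (b k)).card : 𝕜) * ((σ (b k)).card : 𝕜)⁻¹) • x (b k) := by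
  rw [blockSum_eq_finsum, finsum_eq_single _ (b k)]
  · rw [ave_single hb, if_pos rfl, smul_smul, mul_one, mul_comm]
  · intro n hn
    rw [ave_single hb, if_neg (Ne.symm hn), zero_smul]

namespace Frame

variable (F : Frame S σ b NX x NY ι) {xs : ℕ → X →ₗ[𝕜] 𝕜}

/-- `Q_σ e_k` has coordinate `1 - 1/|σ_n| ≥ 1/2` at `k`. -/
theorem half_le_residual_single (hb : IsFibres σ b) (hσ_card : ∀ n, 2 ≤ (σ n).card) (k : ℕ) :
    1 / 2 ≤ ‖((Finsupp.single k 1 - avgProj σ (Finsupp.single k 1) : ℕ →₀ 𝕜)) k‖ := by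
  have hk : k ∈ σ (b k) := (hb _ _).2 rfl
  have h2 : (2 : ℝ) ≤ (σ (b k)).card := by exact_mod_cast hσ_card (b k)
  have e : ((Finsupp.single k 1 - avgProj σ (Finsupp.single k 1) : ℕ →₀ 𝕜)) k =
      ((1 - ((σ (b k)).card : ℝ)⁻¹ : ℝ) : 𝕜) := by
    rw [Finsupp.sub_apply, avgProj_single hb, Finsupp.smul_apply, ind_apply, if_pos hk]
    simp
  have h3 : ((σ (b k)).card : ℝ)⁻¹ ≤ 2⁻¹ := inv_anti₀ (by norm_num) h2
  rw [e, RCLike.norm_ofReal, abs_of_nonneg (by linarith)]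
  linarith

theorem exists_norm_unitVec (F : Frame S σ b NX x NY ι) (hS : S.IsSymmetric)
    (hSconv : S.qnorm.IsLocallyConvex) (hσ_card : ∀ n, 2 ≤ (σ n).card) :
    ∃ c C : ℝ, 0 < c ∧ 0 < C ∧ ∀ n, ∀ k ∈ σ n,
      c * max 1 (NX (x n) * fundamental S.norm00 (σ n).card / (σ n).card) ≤ NY (unitVec ι k) ∧
      NY (unitVec ι k) ≤ C * max 1 (NX (x n) * fundamental S.norm00 (σ n).card / (σ n).card) := by
  obtain ⟨C, hC0, hC⟩ := hS.qnorm00.exists_sub_avgProj_le (S.qnorm00_isLocallyConvex hSconv)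
  obtain ⟨D, hD0, hD⟩ := hS.qnorm00.exists_coord_le
  have hL : 0 < fundamental S.norm00 1 := fundamental_pos S.qnorm00 le_rfl
  refine ⟨min 1 (1 / (2 * D)), C * fundamental S.norm00 1 + 1, by positivity, by positivity, ?_⟩
  rintro n k hk
  obtain rfl := (F.fibres _ _).1 hk
  have e : NY (unitVec ι k) = S.norm00 (Finsupp.single k 1 - avgProj σ (Finsupp.single k 1)) +
      NX (x (b k)) * fundamental S.norm00 (σ (b k)).card / (σ (b k)).card := by
    rw [unitVec, F.completion.isometric, dkkNorm, blockSum_single F.fibres, NX.smul', norm_mul,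
      norm_inv, RCLike.norm_ofReal, abs_of_pos (fundamental_card_pos S F.partition _),
      RCLike.norm_natCast]
    congr 1
    ring
  have hnn : 0 ≤ NX (x (b k)) * fundamental S.norm00 (σ (b k)).card / (σ (b k)).card :=
    div_nonneg (mul_nonneg (NX.nonneg' _) (fundamental_card_pos S F.partition _).le)
      (Nat.cast_nonneg _)
  have h1 : S.norm00 (Finsupp.single k 1 - avgProj σ (Finsupp.single k 1)) ≤
      C * fundamental S.norm00 1 := by
    refine (hC σ b F.fibres _).trans_eq ?_
    rw [hS.qnorm00.single_eq, norm_one, one_mul]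
    rfl
  have h2 : 1 / (2 * D) ≤ S.norm00 (Finsupp.single k 1 - avgProj σ (Finsupp.single k 1)) := by
    have := (half_le_residual_single (𝕜 := 𝕜) F.fibres hσ_card k).trans (hD _ k)
    change _ ≤ D * S.norm00 _ at this
    rw [div_le_iff₀ (by positivity)]
    linarith
  rw [e]
  constructor
  · rw [mul_max_of_nonneg _ _ (by positivity), mul_one]
    refine max_le (((min_le_right _ _).trans h2).trans (le_add_of_nonneg_right hnn)) ?_
    refine (mul_le_of_le_one_left hnn (min_le_left _ _)).trans (le_add_of_nonneg_left ?_)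
    exact S.qnorm.nonneg' _
  · rw [add_mul, one_mul]
    exact add_le_add (h1.trans (le_mul_of_one_le_right (by positivity) (le_max_left _ _)))
      (le_max_right _ _)

theorem exists_norm_dualVec (hS : S.IsSymmetric) (hSconv : S.qnorm.IsLocallyConvex)
    (hσ_card : ∀ n, 2 ≤ (σ n).card) (hx : IsBasisWithDual NX x xs) :
    ∃ c C : ℝ, 0 < c ∧ 0 < C ∧ ∀ n, ∀ k ∈ σ n,
      c * max 1 (NX.dualNorm (xs n) / fundamental S.norm00 (σ n).card)
        ≤ NY.dualNorm (F.dualVec xs k) ∧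
      NY.dualNorm (F.dualVec xs k)
        ≤ C * max 1 (NX.dualNorm (xs n) / fundamental S.norm00 (σ n).card) := by
  obtain ⟨C, hC0, hC⟩ := hS.qnorm00.exists_sub_avgProj_le (S.qnorm00_isLocallyConvex hSconv)
  obtain ⟨D, hD0, hD⟩ := hS.exists_coord_le
  obtain ⟨A, hA0, hA⟩ := F.Q_bounded.exists_pos
  obtain ⟨B, hB0, hB⟩ := F.T_bounded.exists_pos
  obtain ⟨K, hK0, hK⟩ := F.J_bounded.exists_pos
  have hL : 0 < fundamental S.norm00 1 := fundamental_pos S.qnorm00 le_rfl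
  refine ⟨min (1 / (2 * C * fundamental S.norm00 1)) (1 / K), D * A + B, by positivity,
    by positivity, ?_⟩
  rintro n k hk
  obtain rfl := (F.fibres _ _).1 hk
  have hbd := F.dualVec_isBounded hx k
  have hΛ := fundamental_card_pos S F.partition (b k)
  have hΛn : ‖(fundamental S.norm00 (σ (b k)).card : 𝕜)⁻¹‖ =
      (fundamental S.norm00 (σ (b k)).card)⁻¹ := by
    rw [norm_inv, RCLike.norm_ofReal, abs_of_pos hΛ]
  have hdn := NY.dualNorm_nonneg (F.dualVec xs k)
  have hxn := NX.dualNorm_nonneg (xs (b k))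
  constructor
  · rw [mul_max_of_nonneg _ _ (by positivity), mul_one]
    refine max_le ((min_le_left _ _).trans ?_) ?_
    · -- test against `Q_σ e_k`
      set f : ℕ →₀ 𝕜 := Finsupp.single k 1 - avgProj σ (Finsupp.single k 1) with hf
      have h1 := hbd.le_dualNorm (ι f)
      rw [F.dualVec_ι hx,
        F.norm_of_ave_eq_zero (ave_sub_avgProj F.partition F.fibres _)] at h1
      have h2 : S.norm00 f ≤ C * fundamental S.norm00 1 := by
        refine (hC σ b F.fibres _).trans_eq ?_
        rw [hS.qnorm00.single_eq, norm_one, one_mul]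
        rfl
      have h3 := half_le_residual_single (𝕜 := 𝕜) F.fibres hσ_card k
      have h4 := mul_le_mul_of_nonneg_left h2 hdn
      rw [div_le_iff₀ (by positivity)]
      linarith
    · -- test against the range of `J`
      have h1 : NX.dualNorm (xs (b k)) ≤
          fundamental S.norm00 (σ (b k)).card * (NY.dualNorm (F.dualVec xs k) * K) := by
        refine QuasiNorm.dualNorm_le (by positivity) fun g => ?_
        have h2 := hbd.le_dualNorm (F.J g)
        rw [F.dualVec_J, norm_mul, hΛn, inv_mul_le_iff₀ hΛ] at h2
        refine h2.trans ?_
        have := mul_le_mul_of_nonneg_left (hK g) hdn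
        nlinarith
      refine (mul_le_mul_of_nonneg_right (min_le_right _ _) (by positivity)).trans ?_
      rw [div_mul_div_comm, one_mul, div_le_iff₀ (by positivity)]
      linarith
  · refine QuasiNorm.dualNorm_le (by positivity) fun y => ?_
    rw [F.dualVec_apply]
    refine (norm_add_le _ _).trans ?_
    rw [norm_mul, hΛn]
    set M := max 1 (NX.dualNorm (xs (b k)) / fundamental S.norm00 (σ (b k)).card)
    have hy := NY.nonneg' y
    have hM1 : 1 ≤ M := le_max_left _ _
    have h1 : ‖(F.Q y).1 k‖ ≤ D * A * NY y * M := by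
      refine ((hD _ k).trans ?_).trans (le_mul_of_one_le_right (by positivity) hM1)
      rw [mul_assoc]
      exact mul_le_mul_of_nonneg_left (hA y) hD0.le
    have h2 : (fundamental S.norm00 (σ (b k)).card)⁻¹ * ‖xs (b k) (F.T y)‖ ≤ M * (B * NY y) := by
      have h3 := (hx.bounded (b k)).le_dualNorm (F.T y)
      have h4 : (fundamental S.norm00 (σ (b k)).card)⁻¹ * NX.dualNorm (xs (b k)) ≤ M := by
        rw [inv_mul_eq_div]; exact le_max_right _ _
      calc _ ≤ (fundamental S.norm00 (σ (b k)).card)⁻¹ *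
            (NX.dualNorm (xs (b k)) * NX (F.T y)) := by gcongr
        _ = ((fundamental S.norm00 (σ (b k)).card)⁻¹ * NX.dualNorm (xs (b k))) * NX (F.T y) := by
            ring
        _ ≤ _ := mul_le_mul h4 (hB y) (NX.nonneg' _) (by positivity)
    nlinarith

theorem semiNormalized_and_mBounded_iff (hS : S.IsSymmetric) (hSconv : S.qnorm.IsLocallyConvex)
    (hσ_card : ∀ n, 2 ≤ (σ n).card) (hx : IsBasisWithDual NX x xs) :
    IsSemiNormalized NY (unitVec ι) ∧ IsMBounded NY (unitVec ι) (F.dualVec xs) ↔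
      ∃ C : ℝ, ∀ n, NX (x n) ≤ C * ((σ n).card / fundamental S.norm00 (σ n).card) ∧
        NX.dualNorm (xs n) ≤ C * fundamental S.norm00 (σ n).card := by
  obtain ⟨c₁, C₁, hc₁, hC₁, h₁⟩ := F.exists_norm_unitVec hS hSconv hσ_card
  obtain ⟨c₂, C₂, hc₂, hC₂, h₂⟩ := F.exists_norm_dualVec hS hSconv hσ_card hx
  constructor
  · rintro ⟨⟨c, C, hc, hN⟩, D, hD⟩
    refine ⟨max (C / c₁) (D / c / c₂), fun n => ?_⟩
    obtain ⟨k, hk⟩ := F.partition.nonempty n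
    have hΛ := fundamental_card_pos S F.partition n
    have hσ : (0 : ℝ) < (σ n).card := by exact_mod_cast F.partition.fibre_card_pos n
    constructor
    · have h3 := ((mul_le_mul_of_nonneg_left (le_max_right _ _) hc₁.le).trans (h₁ n k hk).1).trans
        (hN k).2
      refine le_trans ?_ (mul_le_mul_of_nonneg_right (le_max_left _ _) (by positivity))
      rw [div_mul_div_comm, le_div_iff₀ (by positivity)]
      rw [mul_div_assoc', div_le_iff₀ hσ] at h3
      linarith
    · have h3 := (mul_le_mul_of_nonneg_left (le_max_right _ _) hc₂.le).trans (h₂ n k hk).1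
      have h4 : NY.dualNorm (F.dualVec xs k) ≤ D / c := by
        rw [le_div_iff₀ hc]
        refine le_trans ?_ (hD k)
        rw [mul_comm]
        exact mul_le_mul_of_nonneg_right (hN k).1 (NY.dualNorm_nonneg _)
      have h5 := h3.trans h4
      refine le_trans ?_ (mul_le_mul_of_nonneg_right (le_max_right _ _) hΛ.le)
      rw [mul_div_assoc', div_le_iff₀ hΛ] at h5
      rw [div_mul_eq_mul_div, le_div_iff₀ hc₂]
      linarith
  · rintro ⟨C, hC⟩
    have hx1 : ∀ n, max 1 (NX (x n) * fundamental S.norm00 (σ n).card / (σ n).card) ≤ max 1 C :=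
      fun n => by
        have hΛ := fundamental_card_pos S F.partition n
        have hσ : (0 : ℝ) < (σ n).card := by exact_mod_cast F.partition.fibre_card_pos n
        refine max_le_max le_rfl ?_
        rw [div_le_iff₀ hσ, ← le_div_iff₀ hΛ, mul_div_assoc]
        exact (hC n).1
    have hx2 : ∀ n, max 1 (NX.dualNorm (xs n) / fundamental S.norm00 (σ n).card) ≤ max 1 C :=
      fun n => max_le_max le_rfl
        ((div_le_iff₀ (fundamental_card_pos S F.partition n)).2 (hC n).2)
    have h3 : ∀ k, NY (unitVec ι k) ≤ C₁ * max 1 C := fun k =>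
      (h₁ _ k (F.mem_fibre k)).2.trans (mul_le_mul_of_nonneg_left (hx1 _) hC₁.le)
    have h4 : ∀ k, NY.dualNorm (F.dualVec xs k) ≤ C₂ * max 1 C := fun k =>
      (h₂ _ k (F.mem_fibre k)).2.trans (mul_le_mul_of_nonneg_left (hx2 _) hC₂.le)
    refine ⟨⟨c₁, C₁ * max 1 C, hc₁, fun k => ⟨?_, h3 k⟩⟩, C₁ * max 1 C * (C₂ * max 1 C),
      fun k => mul_le_mul (h3 k) (h4 k) (NY.dualNorm_nonneg _) (by positivity)⟩
    exact (le_mul_of_one_le_right hc₁.le (le_max_left _ _)).trans (h₁ _ k (F.mem_fibre k)).1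

end Frame

/-! ### Duality on `c₀₀` -/

/-- The functional `f ↦ ⟨f, g⟩ = ∑ f_n g_n` on `c₀₀`. -/
def pairing (g : ℕ →₀ 𝕜) : (ℕ →₀ 𝕜) →ₗ[𝕜] 𝕜 := Finsupp.linearCombination 𝕜 g

theorem pairing_apply (g f : ℕ →₀ 𝕜) : pairing g f = f.sum fun n c => c * g n := rfl

theorem pairing_comm (f g : ℕ →₀ 𝕜) : pairing g f = pairing f g := by
  classical
  rw [pairing_apply, pairing_apply,
    Finsupp.sum_of_support_subset f (s := f.support ∪ g.support) Finset.subset_union_left _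
      (by simp),
    Finsupp.sum_of_support_subset g (s := f.support ∪ g.support) Finset.subset_union_right _
      (by simp)]
  exact Finset.sum_congr rfl fun k _ => mul_comm _ _

theorem pairing_single (g : ℕ →₀ 𝕜) (k : ℕ) (c : 𝕜) : pairing g (Finsupp.single k c) = c * g k := by
  simp [pairing]

theorem pairing_ind (g : ℕ →₀ 𝕜) (A : Finset ℕ) : pairing g (ind 𝕜 A) = ∑ k ∈ A, g k := by
  simp [ind, pairing_single]

theorem pairing_sub (f g h : ℕ →₀ 𝕜) : pairing (f - g) h = pairing f h - pairing g h := by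
  rw [pairing_comm, map_sub, pairing_comm, pairing_comm h g]

/-- Averaging projections are self-adjoint. -/
theorem pairing_avgProj (hσ : IsOrderedPartition σ) (hb : IsFibres σ b) (f g : ℕ →₀ 𝕜) :
    pairing (avgProj σ g) f = pairing g (avgProj σ f) := by
  have h : pairing (avgProj σ g) =
      pairing g ∘ₗ (isLinearMap_finsum hσ fun n => ind 𝕜 (σ n)).mk' _ := by
    ext k
    rw [LinearMap.comp_apply, LinearMap.comp_apply, LinearMap.comp_apply, Finsupp.lsingle_apply,
      pairing_single, one_mul, avgProj_apply hb]
    change _ = pairing g (avgProj σ (Finsupp.single k 1))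
    rw [avgProj_single hb, map_smul, pairing_ind, ave, mul_one, smul_eq_mul]
  rw [h]
  rfl

theorem pairing_residual (hσ : IsOrderedPartition σ) (hb : IsFibres σ b) (f g : ℕ →₀ 𝕜) :
    pairing (g - avgProj σ g) f = pairing g (f - avgProj σ f) := by
  rw [pairing_sub, map_sub, pairing_avgProj hσ hb]

theorem pairing_isBounded {N : QuasiNorm 𝕜 (ℕ →₀ 𝕜)} (hN : N.IsSymmetric) (g : ℕ →₀ 𝕜) :
    N.IsBounded (pairing g) := by
  obtain ⟨C, hC0, hC⟩ := hN.exists_coord_le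
  refine ⟨∑ k ∈ g.support, ‖g k‖ * C, fun f => ?_⟩
  rw [pairing_comm, pairing_apply, Finsupp.sum, Finset.sum_mul]
  refine (norm_sum_le _ _).trans (Finset.sum_le_sum fun k _ => ?_)
  rw [norm_mul, mul_assoc]
  exact mul_le_mul_of_nonneg_left (hC f k) (norm_nonneg _)

theorem SequenceSpace.dualNorm00_eq (S : SequenceSpace 𝕜) (g : ℕ →₀ 𝕜) :
    S.dualNorm00 g = S.qnorm00.dualNorm (pairing g) := rfl

theorem SequenceSpace.dualNorm00_nonneg (S : SequenceSpace 𝕜) (g : ℕ →₀ 𝕜) :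
    0 ≤ S.dualNorm00 g := by
  rw [S.dualNorm00_eq]
  exact S.qnorm00.dualNorm_nonneg _

namespace SequenceSpace.IsSymmetric

theorem norm_pairing_le (hS : S.IsSymmetric) (g f : ℕ →₀ 𝕜) :
    ‖pairing g f‖ ≤ S.dualNorm00 g * S.norm00 f :=
  (pairing_isBounded hS.qnorm00 g).le_dualNorm f

theorem dualNorm00_smul (hS : S.IsSymmetric) (c : 𝕜) (g : ℕ →₀ 𝕜) :
    S.dualNorm00 (c • g) = ‖c‖ * S.dualNorm00 g := by
  have h : pairing (c • g) = c • pairing g := by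
    ext k
    simp [pairing_single]
  rw [S.dualNorm00_eq, S.dualNorm00_eq, h,
    QuasiNorm.dualNorm_smul (pairing_isBounded hS.qnorm00 g)]

theorem dualNorm00_ind (hS : S.IsSymmetric) (A : Finset ℕ) :
    S.dualNorm00 (ind 𝕜 A) = fundamental S.dualNorm00 A.card := by
  have key : ∀ A B : Finset ℕ, A.card = B.card →
      S.dualNorm00 (ind 𝕜 A) ≤ S.dualNorm00 (ind 𝕜 B) := by
    intro A B h
    obtain ⟨π, hπ⟩ := exists_perm_mem_iff h
    rw [S.dualNorm00_eq]
    refine QuasiNorm.dualNorm_le (S.dualNorm00_nonneg _) fun f => ?_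
    have h1 : pairing (ind 𝕜 A) f = pairing (ind 𝕜 B) (Finsupp.equivMapDomain π f) := by
      rw [pairing_comm, pairing_ind, pairing_comm, pairing_ind]
      refine Finset.sum_bij (fun k _ => π k) (fun k hk => (hπ k).2 hk)
        (fun _ _ _ _ h => π.injective h) (fun k hk => ⟨π.symm k, ?_, by simp⟩)
        (fun k _ => by simp [Finsupp.equivMapDomain_apply])
      rw [← hπ]
      simpa using hk
    have h2 : S.qnorm00 (Finsupp.equivMapDomain π f) = S.qnorm00 f :=
      hS.qnorm00.eq_of_perm π fun k => by simp [Finsupp.equivMapDomain_apply]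
    rw [h1, ← h2]
    exact hS.norm_pairing_le _ _
  exact le_antisymm (key _ _ (by simp)) (key _ _ (by simp))

theorem fundamental_dualNorm00_pos (hS : S.IsSymmetric) {m : ℕ} (hm : 1 ≤ m) :
    0 < fundamental S.dualNorm00 m := by
  have h := hS.norm_pairing_le (ind 𝕜 (Finset.range m)) (ind 𝕜 (Finset.range m))
  have h1 : pairing (ind 𝕜 (Finset.range m)) (ind 𝕜 (Finset.range m)) = m := by
    rw [pairing_ind, Finset.sum_congr rfl fun k hk => by rw [ind_apply, if_pos hk]]
    simp
  rw [h1, RCLike.norm_natCast] at h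
  have hm' : (0 : ℝ) < m := by exact_mod_cast hm
  exact pos_of_mul_pos_left (hm'.trans_le h) (fundamental_pos S.qnorm00 hm).le

/-- The normalization of the dual blocks compensates the one of `v_n^*`: in the dual construction
the average over `σ_n` is multiplied by `(|σ_n| / Λ_{|σ_n|}) x_n^*`. -/
theorem fundamental_smul_dualBlocks (hS : S.IsSymmetric) (hσ : IsOrderedPartition σ)
    (xs : ℕ → X →ₗ[𝕜] 𝕜) (n : ℕ) :
    (fundamental S.dualNorm00 (σ n).card : 𝕜) • dualBlocks S σ xs n =
      (((σ n).card : 𝕜) * (fundamental S.norm00 (σ n).card : 𝕜)⁻¹) • xs n := by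
  have h1 := fundamental_card_pos S hσ n
  have h2 : 0 < fundamental S.dualNorm00 (σ n).card :=
    hS.fundamental_dualNorm00_pos (hσ.fibre_card_pos n)
  have h3 : (0 : ℝ) < (σ n).card := by exact_mod_cast hσ.fibre_card_pos n
  have h1' : (fundamental S.norm00 (σ n).card : 𝕜) ≠ 0 := by exact_mod_cast h1.ne'
  have h2' : (fundamental S.dualNorm00 (σ n).card : 𝕜) ≠ 0 := by exact_mod_cast h2.ne'
  have h3' : ((σ n).card : 𝕜) ≠ 0 := by exact_mod_cast h3.ne'
  rw [dualBlocks, smul_smul, hS.dualNorm00_smul, hS.dualNorm00_ind, RCLike.norm_ofReal,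
    abs_of_pos (by positivity)]
  congr 1
  push_cast
  field_simp

end SequenceSpace.IsSymmetric

namespace Frame

variable (F : Frame S σ b NX x NY ι) {xs : ℕ → X →ₗ[𝕜] 𝕜}

/-- The finite linear combination of coordinate functionals with coefficients `a`. -/
def dualComb (xs : ℕ → X →ₗ[𝕜] 𝕜) (a : ℕ →₀ 𝕜) : Y →ₗ[𝕜] 𝕜 := a.sum fun k t => t • F.dualVec xs k

theorem dualComb_isBounded (hx : IsBasisWithDual NX x xs) (a : ℕ →₀ 𝕜) :
    NY.IsBounded (F.dualComb xs a) :=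
  QuasiNorm.BoundedMap.sum (M := QuasiNorm.scalar 𝕜) _ _ fun k _ =>
    (F.dualVec_isBounded hx k).smul _

theorem dualComb_ι (hx : IsBasisWithDual NX x xs) (a f : ℕ →₀ 𝕜) :
    F.dualComb xs a (ι f) = pairing a f := by
  rw [dualComb, pairing_comm, Finsupp.sum, LinearMap.sum_apply]
  simp only [LinearMap.smul_apply, F.dualVec_ι hx]
  rfl

/-- The component of `dualComb` in the dual of `X`. -/
theorem blockSum_dualBlocks_apply_blockSum (F : Frame S σ b NX x NY ι) (hS : S.IsSymmetric)
    (hx : IsBasisWithDual NX x xs) (a f : ℕ →₀ 𝕜) :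
    blockSum S.dualNorm00 σ (dualBlocks S σ xs) a (blockSum S.norm00 σ x f) =
      pairing (avgProj σ a) f := by
  rw [blockSum_eq_sum F.fibres, LinearMap.sum_apply, pairing_comm, avgProj,
    finsum_ave_smul_eq F.fibres, map_sum]
  refine Finset.sum_congr rfl fun n _ => ?_
  rw [hS.fundamental_smul_dualBlocks F.partition, LinearMap.smul_apply, LinearMap.smul_apply,
    hx.apply_blockSum F.fibres, map_smul, pairing_ind, ave, ave]
  have h1 := fundamental_card_ne_zero S F.partition n
  have h2 : ((σ n).card : 𝕜) ≠ 0 := by exact_mod_cast (F.partition.fibre_card_pos n).ne'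
  simp only [smul_eq_mul]
  field_simp

theorem blockSum_dualBlocks_isBounded (F : Frame S σ b NX x NY ι) (hx : IsBasisWithDual NX x xs)
    (a : ℕ →₀ 𝕜) : NX.IsBounded (blockSum S.dualNorm00 σ (dualBlocks S σ xs) a) := by
  rw [blockSum_eq_sum F.fibres]
  exact QuasiNorm.BoundedMap.sum (M := QuasiNorm.scalar 𝕜) _ _ fun n _ =>
    (((hx.bounded n).smul _).smul _).smul _

theorem dualComb_J (hS : S.IsSymmetric) (hx : IsBasisWithDual NX x xs) (a : ℕ →₀ 𝕜) (g : X) :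
    F.dualComb xs a (F.J g) = blockSum S.dualNorm00 σ (dualBlocks S σ xs) a g := by
  refine QuasiNorm.BoundedMap.eqOn_closedSpan (N := NX) (M := QuasiNorm.scalar 𝕜)
    (L := F.dualComb xs a ∘ₗ F.J) (s := Set.range x)
    (QuasiNorm.BoundedMap.comp (P := QuasiNorm.scalar 𝕜) (F.dualComb_isBounded hx a) F.J_bounded)
    (F.blockSum_dualBlocks_isBounded hx a) ?_ (hx.generates ▸ Submodule.mem_top)
  rintro _ ⟨n, rfl⟩
  have h0 := fundamental_card_ne_zero S F.partition n
  have e : x n = blockSum S.norm00 σ x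
      ((fundamental S.norm00 (σ n).card : 𝕜)⁻¹ • ind 𝕜 (σ n)) := by
    rw [← blockVec_single, blockSum_blockVec F.partition F.fibres,
      Finsupp.sum_single_index (by simp), smul_smul, inv_mul_cancel₀ h0, one_smul]
  conv_rhs => rw [e]
  rw [F.blockSum_dualBlocks_apply_blockSum hS hx, LinearMap.comp_apply, F.J_x, ← map_smul,
    F.dualComb_ι hx, pairing_avgProj F.partition F.fibres, ← blockVec_single,
    avgProj_blockVec F.partition F.fibres]

/-- The dual basis of the unit vector system is equivalent to the unit vector system of the
construction with `S^*` and the dual blocks. The lower estimate tests a functional against the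
range of `Q_σ` and against the range of `J`. -/
theorem exists_dualNorm_equiv (hS : S.IsSymmetric) (hSconv : S.qnorm.IsLocallyConvex)
    (hx : IsBasisWithDual NX x xs) :
    ∃ c C : ℝ, 0 < c ∧ ∀ a : ℕ →₀ 𝕜,
      c * dkkNorm S.dualNorm00 σ NX.dualNorm (dualBlocks S σ xs) a
        ≤ NY.dualNorm (a.sum fun k t => t • F.dualVec xs k) ∧
      NY.dualNorm (a.sum fun k t => t • F.dualVec xs k)
        ≤ C * dkkNorm S.dualNorm00 σ NX.dualNorm (dualBlocks S σ xs) a := by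
  obtain ⟨C, hC0, hC⟩ := hS.qnorm00.exists_sub_avgProj_le (S.qnorm00_isLocallyConvex hSconv)
  obtain ⟨K, hK0, hK⟩ := F.J_bounded.exists_pos
  refine ⟨1 / (C + K), (QuasiNorm.scalar 𝕜).modulus * NY.modulus, by positivity, fun a => ?_⟩
  change _ ≤ NY.dualNorm (F.dualComb xs a) ∧ NY.dualNorm (F.dualComb xs a) ≤ _
  have hbd := F.dualComb_isBounded hx a
  have hBbd := F.blockSum_dualBlocks_isBounded hx a
  have hdn := NY.dualNorm_nonneg (F.dualComb xs a)
  have hsn : 0 ≤ S.dualNorm00 (a - avgProj σ a) := S.dualNorm00_nonneg _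
  have hxn := NX.dualNorm_nonneg (blockSum S.dualNorm00 σ (dualBlocks S σ xs) a)
  constructor
  · rw [one_div, inv_mul_le_iff₀ (by positivity), dkkNorm, add_mul]
    refine add_le_add ?_ ?_
    · rw [S.dualNorm00_eq]
      refine QuasiNorm.dualNorm_le (by positivity) fun f => ?_
      rw [pairing_residual F.partition F.fibres, ← F.dualComb_ι hx]
      refine (hbd.le_dualNorm _).trans ?_
      rw [F.norm_of_ave_eq_zero (ave_sub_avgProj F.partition F.fibres f)]
      have := mul_le_mul_of_nonneg_left (hC σ b F.fibres f) hdn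
      refine this.trans_eq ?_
      change _ * (C * S.qnorm00 f) = C * _ * S.qnorm00 f
      ring
    · refine QuasiNorm.dualNorm_le (by positivity) fun g => ?_
      rw [← F.dualComb_J hS hx]
      refine (hbd.le_dualNorm _).trans ?_
      have := mul_le_mul_of_nonneg_left (hK g) hdn
      linarith
  · have h0 : 0 ≤ dkkNorm S.dualNorm00 σ NX.dualNorm (dualBlocks S σ xs) a := add_nonneg hsn hxn
    have h1 := (QuasiNorm.scalar 𝕜).modulus_pos
    have h2 := NY.modulus_pos
    refine QuasiNorm.dualNorm_le (by positivity) fun y => ?_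
    refine QuasiNorm.BoundedMap.le_of_dense (N := NY) (M := QuasiNorm.scalar 𝕜) hbd
      F.completion.dense h0 (fun f => ?_) y
    change ‖F.dualComb xs a (ι f)‖ ≤ _
    have e : pairing a f = pairing (a - avgProj σ a) (f - avgProj σ f) +
        blockSum S.dualNorm00 σ (dualBlocks S σ xs) a (blockSum S.norm00 σ x f) := by
      rw [F.blockSum_dualBlocks_apply_blockSum hS hx, pairing_residual F.partition F.fibres,
        avgProj_of_ave_eq_zero (ave_sub_avgProj F.partition F.fibres f), sub_zero, map_sub,
        pairing_avgProj F.partition F.fibres]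
      ring
    rw [F.dualComb_ι hx, e, dkkNorm, add_mul]
    refine (norm_add_le _ _).trans (add_le_add ?_ ?_)
    · exact (hS.norm_pairing_le _ _).trans (mul_le_mul_of_nonneg_left (F.qnorm_Q_ι_le f) hsn)
    · exact (hBbd.le_dualNorm _).trans (mul_le_mul_of_nonneg_left (F.norm_blockSum_le f) hxn)

/-! ### Unconditionality parameters -/

theorem J_x_eq_sum (n : ℕ) : F.J (x n) =
    ∑ k ∈ σ n, (fundamental S.norm00 (σ n).card : 𝕜)⁻¹ • unitVec ι k := by
  rw [F.J_x, map_ind, Finset.smul_sum]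

theorem sum_dualVec_J (g : X) (n : ℕ) :
    ∑ k ∈ σ n, F.dualVec xs k (F.J g) • unitVec ι k = xs n g • F.J (x n) := by
  rw [F.J_x_eq_sum, Finset.smul_sum]
  refine Finset.sum_congr rfl fun k hk => ?_
  rw [F.dualVec_J, (F.fibres _ _).1 hk, smul_smul, mul_comm]

theorem exists_ktilde_le (F : Frame S σ b NX x NY ι) (xs : ℕ → X →ₗ[𝕜] 𝕜) :
    ∃ c : ℝ, 0 < c ∧ ∀ n,
      ENNReal.ofReal c * ktilde NX x xs n
        ≤ ktilde NY (unitVec ι) (F.dualVec xs) (∑ k ∈ Finset.range n, (σ k).card) := by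
  classical
  obtain ⟨K, hK0, hK⟩ := F.J_bounded.exists_pos
  obtain ⟨D, hD0, hD⟩ := F.T_bounded.exists_pos
  refine ⟨(K * D)⁻¹, by positivity, fun n => ?_⟩
  rw [ktilde]
  simp only [ENNReal.mul_iSup]
  refine iSup_le fun g => iSup_le fun hg => iSup_le fun hgs => iSup_le fun A => ?_
  -- the competitor is a multiple of `J g`, with the union of the blocks indexed by `A`
  have h1 : NY (((K : 𝕜)⁻¹) • F.J g) ≤ 1 := by
    rw [NY.smul', norm_inv, RCLike.norm_ofReal, abs_of_pos hK0, inv_mul_le_iff₀ hK0]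
    exact (hK g).trans (mul_le_mul_of_nonneg_left hg hK0.le)
  have h2 : ((K : 𝕜)⁻¹) • F.J g ∈ NY.closedSpan
      (unitVec ι '' {j | j < ∑ k ∈ Finset.range n, (σ k).card}) := by
    refine Submodule.smul_mem _ _ (F.J_bounded.map_closedSpan ?_ hgs)
    rintro _ ⟨j, hj, rfl⟩
    rw [F.J_x_eq_sum]
    refine Submodule.sum_mem _ fun k hk => Submodule.smul_mem _ _ (NY.le_closure _ ?_)
    refine Submodule.subset_span ⟨k, ?_, rfl⟩
    exact (F.partition.fibre_lt_iff F.fibres _ _).1 (((F.fibres _ _).1 hk).trans_lt hj)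
  have h3 : coordProj (unitVec ι) (F.dualVec xs) (A.biUnion σ) (((K : 𝕜)⁻¹) • F.J g) =
      ((K : 𝕜)⁻¹) • F.J (coordProj x xs A g) := by
    rw [coordProj, Finset.sum_biUnion, coordProj, map_sum, Finset.smul_sum]
    · refine Finset.sum_congr rfl fun j _ => ?_
      rw [map_smul, ← F.sum_dualVec_J, Finset.smul_sum]
      simp [smul_smul]
    · intro i _ j _ hij
      refine Finset.disjoint_left.2 fun k hk hk' => hij ?_
      rw [← (F.fibres _ _).1 hk, ← (F.fibres _ _).1 hk']
  refine le_trans ?_ (le_iSup_of_le _ (le_iSup_of_le h1 (le_iSup_of_le h2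
    (le_iSup_of_le (A.biUnion σ) le_rfl))))
  rw [h3, ← ENNReal.ofReal_mul (by positivity)]
  refine ENNReal.ofReal_le_ofReal ?_
  rw [NY.smul', norm_inv, RCLike.norm_ofReal, abs_of_pos hK0, mul_inv, mul_assoc]
  refine mul_le_mul_of_nonneg_left ?_ (by positivity)
  rw [inv_mul_le_iff₀ hD0]
  have := hD (F.J (coordProj x xs A g))
  rwa [F.T_J] at this

/-! ### Schauder bases and Schauder decompositions -/

/-- The closed linear span of the unit vectors of a block. -/
abbrev blockSpace (NY : QuasiNorm 𝕜 Y) (ι : (ℕ →₀ 𝕜) →ₗ[𝕜] Y) (σ : ℕ → Finset ℕ) (n : ℕ) :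
    Submodule 𝕜 Y := NY.closedSpan (unitVec ι '' (σ n : Set ℕ))

/-- The projection onto the block space, through the coordinate functionals. -/
def blockProj (xs : ℕ → X →ₗ[𝕜] 𝕜) (n : ℕ) : Y →ₗ[𝕜] Y :=
  ∑ k ∈ σ n, (F.dualVec xs k).smulRight (unitVec ι k)

theorem blockProj_apply (n : ℕ) (y : Y) :
    F.blockProj xs n y = ∑ k ∈ σ n, F.dualVec xs k y • unitVec ι k := by
  simp [blockProj, LinearMap.sum_apply]

theorem blockProj_bounded (hx : IsBasisWithDual NX x xs) (n : ℕ) :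
    NY.BoundedMap NY (F.blockProj xs n) :=
  QuasiNorm.BoundedMap.sum _ _ fun k _ => QuasiNorm.BoundedMap.smulRight
    (F.dualVec_isBounded hx k) _ _

theorem blockProj_mem (n : ℕ) (y : Y) : F.blockProj xs n y ∈ blockSpace NY ι σ n := by
  rw [blockProj_apply]
  exact Submodule.sum_mem _ fun k hk => Submodule.smul_mem _ _
    (NY.subset_closedSpan ⟨k, hk, rfl⟩)

theorem blockProj_of_mem (hx : IsBasisWithDual NX x xs) {n m : ℕ} {y : Y}
    (hy : y ∈ blockSpace NY ι σ m) : F.blockProj xs n y = if m = n then y else 0 := by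
  have key : ∀ k ∈ σ m, F.blockProj xs n (unitVec ι k) = if m = n then unitVec ι k else 0 := by
    intro k hk
    rw [blockProj_apply]
    simp only [(F.isBasisWithDual hx).biorthogonal, ite_smul, one_smul, zero_smul,
      Finset.sum_ite_eq, F.fibres k n, (F.fibres _ _).1 hk]
  split_ifs with h
  · refine (F.blockProj_bounded hx n).eqOn_closedSpan (QuasiNorm.BoundedMap.id NY) ?_ hy
    rintro _ ⟨k, hk, rfl⟩
    rw [key k hk, if_pos h, LinearMap.id_apply]
  · refine (F.blockProj_bounded hx n).eqOn_closedSpan (QuasiNorm.BoundedMap.zero NY NY) ?_ hy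
    rintro _ ⟨k, hk, rfl⟩
    rw [key k hk, if_neg h, LinearMap.zero_apply]

/-- The terms of a block expansion are the block projections of its sum. -/
theorem eq_blockProj (hx : IsBasisWithDual NX x xs) {y : Y} {u : ℕ → Y}
    (hu : ∀ n, u n ∈ blockSpace NY ι σ n)
    (hy : NY.ConvergesTo (fun m => ∑ n ∈ Finset.range m, u n) y) (n : ℕ) :
    u n = F.blockProj xs n y := by
  have h1 := (F.blockProj_bounded hx n).convergesTo hy
  refine QuasiNorm.ConvergesTo.unique (QuasiNorm.convergesTo_of_eventually_eq ?_) h1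
  filter_upwards [eventually_gt_atTop n] with m hm
  rw [map_sum]
  simp only [F.blockProj_of_mem hx (hu _), Finset.sum_ite_eq', Finset.mem_range, hm, if_true]

theorem T_blockProj (hx : IsBasisWithDual NX x xs) (n : ℕ) (y : Y) :
    F.T (F.blockProj xs n y) = xs n (F.T y) • x n := by
  have h : F.T ∘ₗ F.blockProj xs n = (xs n ∘ₗ F.T).smulRight (x n) := by
    refine QuasiNorm.BoundedMap.ext_of_dense (F.T_bounded.comp (F.blockProj_bounded hx n))
      (QuasiNorm.BoundedMap.smulRight (QuasiNorm.BoundedMap.comp (P := QuasiNorm.scalar 𝕜)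
        (hx.bounded n) F.T_bounded) _ _) F.completion.dense fun f => ?_
    rw [LinearMap.comp_apply, LinearMap.smulRight_apply, LinearMap.comp_apply, F.T_ι,
      hx.apply_blockSum F.fibres, blockProj_apply]
    simp only [F.dualVec_ι hx, map_sum, map_smul, unitVec, F.T_ι, blockSum_single F.fibres]
    have h3 : ∀ k ∈ σ n, f k • ((fundamental S.norm00 (σ (b k)).card : 𝕜) *
        ((σ (b k)).card : 𝕜)⁻¹) • x (b k) = (f k * ((fundamental S.norm00 (σ n).card : 𝕜) *
        ((σ n).card : 𝕜)⁻¹)) • x n := fun k hk => by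
      rw [(F.fibres _ _).1 hk, smul_smul]
    rw [Finset.sum_congr rfl h3, ← Finset.sum_smul, ← Finset.sum_mul, ave]
    congr 1
    ring
  exact LinearMap.congr_fun h y

theorem Q_blockProj_val (hx : IsBasisWithDual NX x xs) (n : ℕ) (y : Y) (k : ℕ) :
    (F.Q (F.blockProj xs n y)).1 k = if b k = n then (F.Q y).1 k else 0 := by
  have h1 : F.dualVec xs k (F.blockProj xs n y) = if b k = n then F.dualVec xs k y else 0 := by
    rw [blockProj_apply, map_sum]
    simp only [map_smul, (F.isBasisWithDual hx).biorthogonal, smul_eq_mul, mul_ite, mul_one,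
      mul_zero, Finset.sum_ite_eq', F.fibres k n]
  rw [dualVec_apply, dualVec_apply, F.T_blockProj hx, map_smul, hx.biorthogonal] at h1
  by_cases h : b k = n
  · rw [if_pos h]
    simpa [h] using h1
  · rw [if_neg h]
    simpa [h, Ne.symm h] using h1

/-- The truncations of `Q y` to the first `m` blocks converge to `Q y`. -/
theorem sum_Q_blockProj_convergesTo (hS : S.IsSymmetric) (hx : IsBasisWithDual NX x xs) (y : Y) :
    S.qnorm.ConvergesTo (fun m => F.Q (∑ n ∈ Finset.range m, F.blockProj xs n y)) (F.Q y) := by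
  classical
  obtain ⟨C, hC0, hC⟩ := hS.qnorm00.exists_lattice
  have hval : ∀ m k, ∀ y, (F.Q (∑ n ∈ Finset.range m, F.blockProj xs n y)).1 k =
      if b k < m then (F.Q y).1 k else 0 := by
    intro m k y
    have h1 : S.coord k (F.Q (∑ n ∈ Finset.range m, F.blockProj xs n y)) =
        ∑ n ∈ Finset.range m, if b k = n then (F.Q y).1 k else 0 := by
      rw [map_sum, map_sum]
      exact Finset.sum_congr rfl fun n _ => F.Q_blockProj_val hx n y k
    rw [Finset.sum_ite_eq] at h1
    simp only [Finset.mem_range] at h1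
    exact h1
  have hbd : ∀ m, NY.BoundedMap S.qnorm (F.Q ∘ₗ ∑ n ∈ Finset.range m, F.blockProj xs n) :=
    fun m => F.Q_bounded.comp (QuasiNorm.BoundedMap.sum _ _ fun n _ => F.blockProj_bounded hx n)
  -- the truncations are uniformly bounded
  have hunif : ∃ D, 0 < D ∧ ∀ m y,
      S.qnorm (F.Q (∑ n ∈ Finset.range m, F.blockProj xs n y)) ≤ D * NY y := by
    refine ⟨S.qnorm.modulus * NY.modulus * C, ?_, fun m y => ?_⟩
    · have := S.qnorm.modulus_pos
      have := NY.modulus_pos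
      positivity
    have := (hbd m).le_of_dense F.completion.dense hC0.le (fun f => ?_) y
    · rwa [LinearMap.comp_apply, LinearMap.sum_apply] at this
    rw [LinearMap.comp_apply, LinearMap.sum_apply]
    have e : F.Q (∑ n ∈ Finset.range m, F.blockProj xs n (ι f)) =
        S.incl (Finsupp.filter (fun k => b k < m) (f - avgProj σ f)) := by
      refine SequenceSpace.ext_coord fun k => ?_
      rw [hval, F.Q_ι]
      change _ = Finsupp.filter (fun k => b k < m) (f - avgProj σ f) k
      rw [Finsupp.filter_apply]
      rfl
    rw [e, S.qnorm_incl]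
    refine (hC _ (f - avgProj σ f) fun k => ?_).trans
      (mul_le_mul_of_nonneg_left (F.qnorm_Q_ι_le f) hC0.le)
    rw [Finsupp.filter_apply]
    split_ifs <;> simp
  obtain ⟨D, hD0, hD⟩ := hunif
  obtain ⟨B, hB0, hB⟩ := F.Q_bounded.exists_pos
  refine Metric.tendsto_atTop.2 fun ε hε => ?_
  have hκ := S.qnorm.modulus_pos
  obtain ⟨f, hf⟩ := F.completion.dense y (ε / (S.qnorm.modulus * (D + B))) (by positivity)
  refine ⟨(f.support).sup b + 1, fun m hm => ?_⟩
  rw [Real.dist_0_eq_abs, abs_of_nonneg (S.qnorm.nonneg' _)]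
  have hfix : ∑ n ∈ Finset.range m, F.blockProj xs n (ι f) = ι f := by
    have h1 : ∀ k ∈ f.support, k ∈ (Finset.range m).biUnion σ := fun k hk => by
      rw [Finset.mem_biUnion]
      refine ⟨b k, Finset.mem_range.2 ?_, F.mem_fibre k⟩
      have := Finset.le_sup (f := b) hk
      omega
    simp only [blockProj_apply, F.dualVec_ι hx]
    rw [← Finset.sum_biUnion, map_eq_sum_unitVec]
    · refine (Finset.sum_subset h1 fun k _ hk => ?_).symm
      rw [Finsupp.notMem_support_iff.1 hk, zero_smul]
    · intro i _ j _ hij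
      refine Finset.disjoint_left.2 fun k hk hk' => hij ?_
      rw [← (F.fibres _ _).1 hk, ← (F.fibres _ _).1 hk']
  have e : F.Q (∑ n ∈ Finset.range m, F.blockProj xs n y) - F.Q y =
      F.Q (∑ n ∈ Finset.range m, F.blockProj xs n (y - ι f)) - F.Q (y - ι f) := by
    simp only [map_sub, Finset.sum_sub_distrib, hfix]
    abel
  rw [e]
  refine (S.qnorm.sub_le _ _).trans_lt ?_
  have h1 := add_le_add (hD m (y - ι f)) (hB (y - ι f))
  rw [← add_mul] at h1
  rw [lt_div_iff₀ (by positivity)] at hf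
  have h2 := mul_le_mul_of_nonneg_left h1 hκ.le
  linarith

/-- The block expansion of `y` converges in the first component by truncation, and in the second one
exactly when the expansion of `T y` does. -/
theorem isSchauderBasis_iff (F : Frame S σ b NX x NY ι) (hS : S.IsSymmetric)
    (hx : IsBasisWithDual NX x xs) :
    IsSchauderBasis NX x ↔ IsSchauderDecomposition NY (blockSpace NY ι σ) := by
  rw [isSchauderBasis_iff_convergesTo hx]
  constructor
  · intro h
    refine ⟨fun n => NY.closure_closure _, fun y => ⟨fun n => F.blockProj xs n y,
      ⟨fun n => F.blockProj_mem n y, ?_⟩, fun u hu => funext fun n => F.eq_blockProj hx hu.1 hu.2 n⟩,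
      fun n => ?_⟩
    · obtain ⟨C, hC0, hC⟩ := F.le_add
      have h1 := Tendsto.const_mul C (Tendsto.add (F.sum_Q_blockProj_convergesTo hS hx y)
        (h (F.T y)))
      rw [add_zero, mul_zero] at h1
      refine squeeze_zero (fun m => NY.nonneg' _) (fun m => ?_) h1
      refine (hC _).trans_eq ?_
      rw [map_sub, map_sub F.T, map_sum F.T]
      simp only [F.T_blockProj hx]
    · obtain ⟨C, hC⟩ := F.blockProj_bounded hx n
      refine ⟨C, fun y u hu hy => ?_⟩
      rw [F.eq_blockProj hx hu hy n]
      exact hC y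
  · intro h g
    obtain ⟨u, ⟨hu, hconv⟩, -⟩ := h.expansion (F.J g)
    have h1 := F.T_bounded.convergesTo hconv
    rw [F.T_J] at h1
    refine (Tendsto.congr fun m => ?_) h1
    simp only [map_sum]
    congr 2
    refine Finset.sum_congr rfl fun n _ => ?_
    rw [F.eq_blockProj hx hu hconv n, F.T_blockProj hx, F.T_J]

end Frame

/-! ### Unconditionality for constant coefficients -/

theorem IsUCC.exists_pos {E : Type*} [AddCommGroup E] [Module 𝕜 E] {N : QuasiNorm 𝕜 E}
    {e : ℕ → E} (h : IsUCC N e) : ∃ C : ℝ, 0 < C ∧ ∀ A B : Finset ℕ, A ⊆ B → ∀ ε : ℕ → 𝕜,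
      (∀ n, ‖ε n‖ = 1) → N (signedSum e ε A) ≤ C * N (signedSum e ε B) := by
  obtain ⟨C, hC⟩ := h
  exact ⟨max C 1, by positivity, fun A B hAB ε hε => (hC A B hAB ε hε).trans
    (mul_le_mul_of_nonneg_right (le_max_left _ _) (N.nonneg' _))⟩

theorem ave_ind_of_subset (hb : IsFibres σ b) {n : ℕ} {A : Finset ℕ} (hA : A ⊆ σ n) (m : ℕ) :
    ave (ind 𝕜 A) (σ m) = if m = n then ((σ n).card : 𝕜)⁻¹ * A.card else 0 := by
  rw [ave]
  split_ifs with h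
  · subst h
    congr 1
    simp only [ind_apply, Finset.sum_ite_mem, Finset.inter_eq_right.2 hA]
    simp
  · rw [Finset.sum_eq_zero, mul_zero]
    intro k hk
    rw [ind_apply, if_neg]
    intro hkA
    exact h (((hb _ _).1 hk).symm.trans ((hb _ _).1 (hA hkA)))

theorem signedSum_one (A : Finset ℕ) : signedSum (unitVec ι) (fun _ => (1 : 𝕜)) A = ι (ind 𝕜 A) := by
  simp [signedSum, map_ind]

namespace Frame

/-- Two disjoint subsets of a block with the same cardinality give a signed sum with vanishing
average, whose quasi-norm is computed in `S`. -/
theorem exists_norm_ind_le_of_isUCC (F : Frame S σ b NX x NY ι) (hS : S.IsSymmetric)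
    (h : IsUCC NY (unitVec ι)) :
    ∃ D : ℝ, 0 < D ∧ ∀ (n : ℕ) (A A' : Finset ℕ), A ⊆ σ n → A' ⊆ σ n → Disjoint A A' →
      A.card = A'.card → NY (ι (ind 𝕜 A)) ≤ D * fundamental S.norm00 (σ n).card := by
  classical
  obtain ⟨K, hK0, hK⟩ := h.exists_pos
  obtain ⟨C, hC0, hC⟩ := hS.qnorm00.exists_lattice
  refine ⟨K * C, by positivity, fun n A A' hA hA' hdisj hcard => ?_⟩
  set ε : ℕ → 𝕜 := fun k => if k ∈ A' then -1 else 1 with hε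
  have hnot : ∀ k ∈ A, k ∉ A' := fun k hk => Finset.disjoint_left.1 hdisj hk
  have e1 : signedSum (unitVec ι) ε A = ι (ind 𝕜 A) := by
    rw [signedSum, map_ind]
    refine Finset.sum_congr rfl fun k hk => ?_
    simp [hε, hnot k hk]
  have e2 : signedSum (unitVec ι) ε (A ∪ A') = ι (ind 𝕜 A - ind 𝕜 A') := by
    rw [signedSum, Finset.sum_union hdisj, map_sub, map_ind, map_ind, sub_eq_add_neg,
      ← Finset.sum_neg_distrib]
    refine congrArg₂ _ (Finset.sum_congr rfl fun k hk => ?_) (Finset.sum_congr rfl fun k hk => ?_)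
    · simp [hε, hnot k hk]
    · simp [hε, hk]
  have h1 := hK A (A ∪ A') Finset.subset_union_left ε fun k => by
    simp only [hε]; split_ifs <;> simp
  rw [e1, e2, F.norm_of_ave_eq_zero (f := ind 𝕜 A - ind 𝕜 A')] at h1
  · refine h1.trans ?_
    rw [mul_assoc]
    refine mul_le_mul_of_nonneg_left ?_ hK0.le
    have h2 := hC (ind 𝕜 A - ind 𝕜 A') (ind 𝕜 (σ n)) fun k => by
      rw [Finsupp.sub_apply, ind_apply, ind_apply, ind_apply]
      by_cases hk : k ∈ A
      · simp [hk, hnot k hk, hA hk]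
      · by_cases hk' : k ∈ A'
        · simp [hk, hk', hA' hk']
        · simp [hk, hk']
    rwa [hS.qnorm00.ind_eq] at h2
  · intro m
    rw [ave_sub, ave_ind_of_subset F.fibres hA, ave_ind_of_subset F.fibres hA', hcard, sub_self]

/-- For the lower estimate, a half of a block is compared with the whole block; for the upper one, the
block is split into two halves and at most one more element, each of which is compared with a signed
sum of mean zero. -/
theorem isSemiNormalized_of_isUCC (F : Frame S σ b NX x NY ι) (hS : S.IsSymmetric)
    (hSconv : S.qnorm.IsLocallyConvex) (hσ_card : ∀ n, 2 ≤ (σ n).card)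
    (h : IsUCC NY (unitVec ι)) : IsSemiNormalized NX x := by
  classical
  obtain ⟨D, hD0, hD⟩ := F.exists_norm_ind_le_of_isUCC hS h
  obtain ⟨K, hK0, hK⟩ := h.exists_pos
  obtain ⟨C, hC0, hC⟩ := hS.qnorm00.exists_mul_fundamental_le
  obtain ⟨B, hB0, hB⟩ :=
    hS.qnorm00.exists_fundamental_div_le (S.qnorm00_isLocallyConvex hSconv)
  have hκ := NY.modulus_pos
  refine ⟨1 / (6 * B * C * K), NY.modulus ^ 3 * (3 * D), by positivity, fun n => ?_⟩
  set s := (σ n).card with hs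
  have hs2 := hσ_card n
  have hΛ : 0 < fundamental S.norm00 s := fundamental_card_pos S F.partition n
  obtain ⟨A, hA, hAc⟩ := Finset.exists_subset_card_eq (s := σ n) (n := s / 2) (by omega)
  have hsd : (σ n \ A).card = s - s / 2 := by rw [Finset.card_sdiff_of_subset hA, hAc]
  obtain ⟨A', hA', hAc'⟩ := Finset.exists_subset_card_eq (s := σ n \ A) (n := s / 2) (by omega)
  have hA'σ : A' ⊆ σ n := hA'.trans Finset.sdiff_subset
  have hAA' : Disjoint A A' := Finset.disjoint_left.2 fun k hk hk' =>
    (Finset.mem_sdiff.1 (hA' hk')).2 hk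
  have hnorm := F.norm_ind n
  constructor
  · -- `1_A` for a subset `A` with half of the elements of the block
    have h1 := hK A (σ n) hA (fun _ => 1) (by simp)
    rw [signedSum_one, signedSum_one, hnorm] at h1
    have h2 := hC A (ind 𝕜 A - avgProj σ (ind 𝕜 A)) (1 / 2) (by norm_num) fun k hk => by
      have hs0 : (0 : ℝ) < s := by exact_mod_cast (by omega : 0 < s)
      have e : (ind 𝕜 A - avgProj σ (ind 𝕜 A)) k = ((1 - (s : ℝ)⁻¹ * A.card : ℝ) : 𝕜) := by
        rw [Finsupp.sub_apply, avgProj_apply F.fibres, ave_ind_of_subset F.fibres hA, ind_apply,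
          if_pos hk, if_pos ((F.fibres _ _).1 (hA hk))]
        simp [hs]
      have h3 : (s : ℝ)⁻¹ * A.card ≤ 1 / 2 := by
        rw [inv_mul_le_iff₀ hs0, hAc]
        have : ((s / 2 : ℕ) : ℝ) ≤ s / 2 := Nat.cast_div_le
        linarith
      rw [e, RCLike.norm_ofReal, abs_of_nonneg (by linarith)]
      linarith
    have h3 : S.qnorm00 (ind 𝕜 A - avgProj σ (ind 𝕜 A)) ≤ NY (ι (ind 𝕜 A)) := F.qnorm_Q_ι_le _
    have h4 := hB (s / 2) s (by omega)
    rw [hAc] at h2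
    have h5 : (s : ℝ) ≤ 3 * (s / 2 : ℕ) := by exact_mod_cast (by omega : s ≤ 3 * (s / 2))
    have h6 : (0 : ℝ) < (s / 2 : ℕ) := by exact_mod_cast (by omega : 0 < s / 2)
    have hL2 : 0 ≤ fundamental S.qnorm00 (s / 2) := S.qnorm00.nonneg' _
    have h7 : fundamental S.norm00 s ≤ 3 * B * fundamental S.qnorm00 (s / 2) := by
      refine le_of_mul_le_mul_left ?_ h6
      refine h4.trans ?_
      have := mul_le_mul_of_nonneg_right h5 hL2
      have := mul_le_mul_of_nonneg_left this hB0.le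
      linarith
    have h8 : fundamental S.qnorm00 (s / 2) ≤
        2 * (C * (K * (fundamental S.norm00 s * NX (x n)))) := by
      have := mul_le_mul_of_nonneg_left (h3.trans h1) hC0.le
      linarith
    rw [div_le_iff₀ (by positivity)]
    refine le_of_mul_le_mul_left ?_ hΛ
    have := mul_le_mul_of_nonneg_left h8 (by positivity : 0 ≤ 3 * B)
    linarith
  · -- the block is the union of two halves and at most one more element
    set R := (σ n \ A) \ A' with hR
    have hRσ : R ⊆ σ n := Finset.sdiff_subset.trans Finset.sdiff_subset
    have hRc : R.card = s - s / 2 - s / 2 := by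
      rw [hR, Finset.card_sdiff_of_subset hA', hsd, hAc']
    obtain ⟨A₁, hA₁, hA₁c⟩ := Finset.exists_subset_card_eq (s := A) (n := R.card) (by omega)
    have hRA₁ : Disjoint R A₁ := Finset.disjoint_left.2 fun k hk hk' =>
      (Finset.mem_sdiff.1 (Finset.mem_sdiff.1 hk).1).2 (hA₁ hk')
    have h1 := hD n A A' hA hA'σ hAA' (by omega)
    have h2 := hD n A' A hA'σ hA hAA'.symm (by omega)
    have h3 := hD n R A₁ hRσ (hA₁.trans hA) hRA₁ hA₁c.symm
    have e : ind 𝕜 (σ n) = ind 𝕜 A + (ind 𝕜 A' + ind 𝕜 R) := by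
      rw [ind, ind, ind, ind, ← Finset.sum_sdiff hA, ← Finset.sum_sdiff hA']
      abel
    have h4 : NY (ι (ind 𝕜 (σ n))) ≤ NY.modulus ^ 3 *
        (NY (ι (ind 𝕜 A)) + NY (ι (ind 𝕜 A')) + NY (ι (ind 𝕜 R))) := by
      have := NY.sum_le Finset.univ ![ι (ind 𝕜 A), ι (ind 𝕜 A'), ι (ind 𝕜 R)]
      simp only [Fin.sum_univ_three, Finset.card_univ, Fintype.card_fin, Matrix.cons_val_zero,
        Matrix.cons_val_one, Matrix.cons_val] at this
      rwa [e, map_add, map_add, ← add_assoc]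
    rw [hnorm] at h4
    refine le_of_mul_le_mul_left (h4.trans ?_) hΛ
    have h5 : NY (ι (ind 𝕜 A)) + NY (ι (ind 𝕜 A')) + NY (ι (ind 𝕜 R)) ≤
        3 * D * fundamental S.norm00 s := by linarith
    have := mul_le_mul_of_nonneg_left h5 (by positivity : 0 ≤ NY.modulus ^ 3)
    linarith

end Frame

/-! ### Summation by parts and rearrangements -/

theorem sum_smul_eq_by_parts {K E : Type*} [CommRing K] [AddCommGroup E] [Module K E] (c : ℕ → K)
    (v : ℕ → E) (n : ℕ) :
    ∑ j ∈ Finset.range (n + 1), c j • v j = c n • (∑ i ∈ Finset.range (n + 1), v i) +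
      ∑ j ∈ Finset.range n, (c j - c (j + 1)) • ∑ i ∈ Finset.range (j + 1), v i := by
  induction n with
  | zero => simp
  | succ n ih =>
    rw [Finset.sum_range_succ, ih, Finset.sum_range_succ v (n + 1),
      Finset.sum_range_succ (fun j => (c j - c (j + 1)) • ∑ i ∈ Finset.range (j + 1), v i) n]
    module

/-- If the partial sums of `v` are dominated by those of `u`, then so are the sums with
non-negative non-increasing coefficients. -/
theorem seminorm_sum_smul_le {E : Type*} [AddCommGroup E] [Module 𝕜 E] (R : Seminorm 𝕜 E)
    (v : ℕ → E) (c u : ℕ → ℝ) (n : ℕ) (hc0 : ∀ j < n, 0 ≤ c j)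
    (hc : ∀ i j, i ≤ j → j < n → c j ≤ c i)
    (hv : ∀ j < n, R (∑ i ∈ Finset.range (j + 1), v i) ≤ ∑ i ∈ Finset.range (j + 1), u i) :
    R (∑ j ∈ Finset.range n, (c j : 𝕜) • v j) ≤ ∑ j ∈ Finset.range n, c j * u j := by
  rcases n with _ | n
  · simp
  have e := sum_smul_eq_by_parts c u n
  simp only [smul_eq_mul] at e
  rw [sum_smul_eq_by_parts, e]
  refine (map_add_le_add R _ _).trans (add_le_add ?_ ?_)
  · rw [map_smul_eq_mul, RCLike.norm_ofReal, abs_of_nonneg (hc0 n (by omega))]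
    exact mul_le_mul_of_nonneg_left (hv n (by omega)) (hc0 n (by omega))
  · refine (Finset.le_sum_of_subadditive R (map_zero R).le (map_add_le_add R) _ _).trans
      (Finset.sum_le_sum fun j hj => ?_)
    rw [Finset.mem_range] at hj
    have h1 : 0 ≤ c j - c (j + 1) := sub_nonneg.2 (hc j (j + 1) (by omega) (by omega))
    rw [map_smul_eq_mul, ← RCLike.ofReal_sub, RCLike.norm_ofReal, abs_of_nonneg h1]
    exact mul_le_mul_of_nonneg_left (hv j (by omega)) h1

/-- An enumeration of a finite set along which `g` is non-increasing. -/
theorem exists_antitone_enumeration (A : Finset ℕ) (g : ℕ → ℝ) :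
    ∃ p : ℕ → ℕ, Set.InjOn p (Finset.range A.card) ∧ (Finset.range A.card).image p = A ∧
      ∀ i j, i ≤ j → j < A.card → g (p j) ≤ g (p i) := by
  induction hn : A.card generalizing A with
  | zero => exact ⟨id, by simp, by simp [Finset.card_eq_zero.1 hn], by simp⟩
  | succ n ih =>
    have hne : A.Nonempty := Finset.card_pos.1 (by omega)
    obtain ⟨a, ha, hmin⟩ := A.exists_min_image g hne
    have hcard : (A.erase a).card = n := by rw [Finset.card_erase_of_mem ha]; omega
    obtain ⟨p, hp1, hp2, hp3⟩ := ih _ hcard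
    have hpA : ∀ i < n, p i ∈ A.erase a := fun i hi => by
      rw [← hp2]; exact Finset.mem_image_of_mem _ (Finset.mem_range.2 hi)
    refine ⟨fun i => if i = n then a else p i, ?_, ?_, ?_⟩
    · intro i hi j hj hij
      simp only [Finset.coe_range, Set.mem_Iio] at hi hj
      by_cases h1 : i = n <;> by_cases h2 : j = n
      · rw [h1, h2]
      · simp only [h1, h2, if_true, if_false] at hij
        have := hpA j (by omega)
        rw [← hij] at this
        simp at this
      · simp only [h1, h2, if_true, if_false] at hij
        have := hpA i (by omega)
        rw [hij] at this
        simp at this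
      · simp only [h1, h2, if_false] at hij
        refine hp1 ?_ ?_ hij <;> simp <;> omega
    · ext k
      simp only [Finset.mem_image, Finset.mem_range]
      constructor
      · rintro ⟨i, hi, rfl⟩
        split_ifs with h
        · exact ha
        · exact Finset.mem_of_mem_erase (hpA i (by omega))
      · intro hk
        by_cases h : k = a
        · exact ⟨n, by omega, by simp [h]⟩
        · have : k ∈ A.erase a := Finset.mem_erase.2 ⟨h, hk⟩
          rw [← hp2, Finset.mem_image] at this
          obtain ⟨i, hi, rfl⟩ := this
          rw [Finset.mem_range] at hi
          exact ⟨i, by omega, by simp [hi.ne]⟩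
    · intro i j hij hj
      by_cases h2 : j = n
      · by_cases h1 : i = n
        · simp [h1, h2]
        · simp only [h1, h2, if_true, if_false]
          exact hmin _ (Finset.mem_of_mem_erase (hpA i (by omega)))
      · have h1 : i ≠ n := by omega
        simp only [h1, h2, if_false]
        exact hp3 i j hij (by omega)

theorem rearrangement_nonneg (f : ℕ → 𝕜) (n : ℕ) : 0 ≤ rearrangement f n :=
  Real.sInf_nonneg fun _ ht => ht.1

theorem exists_norm_le_of_tendsto_zero {f : ℕ → 𝕜} (hf : Tendsto f atTop (𝓝 0)) :
    ∃ B : ℝ, 0 ≤ B ∧ ∀ k, ‖f k‖ ≤ B := by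
  obtain ⟨B, hB⟩ := hf.norm.bddAbove_range
  exact ⟨B, (norm_nonneg _).trans (hB ⟨0, rfl⟩), fun k => hB ⟨k, rfl⟩⟩

/-- Along an injective enumeration with non-increasing moduli, the moduli are at most those of the
non-increasing rearrangement. -/
theorem norm_le_rearrangement {f : ℕ → 𝕜} (hf : Tendsto f atTop (𝓝 0)) {p : ℕ → ℕ} {n j : ℕ}
    (hp : Set.InjOn p (Finset.range n)) (hanti : ∀ i j, i ≤ j → j < n → ‖f (p j)‖ ≤ ‖f (p i)‖)
    (hj : j < n) : ‖f (p j)‖ ≤ rearrangement f j := by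
  obtain ⟨B, hB0, hB⟩ := exists_norm_le_of_tendsto_zero hf
  refine le_csInf ⟨B, hB0, ?_⟩ ?_
  · have : {k | B < ‖f k‖} = ∅ := Set.eq_empty_of_forall_notMem fun k hk => (hB k).not_gt hk
    rw [this]
    simp
  · rintro t ⟨-, ht⟩
    by_contra! h
    have hsub : (((Finset.range (j + 1)).image p : Finset ℕ) : Set ℕ) ⊆ {k | t < ‖f k‖} := by
      intro k hk
      simp only [Finset.coe_image, Set.mem_image, Finset.coe_range, Set.mem_Iio] at hk
      obtain ⟨i, hi, rfl⟩ := hk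
      exact h.trans_le (hanti i j (by omega) hj)
    have h1 := (Set.encard_le_encard hsub).trans ht
    rw [Set.encard_coe_eq_coe_finsetCard, Finset.card_image_of_injOn, Finset.card_range] at h1
    · have : j + 1 ≤ j := by exact_mod_cast h1
      omega
    · exact hp.mono (by
        intro i hi
        simp only [Finset.coe_range, Set.mem_Iio] at hi ⊢
        omega)

/-- An upper bound for the rearrangement, from an estimate on finite sets on which `|f|` is
large. -/
theorem rearrangement_mul_le {f : ℕ → 𝕜} {L K : ℝ} (hL : 0 < L) (hK : 0 ≤ K) {n : ℕ}
    (h : ∀ (A : Finset ℕ) (t : ℝ), 0 ≤ t → A.card = n + 1 → (∀ k ∈ A, t ≤ ‖f k‖) → t * L ≤ K) :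
    rearrangement f n * L ≤ K := by
  rw [← le_div_iff₀ hL]
  by_contra! hlt
  obtain ⟨t, ht1, ht2⟩ := exists_between hlt
  have ht0 : 0 ≤ t := (div_nonneg hK hL.le).trans ht1.le
  have hcard : ¬ {k | t < ‖f k‖}.encard ≤ n := fun hn =>
    ht2.not_ge (csInf_le ⟨0, fun _ hs => hs.1⟩ ⟨ht0, hn⟩)
  have h1 : ((n + 1 : ℕ) : ℕ∞) ≤ {k | t < ‖f k‖}.encard := by
    push_cast
    exact Order.add_one_le_of_lt (not_le.1 hcard)
  obtain ⟨s, hs, hsc⟩ := Set.exists_subset_encard_eq h1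
  have hfin : s.Finite := Set.finite_of_encard_eq_coe hsc
  have h2 := h hfin.toFinset t ht0
    (by rw [hfin.encard_eq_coe_toFinset_card] at hsc; exact_mod_cast hsc)
    fun k hk => (hs (hfin.mem_toFinset.1 hk)).le
  rw [div_lt_iff₀ hL] at ht1
  linarith

theorem norm_sgn (z : 𝕜) : ‖sgn z‖ = 1 := by
  rw [sgn]
  split_ifs with h
  · simp
  · rw [norm_div, RCLike.norm_ofReal, abs_of_nonneg (norm_nonneg _),
      div_self (norm_ne_zero_iff.2 h)]

theorem norm_mul_sgn (z : 𝕜) : (‖z‖ : 𝕜) * sgn z = z := by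
  rw [sgn]
  split_ifs with h
  · simp [h]
  · have : (‖z‖ : 𝕜) ≠ 0 := by exact_mod_cast norm_ne_zero_iff.2 h
    field_simp

theorem IsQuasiconcave.le_mul {Φ : ℕ → ℝ} (h : IsQuasiconcave Φ) {c : ℝ} (hc : 1 ≤ c) {m s : ℕ}
    (hs : 0 < s) (hms : (m : ℝ) ≤ c * s) : Φ m ≤ c * Φ s := by
  have hs' : (0 : ℝ) < s := by exact_mod_cast hs
  rcases le_total m s with h1 | h1
  · exact (h.mono h1).trans (le_mul_of_one_le_left (h.nonneg s) hc)
  · have h2 := h.div s m h1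
    have h3 := mul_le_mul_of_nonneg_right hms (h.nonneg s)
    refine le_of_mul_le_mul_left ?_ hs'
    linarith

theorem IsQuasiconcave.div_le_weight {Φ : ℕ → ℝ} (h : IsQuasiconcave Φ) {c : ℝ} (hc : 1 ≤ c)
    {k s : ℕ} (hs : 0 < s) (hks : ((k + 1 : ℕ) : ℝ) ≤ c * s) :
    Φ s / s ≤ c * weight Φ k := by
  have hs' : (0 : ℝ) < s := by exact_mod_cast hs
  have hk' : (0 : ℝ) < k + 1 := by positivity
  rw [weight, mul_div_assoc', div_le_div_iff₀ hs' hk']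
  push_cast at hks
  rcases le_total (k + 1) s with h1 | h1
  · have h2 := h.div (k + 1) s h1
    push_cast at h2
    have h3 : (s : ℝ) * Φ (k + 1) ≤ c * (s * Φ (k + 1)) :=
      le_mul_of_one_le_left (mul_nonneg hs'.le (h.nonneg _)) hc
    linarith
  · have h2 := mul_le_mul (h.mono h1) hks hk'.le (h.nonneg _)
    linarith

namespace Frame

/-! ### Upper Lorentz estimates -/

theorem unitVec_sum_eq_map (ι : (ℕ →₀ 𝕜) →ₗ[𝕜] Y) (A : Finset ℕ) (ε : ℕ → 𝕜) :
    ∑ k ∈ A, ε k • unitVec ι k = ι (∑ k ∈ A, Finsupp.single k (ε k)) := by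
  rw [map_sum]
  refine Finset.sum_congr rfl fun k _ => ?_
  rw [unitVec, ← map_smul]
  simp

/-- A norm equivalent to the quasi-norm of the completion, and its values on vectors with
coefficients of modulus one. -/
theorem exists_seminorm (F : Frame S σ b NX x NY ι) (hS : S.IsSymmetric)
    (hSconv : S.qnorm.IsLocallyConvex) (hXconv : NX.IsLocallyConvex) (hxn : IsSemiNormalized NX x)
    {c : ℝ} (hM : ∀ n, ∑ k ∈ Finset.range (n + 1), ((σ k).card : ℝ) ≤ c * (σ n).card)
    {Φ : ℕ → ℝ} (hΦ : IsQuasiconcave Φ) (hΦS : ∀ m, fundamental S.norm00 m ≤ Φ m) :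
    ∃ (R : Seminorm 𝕜 Y) (C D : ℝ), 0 < C ∧ 0 < D ∧ (∀ y, NY y ≤ C * R y) ∧
      ∀ (A : Finset ℕ) (ε : ℕ → 𝕜), (∀ k, ‖ε k‖ = 1) →
        R (∑ k ∈ A, ε k • unitVec ι k) ≤
          D * ∑ j ∈ Finset.range A.card, IsQuasiconcave.weight Φ j := by
  classical
  obtain ⟨qS, C₁, hqS⟩ := hSconv
  obtain ⟨qX, C₂, hqX⟩ := hXconv
  obtain ⟨C₃, hC₃, hC₃'⟩ := F.le_add
  obtain ⟨C₄, hC₄, hC₄'⟩ := hS.qnorm00.exists_sub_avgProj_le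
    (S.qnorm00_isLocallyConvex ⟨qS, C₁, hqS⟩)
  obtain ⟨_, B, -, hB⟩ := hxn
  set c' := max c 1
  set D := max C₁ 1 * C₄ + c' * (max C₂ 1 * max B 1)
  have hD : 0 < D := by positivity
  refine ⟨qS.comp F.Q + qX.comp F.T, C₃ * (max C₁ 1 + max C₂ 1), D, by positivity, hD,
    fun y => ?_, fun A ε hε => ?_⟩
  · refine (hC₃' y).trans ?_
    rw [mul_assoc]
    refine mul_le_mul_of_nonneg_left ?_ hC₃.le
    change _ ≤ _ * (qS (F.Q y) + qX (F.T y))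
    have h1 := apply_nonneg qS (F.Q y)
    have h2 := apply_nonneg qX (F.T y)
    have h3 := (hqS (F.Q y)).1.trans (mul_le_mul_of_nonneg_right (le_max_left C₁ 1) h1)
    have h4 := (hqX (F.T y)).1.trans (mul_le_mul_of_nonneg_right (le_max_left C₂ 1) h2)
    have h5 : 0 ≤ max C₁ 1 * qX (F.T y) := by positivity
    have h6 : 0 ≤ max C₂ 1 * qS (F.Q y) := by positivity
    nlinarith
  · set f : ℕ →₀ 𝕜 := ∑ k ∈ A, Finsupp.single k (ε k) with hf
    set U := ∑ j ∈ Finset.range A.card, IsQuasiconcave.weight Φ j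
    have hfk : ∀ k, f k = if k ∈ A then ε k else 0 := fun k => by
      simp [hf, Finsupp.finsetSum_apply, Finsupp.single_apply]
    have h1 : qS (F.Q (ι f)) ≤ max C₁ 1 * C₄ * U := by
      rw [F.Q_ι]
      refine ((hqS _).2.trans (mul_le_mul_of_nonneg_right (le_max_left C₁ 1)
        (S.qnorm.nonneg' _))).trans ?_
      rw [mul_assoc]
      refine mul_le_mul_of_nonneg_left ((hC₄' σ b F.fibres f).trans
        (mul_le_mul_of_nonneg_left ?_ hC₄.le)) (by positivity)
      have e : S.qnorm00 f = fundamental S.qnorm00 A.card := by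
        rw [← hS.qnorm00.ind_eq]
        refine hS.qnorm00.congr_norm fun k => ?_
        rw [hfk, ind_apply]
        split_ifs <;> simp [hε]
      rw [e]
      exact (hΦS _).trans (hΦ.le_sum_weight _)
    have h2 : qX (F.T (ι f)) ≤ c' * (max C₂ 1 * max B 1) * U := by
      have h3 : ∀ k, qX (F.T (ε k • unitVec ι k)) ≤
          c' * (max C₂ 1 * max B 1) * IsQuasiconcave.weight Φ k := fun k => by
        have hs := F.partition.fibre_card_pos (b k)
        have hs' : (0 : ℝ) < (σ (b k)).card := by exact_mod_cast hs
        have hΛ := fundamental_card_pos S F.partition (b k)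
        rw [map_smul, map_smul_eq_mul, hε, one_mul, unitVec, F.T_ι, blockSum_single F.fibres,
          map_smul_eq_mul, norm_mul, norm_inv, RCLike.norm_ofReal, RCLike.norm_natCast,
          abs_of_pos hΛ, ← div_eq_mul_inv]
        have h4 : fundamental S.norm00 (σ (b k)).card / (σ (b k)).card ≤
            c' * IsQuasiconcave.weight Φ k := by
          refine (div_le_div_of_nonneg_right (hΦS _) hs'.le).trans
            (hΦ.div_le_weight (le_max_right _ _) hs ?_)
          have h5 : k < ∑ j ∈ Finset.range (b k + 1), (σ j).card :=
            (F.partition.fibre_lt_iff F.fibres _ _).1 (Nat.lt_succ_self _)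
          have h6 : ((k + 1 : ℕ) : ℝ) ≤ ∑ j ∈ Finset.range (b k + 1), ((σ j).card : ℝ) := by
            exact_mod_cast h5
          exact (h6.trans (hM _)).trans (mul_le_mul_of_nonneg_right (le_max_left _ _) hs'.le)
        have h5 : qX (x (b k)) ≤ max C₂ 1 * max B 1 :=
          (hqX _).2.trans (mul_le_mul (le_max_left _ _) ((hB _).2.trans (le_max_left _ _))
            (NX.nonneg' _) (by positivity))
        have h7 := hΦ.weight_nonneg k
        calc _ ≤ c' * IsQuasiconcave.weight Φ k * (max C₂ 1 * max B 1) :=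
              mul_le_mul h4 h5 (apply_nonneg _ _) (by positivity)
          _ = _ := by ring
      rw [hf, ← unitVec_sum_eq_map, map_sum]
      refine (Finset.le_sum_of_subadditive qX (map_zero qX).le (map_add_le_add qX) _ _).trans
        ((Finset.sum_le_sum fun k _ => h3 k).trans ?_)
      rw [← Finset.mul_sum]
      exact mul_le_mul_of_nonneg_left (sum_le_sum_range_card hΦ.weight_antitone A) (by positivity)
    rw [unitVec_sum_eq_map]
    change qS (F.Q (ι f)) + qX (F.T (ι f)) ≤ D * U
    rw [add_mul]
    exact add_le_add h1 h2

/-- The upper Lorentz estimate with weight `Φ_m / m`, along enumerations with non-increasing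
moduli. -/
theorem exists_upper_lorentz (F : Frame S σ b NX x NY ι) (hS : S.IsSymmetric)
    (hSconv : S.qnorm.IsLocallyConvex) (hXconv : NX.IsLocallyConvex) (hxn : IsSemiNormalized NX x)
    {c : ℝ} (hM : ∀ n, ∑ k ∈ Finset.range (n + 1), ((σ k).card : ℝ) ≤ c * (σ n).card)
    {Φ : ℕ → ℝ} (hΦ : IsQuasiconcave Φ) (hΦS : ∀ m, fundamental S.norm00 m ≤ Φ m) :
    ∃ D : ℝ, 0 < D ∧ ∀ (f : ℕ → 𝕜) (n : ℕ) (p : ℕ → ℕ), Set.InjOn p (Finset.range n) →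
      (∀ i j, i ≤ j → j < n → ‖f (p j)‖ ≤ ‖f (p i)‖) →
      NY (∑ j ∈ Finset.range n, f (p j) • unitVec ι (p j)) ≤
        D * ∑ j ∈ Finset.range n, ‖f (p j)‖ * IsQuasiconcave.weight Φ j := by
  obtain ⟨R, C, D, hC0, hD0, hC, hD⟩ := F.exists_seminorm hS hSconv hXconv hxn hM hΦ hΦS
  refine ⟨C * D, by positivity, fun f n p hp hanti => (hC _).trans ?_⟩
  rw [mul_assoc]
  refine mul_le_mul_of_nonneg_left ?_ hC0.le
  have h := seminorm_sum_smul_le R (fun j => sgn (f (p j)) • unitVec ι (p j))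
    (fun j => ‖f (p j)‖) (fun j => D * IsQuasiconcave.weight Φ j) n (fun _ _ => norm_nonneg _)
    hanti fun j hj => by
      have hp' : Set.InjOn p (Finset.range (j + 1)) := hp.mono (by
        intro i hi
        simp only [Finset.coe_range, Set.mem_Iio] at hi ⊢
        omega)
      have h1 := hD ((Finset.range (j + 1)).image p) (fun k => sgn (f k)) fun k => norm_sgn _
      rw [Finset.sum_image hp', Finset.card_image_of_injOn hp', Finset.card_range] at h1
      rwa [← Finset.mul_sum]
  simp only [smul_smul, norm_mul_sgn] at h
  refine h.trans_eq ?_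
  rw [Finset.mul_sum]
  exact Finset.sum_congr rfl fun j _ => by ring

/-! ### Lower weak-Lorentz estimates -/

/-- The coefficients of a vector satisfy a weak Lorentz estimate. Large coefficients come either from
the component in `S`, or from a coefficient in `X`; in the latter case the indices lie before the
end of a block `σ_n`, so there are at most as many as elements of `σ_n`, up to a constant. -/
theorem exists_lower_weakLorentz (F : Frame S σ b NX x NY ι) (hS : S.IsSymmetric)
    {xs : ℕ → X →ₗ[𝕜] 𝕜} (hx : IsBasisWithDual NX x xs)
    (hxs : ∃ B : ℝ, ∀ n, NX.dualNorm (xs n) ≤ B)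
    {c : ℝ} (hM : ∀ n, ∑ k ∈ Finset.range (n + 1), ((σ k).card : ℝ) ≤ c * (σ n).card)
    {Φ : ℕ → ℝ} {K : ℝ} (hΦ : IsQuasiconcave Φ) (hK : 0 < K)
    (hΦS : ∀ m, fundamental S.norm00 m ≤ Φ m ∧ Φ m ≤ K * fundamental S.norm00 m) :
    ∃ D : ℝ, 0 < D ∧ ∀ (y : Y) (A : Finset ℕ) (t : ℝ), 0 ≤ t →
      (∀ k ∈ A, t ≤ ‖F.dualVec xs k y‖) → t * Φ A.card ≤ D * NY y := by
  classical
  obtain ⟨B, hB⟩ := hxs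
  obtain ⟨C₁, hC₁, hC₁'⟩ := hS.exists_mul_fundamental_le
  obtain ⟨C₂, hC₂, hC₂'⟩ := F.Q_bounded.exists_pos
  obtain ⟨C₃, hC₃, hC₃'⟩ := F.T_bounded.exists_pos
  set c' := max c 1
  set B' := max B 1
  refine ⟨2 * K * (C₁ * C₂) + 2 * c' * K * (B' * C₃), by positivity, fun y A t ht h => ?_⟩
  set A₁ := A.filter fun k => t / 2 ≤ ‖(F.Q y).1 k‖ with hA₁
  set A₂ := A.filter fun k => ¬ t / 2 ≤ ‖(F.Q y).1 k‖ with hA₂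
  have hcard : A.card = A₁.card + A₂.card := (Finset.card_filter_add_card_filter_not _).symm
  have hy := NY.nonneg' y
  have h1 : t * Φ A₁.card ≤ 2 * K * (C₁ * C₂) * NY y := by
    have h2 := hC₁' A₁ (F.Q y) (t / 2) (by positivity) fun k hk => (Finset.mem_filter.1 hk).2
    have h3 := mul_le_mul_of_nonneg_left (hC₂' y) hC₁.le
    have h4 := mul_le_mul_of_nonneg_left (hΦS A₁.card).2 ht
    have h5 := mul_le_mul_of_nonneg_left (h2.trans h3) hK.le
    linarith
  have h2 : t * Φ A₂.card ≤ 2 * c' * K * (B' * C₃) * NY y := by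
    rcases A₂.eq_empty_or_nonempty with h0 | hne
    · rw [h0, Finset.card_empty, hΦ.zero, mul_zero]
      positivity
    set k := A₂.max' hne
    have hk : k ∈ A₂ := A₂.max'_mem hne
    have hkA := Finset.mem_filter.1 hk
    set s := (σ (b k)).card
    have hs : 0 < s := F.partition.fibre_card_pos _
    have hΛ : 0 < fundamental S.norm00 s := fundamental_card_pos S F.partition (b k)
    have h3 : A₂.card ≤ ∑ j ∈ Finset.range (b k + 1), (σ j).card := by
      rw [← Finset.card_range (∑ j ∈ Finset.range (b k + 1), (σ j).card)]
      refine Finset.card_le_card fun i hi => Finset.mem_range.2 ?_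
      rw [← F.partition.fibre_lt_iff F.fibres]
      exact Nat.lt_succ_of_le (F.partition.fibre_mono F.fibres (A₂.le_max' i hi))
    have h4 : (A₂.card : ℝ) ≤ c' * s := by
      have h5 : (A₂.card : ℝ) ≤ ∑ j ∈ Finset.range (b k + 1), ((σ j).card : ℝ) := by
        exact_mod_cast h3
      exact (h5.trans (hM _)).trans (mul_le_mul_of_nonneg_right (le_max_left _ _) (by positivity))
    have h5 : Φ A₂.card ≤ c' * (K * fundamental S.norm00 s) :=
      (hΦ.le_mul (le_max_right _ _) hs h4).trans
        (mul_le_mul_of_nonneg_left (hΦS s).2 (by positivity))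
    have h6 : t / 2 * fundamental S.norm00 s ≤ B' * (C₃ * NY y) := by
      have h7 := h k hkA.1
      rw [F.dualVec_apply] at h7
      have h8 := h7.trans (norm_add_le _ _)
      rw [norm_mul, norm_inv, RCLike.norm_ofReal, abs_of_pos hΛ] at h8
      have h9 : t / 2 ≤ (fundamental S.norm00 s)⁻¹ * ‖xs (b k) (F.T y)‖ := by
        have := not_le.1 hkA.2
        linarith
      rw [inv_mul_eq_div, le_div_iff₀ hΛ] at h9
      refine h9.trans (((hx.bounded _).le_dualNorm _).trans ?_)
      exact mul_le_mul ((hB _).trans (le_max_left _ _)) (hC₃' y) (NX.nonneg' _) (by positivity)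
    have h7 := mul_le_mul_of_nonneg_left h5 ht
    have h8 := mul_le_mul_of_nonneg_left h6 (show 0 ≤ 2 * c' * K by positivity)
    linarith
  have h3 := mul_le_mul_of_nonneg_left (hΦ.add_le A₁.card A₂.card) ht
  rw [hcard, add_mul]
  linarith

end Frame

/-! ### Embeddings between Lorentz spaces and the completion -/

theorem lorentzNorm_one {w : ℕ → ℝ} (hw : ∀ n, 0 < w n) (f : ℕ → 𝕜) :
    lorentzNorm 1 w f = ∑' n, ENNReal.ofReal (rearrangement f n * w n) := by
  rw [lorentzNorm, one_div_one, ENNReal.rpow_one]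
  refine tsum_congr fun n => ?_
  have h : 0 < primitive w n := Finset.sum_pos (fun k _ => hw k) (by simp)
  rw [Real.rpow_one]
  congr 1
  field_simp

theorem summable_rearrangement {w : ℕ → ℝ} (hw : ∀ n, 0 < w n) {f : ℕ → 𝕜}
    (hf : lorentzNorm 1 w f < ⊤) : Summable fun n => rearrangement f n * w n := by
  rw [lorentzNorm_one hw] at hf
  have h := ENNReal.summable_toReal hf.ne
  refine h.congr fun n => ?_
  rw [ENNReal.toReal_ofReal (mul_nonneg (rearrangement_nonneg f n) (hw n).le)]

theorem primitive_diff (L : ℕ → ℝ) (h0 : L 0 = 0) (n : ℕ) :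
    primitive (fun n => L (n + 1) - L n) n = L (n + 1) := by
  rw [primitive, Finset.sum_range_sub, h0, sub_zero]

/-- The upper Lorentz estimate for the vectors with coefficients `f` on a finite set. -/
theorem norm_sum_unitVec_le {u : ℕ → ℝ} {D : ℝ}
    (hupper : ∀ (f : ℕ → 𝕜) (n : ℕ) (p : ℕ → ℕ), Set.InjOn p (Finset.range n) →
      (∀ i j, i ≤ j → j < n → ‖f (p j)‖ ≤ ‖f (p i)‖) →
      NY (∑ j ∈ Finset.range n, f (p j) • unitVec ι (p j)) ≤
        D * ∑ j ∈ Finset.range n, ‖f (p j)‖ * u j) (A : Finset ℕ) (f : ℕ → 𝕜) :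
    ∃ p : ℕ → ℕ, Set.InjOn p (Finset.range A.card) ∧ (∀ j < A.card, p j ∈ A) ∧
      (∀ i j, i ≤ j → j < A.card → ‖f (p j)‖ ≤ ‖f (p i)‖) ∧
      NY (∑ k ∈ A, f k • unitVec ι k) ≤ D * ∑ j ∈ Finset.range A.card, ‖f (p j)‖ * u j := by
  obtain ⟨p, hp, himg, hanti⟩ := exists_antitone_enumeration A fun k => ‖f k‖
  refine ⟨p, hp, fun j hj => ?_, hanti, ?_⟩
  · have : p j ∈ (Finset.range A.card).image p :=
      Finset.mem_image_of_mem _ (Finset.mem_range.2 hj)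
    rwa [himg] at this
  · refine le_of_eq_of_le ?_ (hupper f A.card p hp hanti)
    rw [← Finset.sum_image (f := fun k => f k • unitVec ι k) hp, himg]

/-- The series with coefficients in `d₁(w)` converges. For the Cauchy property, the rearrangement
of a tail is bounded both by the one of the whole sequence and by the supremum of the tail. -/
theorem exists_lorentz_embedding {u w : ℕ → ℝ} {D K : ℝ} (hD : 0 < D) (hK : 0 < K)
    (hw : ∀ n, 0 < w n) (hu0 : ∀ n, 0 ≤ u n) (huw : ∀ n, u n ≤ K * w n)
    (hupper : ∀ (f : ℕ → 𝕜) (n : ℕ) (p : ℕ → ℕ), Set.InjOn p (Finset.range n) →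
      (∀ i j, i ≤ j → j < n → ‖f (p j)‖ ≤ ‖f (p i)‖) →
      NY (∑ j ∈ Finset.range n, f (p j) • unitVec ι (p j)) ≤
        D * ∑ j ∈ Finset.range n, ‖f (p j)‖ * u j)
    (hNY : NY.IsComplete) {es : ℕ → Y →ₗ[𝕜] 𝕜} (he : IsBasisWithDual NY (unitVec ι) es) :
    ∃ C : ℝ, ∀ f : ℕ → 𝕜, MemLorentz 1 w f →
      ∃ y, NY.ConvergesTo (fun m => ∑ k ∈ Finset.range m, f k • unitVec ι k) y ∧
        (∀ k, es k y = f k) ∧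
        ENNReal.ofReal (NY y) ≤ ENNReal.ofReal C * lorentzNorm 1 w f := by
  have hκ := NY.modulus_pos
  refine ⟨NY.modulus * (D * K), fun f hf => ?_⟩
  have hsum := summable_rearrangement hw hf.2
  have hr := rearrangement_nonneg f
  have hbound : ∀ A : Finset ℕ, ∀ δ : ℝ, 0 ≤ δ → (∀ k ∈ A, ‖f k‖ ≤ δ) →
      NY (∑ k ∈ A, f k • unitVec ι k) ≤
        D * K * ∑ j ∈ Finset.range A.card, min (rearrangement f j) δ * w j := by
    intro A δ hδ hA
    obtain ⟨p, hp, hpA, hanti, h⟩ := norm_sum_unitVec_le hupper A f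
    refine h.trans ?_
    rw [mul_assoc, Finset.mul_sum (a := K)]
    refine mul_le_mul_of_nonneg_left (Finset.sum_le_sum fun j hj => ?_) hD.le
    rw [Finset.mem_range] at hj
    have h1 : ‖f (p j)‖ ≤ min (rearrangement f j) δ :=
      le_min (norm_le_rearrangement hf.1 hp hanti hj) (hA _ (hpA j hj))
    have h2 := mul_le_mul h1 (huw j) (hu0 j) ((norm_nonneg _).trans h1)
    linarith
  have hcauchy : ∀ ε > 0, ∃ n₀, ∀ m ≥ n₀, ∀ n ≥ n₀,
      NY (∑ k ∈ Finset.range m, f k • unitVec ι k - ∑ k ∈ Finset.range n, f k • unitVec ι k)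
        < ε := by
    intro ε hε
    set η := ε / (D * K) / 2 with hη
    have hη0 : 0 < η := by positivity
    obtain ⟨s, hs⟩ := summable_iff_vanishing_norm.1 hsum η hη0
    set W := ∑ j ∈ s, w j with hW
    have hW0 : 0 ≤ W := Finset.sum_nonneg fun j _ => (hw j).le
    set δ := η / (W + 1) with hδ
    have hδ0 : 0 < δ := by positivity
    obtain ⟨n₀, hn₀⟩ := Metric.tendsto_atTop.1 hf.1 δ hδ0
    have key : ∀ m n, n₀ ≤ n → n ≤ m →
        NY (∑ k ∈ Finset.range m, f k • unitVec ι k - ∑ k ∈ Finset.range n, f k • unitVec ι k)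
          < ε := by
      intro m n hn hnm
      rw [← Finset.sum_Ico_eq_sub _ hnm]
      have h1 := hbound (Finset.Ico n m) δ hδ0.le fun k hk => by
        have := hn₀ k (hn.trans (Finset.mem_Ico.1 hk).1)
        rw [dist_zero_right] at this
        exact this.le
      refine h1.trans_lt ?_
      set T := Finset.range (Finset.Ico n m).card
      have h2 : ∑ j ∈ T, min (rearrangement f j) δ * w j < η + η := by
        rw [← Finset.sum_filter_add_sum_filter_not T (fun j => j ∈ s)]
        refine add_lt_add ?_ ?_
        · have h3 : ∑ j ∈ T with j ∈ s, min (rearrangement f j) δ * w j ≤ ∑ j ∈ s, δ * w j := by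
            refine (Finset.sum_le_sum fun j _ => mul_le_mul_of_nonneg_right (min_le_right _ _)
              (hw j).le).trans (Finset.sum_le_sum_of_subset_of_nonneg ?_ fun j _ _ => ?_)
            · intro j hj; exact (Finset.mem_filter.1 hj).2
            · exact mul_nonneg hδ0.le (hw j).le
          rw [← Finset.mul_sum, ← hW] at h3
          refine h3.trans_lt ?_
          rw [hδ, div_mul_eq_mul_div, div_lt_iff₀ (by positivity)]
          nlinarith
        · have h3 := hs (T.filter fun j => ¬ j ∈ s) (Finset.disjoint_left.2 fun j hj hj' =>
            (Finset.mem_filter.1 hj).2 hj')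
          refine (Finset.sum_le_sum fun j _ => mul_le_mul_of_nonneg_right (min_le_left _ _)
            (hw j).le).trans_lt ((le_abs_self _).trans_lt h3)
      have h3 := mul_lt_mul_of_pos_left h2 (show 0 < D * K by positivity)
      refine h3.trans_eq ?_
      rw [hη]
      field_simp
      ring
    refine ⟨n₀, fun m hm n hn => ?_⟩
    rcases le_total n m with h | h
    · exact key m n hn h
    · rw [NY.sub_comm]
      exact key n m hm h
  obtain ⟨y, hy⟩ := hNY _ hcauchy
  refine ⟨y, hy, fun k => schauder_coeff he hy k, ?_⟩
  obtain ⟨B, hB0, hB⟩ := exists_norm_le_of_tendsto_zero hf.1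
  have h1 := hy.le (tendsto_const_nhds (x := D * K * ∑' n, rearrangement f n * w n))
    (Eventually.of_forall fun m => by
      refine (hbound (Finset.range m) B hB0 fun k _ => hB k).trans ?_
      refine mul_le_mul_of_nonneg_left ?_ (by positivity)
      refine (Finset.sum_le_sum fun j _ => mul_le_mul_of_nonneg_right (min_le_left _ _)
        (hw j).le).trans ?_
      exact hsum.sum_le_tsum _ fun j _ => mul_nonneg (hr j) (hw j).le)
  rw [lorentzNorm_one hw, ← ENNReal.ofReal_tsum_of_nonneg
    (fun n => mul_nonneg (hr n) (hw n).le) hsum, ← ENNReal.ofReal_mul (by positivity)]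
  refine ENNReal.ofReal_le_ofReal (h1.trans_eq ?_)
  ring

namespace Frame

/-- The coefficient transform takes values in the weak Lorentz space. -/
theorem exists_weakLorentz_embedding (F : Frame S σ b NX x NY ι) {xs : ℕ → X →ₗ[𝕜] 𝕜}
    (hx : IsBasisWithDual NX x xs) {Φ : ℕ → ℝ}
    (hΦS : ∀ m, fundamental S.norm00 m ≤ Φ m) {D : ℝ} (hD : 0 < D)
    (hlower : ∀ (y : Y) (A : Finset ℕ) (t : ℝ), 0 ≤ t →
      (∀ k ∈ A, t ≤ ‖F.dualVec xs k y‖) → t * Φ A.card ≤ D * NY y) :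
    ∃ C : ℝ, ∀ y,
      MemWeakLorentz (fun n => fundamental S.norm00 (n + 1) - fundamental S.norm00 n)
        (fun k => F.dualVec xs k y) ∧
      weakLorentzNorm (fun n => fundamental S.norm00 (n + 1) - fundamental S.norm00 n)
        (fun k => F.dualVec xs k y) ≤ ENNReal.ofReal (C * NY y) := by
  have hweak : ∀ y, weakLorentzNorm (fun n => fundamental S.norm00 (n + 1) -
      fundamental S.norm00 n) (fun k => F.dualVec xs k y) ≤ ENNReal.ofReal (D * NY y) := by
    intro y
    refine iSup_le fun n => ENNReal.ofReal_le_ofReal ?_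
    rw [primitive_diff (fundamental S.norm00) (fundamental_zero S.qnorm00)]
    refine rearrangement_mul_le (fundamental_pos S.qnorm00 (by omega))
      (mul_nonneg hD.le (NY.nonneg' y)) fun A t ht hA h => ?_
    refine le_trans ?_ (hlower y A t ht h)
    rw [hA]
    exact mul_le_mul_of_nonneg_left (hΦS _) ht
  have hΦ1 : 0 < Φ 1 := (fundamental_pos S.qnorm00 le_rfl).trans_le (hΦS 1)
  have hunif : ∀ y k, ‖F.dualVec xs k y‖ ≤ D / Φ 1 * NY y := fun y k => by
    have := hlower y {k} ‖F.dualVec xs k y‖ (norm_nonneg _) (by simp)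
    rw [Finset.card_singleton] at this
    rw [div_mul_eq_mul_div, le_div_iff₀ hΦ1]
    exact this
  refine ⟨D, fun y => ⟨⟨?_, (hweak y).trans_lt ENNReal.ofReal_lt_top⟩, hweak y⟩⟩
  refine Metric.tendsto_atTop.2 fun ε hε => ?_
  obtain ⟨f, hf⟩ := F.completion.dense y (ε / (D / Φ 1)) (by positivity)
  refine ⟨f.support.sup id + 1, fun k hk => ?_⟩
  have hfk : f k = 0 := by
    by_contra h
    have := Finset.le_sup (f := id) (Finsupp.mem_support_iff.2 h)
    simp only [id] at this
    change k ≤ f.support.sup id at this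
    omega
  rw [dist_zero_right]
  have h1 := hunif (y - ι f) k
  rw [map_sub, F.dualVec_ι hx, hfk, sub_zero] at h1
  refine h1.trans_lt ?_
  rwa [lt_div_iff₀' (by positivity)] at hf

end Frame

end Frames

section Gauges

variable {𝕜 X Y : Type*} [RCLike 𝕜] [AddCommGroup X] [Module 𝕜 X] [AddCommGroup Y] [Module 𝕜 Y]

/-! ### Sequence spaces from gauges with the Fatou property -/

/-- An extended quasi-norm on scalar sequences, invariant under permutations and changes of signs,
with the Fatou property. -/
structure IsFatouGauge (ρ : (ℕ → 𝕜) → ENNReal) : Prop where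
  smul_le : ∀ (c : 𝕜) f, ρ (c • f) ≤ ‖c‖ₑ * ρ f
  add_le : ∃ κ : NNReal, 1 ≤ κ ∧ ∀ f g, ρ (f + g) ≤ κ * (ρ f + ρ g)
  fatou : ∀ (f : ℕ → ℕ → 𝕜) (g : ℕ → 𝕜) (C : ENNReal),
    (∀ k, Tendsto (fun n => f n k) atTop (𝓝 (g k))) → (∀ n, ρ (f n) ≤ C) → ρ g ≤ C
  coord_le : ∃ C : NNReal, ∀ f k, ‖f k‖ₑ ≤ C * ρ f
  symm : ∀ f g (π : Equiv.Perm ℕ), (∀ k, ‖g (π k)‖ = ‖f k‖) → ρ g ≤ ρ f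
  ind_lt : ∀ k, ρ (ind 𝕜 {k}) < ⊤

namespace IsFatouGauge

variable {ρ : (ℕ → 𝕜) → ENNReal}

theorem map_zero (h : IsFatouGauge ρ) : ρ 0 = 0 := by
  simpa using h.smul_le 0 0

theorem map_neg (h : IsFatouGauge ρ) (f : ℕ → 𝕜) : ρ (-f) = ρ f :=
  le_antisymm (h.symm _ _ (Equiv.refl ℕ) (by simp)) (h.symm _ _ (Equiv.refl ℕ) (by simp))

theorem c00_lt (h : IsFatouGauge ρ) (f : ℕ →₀ 𝕜) : ρ f < ⊤ := by
  obtain ⟨κ, -, hκ⟩ := h.add_le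
  induction f using Finsupp.induction_linear with
  | zero => rw [Finsupp.coe_zero, h.map_zero]; exact ENNReal.zero_lt_top
  | add f g hf hg =>
    rw [Finsupp.coe_add]
    exact (hκ _ _).trans_lt (ENNReal.mul_lt_top ENNReal.coe_lt_top (ENNReal.add_lt_top.2 ⟨hf, hg⟩))
  | single k c =>
    have e : (Finsupp.single k c : ℕ →₀ 𝕜) = c • ind 𝕜 {k} := by simp [ind]
    rw [e, Finsupp.coe_smul]
    exact (h.smul_le _ _).trans_lt (ENNReal.mul_lt_top enorm_lt_top (h.ind_lt k))

/-- The closure of `c₀₀` for a gauge. -/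
def closureC00 (h : IsFatouGauge ρ) : Submodule 𝕜 (ℕ → 𝕜) where
  carrier := {f | ∀ ε : NNReal, 0 < ε → ∃ g : ℕ →₀ 𝕜, ρ (f - g) < ε}
  zero_mem' := fun ε hε => ⟨0, by simpa [h.map_zero] using hε⟩
  add_mem' := by
    rintro f f' hf hf' ε hε
    obtain ⟨κ, hκ1, hκ⟩ := h.add_le
    have hκ0 : 0 < κ := one_pos.trans_le hκ1
    obtain ⟨g, hg⟩ := hf (ε / (2 * κ)) (by positivity)
    obtain ⟨g', hg'⟩ := hf' (ε / (2 * κ)) (by positivity)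
    refine ⟨g + g', ?_⟩
    have e : f + f' - ⇑(g + g') = (f - g) + (f' - g') := by rw [Finsupp.coe_add]; abel
    rw [e]
    refine (hκ _ _).trans_lt ?_
    have e2 : (ε : ENNReal) = κ * (((ε / (2 * κ) : NNReal) : ENNReal) +
        ((ε / (2 * κ) : NNReal) : ENNReal)) := by
      rw [← ENNReal.coe_add, ← ENNReal.coe_mul]
      congr 1
      field_simp
      ring
    rw [e2]
    exact ENNReal.mul_lt_mul_right (by simpa using hκ0.ne') ENNReal.coe_ne_top
      (ENNReal.add_lt_add hg hg')
  smul_mem' := by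
    rintro c f hf ε hε
    obtain ⟨g, hg⟩ := hf (ε / (‖c‖₊ + 1)) (by positivity)
    refine ⟨c • g, ?_⟩
    rw [Finsupp.coe_smul, ← smul_sub]
    refine (h.smul_le _ _).trans_lt ?_
    have e2 : (ε : ENNReal) = ((‖c‖₊ + 1 : NNReal) : ENNReal) *
        ((ε / (‖c‖₊ + 1) : NNReal) : ENNReal) := by
      rw [← ENNReal.coe_mul]
      congr 1
      field_simp
    rw [e2]
    refine lt_of_le_of_lt (mul_le_mul_left (b := ‖c‖ₑ) (c := ((‖c‖₊ + 1 : NNReal) : ENNReal)) ?_ _)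
      (ENNReal.mul_lt_mul_right (by simp) ENNReal.coe_ne_top hg)
    rw [enorm_eq_nnnorm]
    exact_mod_cast le_self_add

theorem lt_top_of_mem (h : IsFatouGauge ρ) {f : ℕ → 𝕜} (hf : f ∈ h.closureC00) : ρ f < ⊤ := by
  obtain ⟨κ, -, hκ⟩ := h.add_le
  obtain ⟨g, hg⟩ := hf 1 one_pos
  have := hκ (f - g) g
  rw [sub_add_cancel] at this
  exact this.trans_lt (ENNReal.mul_lt_top ENNReal.coe_lt_top
    (ENNReal.add_lt_top.2 ⟨hg.trans ENNReal.coe_lt_top, h.c00_lt g⟩))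

theorem c00_mem (h : IsFatouGauge ρ) (f : ℕ →₀ 𝕜) : (f : ℕ → 𝕜) ∈ h.closureC00 :=
  fun ε hε => ⟨f, by simpa [h.map_zero] using hε⟩

theorem toReal_coord_le (h : IsFatouGauge ρ) : ∃ C : ℝ, 0 ≤ C ∧ ∀ f, ρ f < ⊤ → ∀ k,
    ‖f k‖ ≤ C * (ρ f).toReal := by
  obtain ⟨C, hC⟩ := h.coord_le
  refine ⟨C, C.2, fun f hf k => ?_⟩
  have := ENNReal.toReal_mono (ENNReal.mul_lt_top ENNReal.coe_lt_top hf).ne (hC f k)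
  simpa using this

theorem toReal_smul_le (h : IsFatouGauge ρ) (c : 𝕜) {f : ℕ → 𝕜} (hf : ρ f < ⊤) :
    (ρ (c • f)).toReal ≤ ‖c‖ * (ρ f).toReal := by
  have := ENNReal.toReal_mono (ENNReal.mul_lt_top enorm_lt_top hf).ne (h.smul_le c f)
  simpa using this

/-- The quasi-norm on the closure of `c₀₀`. -/
def qnorm (h : IsFatouGauge ρ) : QuasiNorm 𝕜 h.closureC00 where
  toFun f := (ρ f).toReal
  nonneg' _ := ENNReal.toReal_nonneg
  eq_zero' f hf := by
    obtain ⟨C, -, hC⟩ := h.toReal_coord_le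
    refine Subtype.ext (funext fun k => ?_)
    have := hC f (h.lt_top_of_mem f.2) k
    rw [hf, mul_zero] at this
    exact norm_le_zero_iff.1 this
  smul' c f := by
    have hf := h.lt_top_of_mem f.2
    refine le_antisymm (h.toReal_smul_le c hf) ?_
    rcases eq_or_ne c 0 with rfl | hc
    · simp
    have h1 := h.toReal_smul_le c⁻¹ (h.lt_top_of_mem (h.closureC00.smul_mem c f.2))
    rw [smul_smul, inv_mul_cancel₀ hc, one_smul, norm_inv,
      le_inv_mul_iff₀ (norm_pos_iff.2 hc)] at h1
    exact h1
  add_le' := by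
    obtain ⟨κ, hκ1, hκ⟩ := h.add_le
    refine ⟨κ, hκ1, fun f g => ?_⟩
    have hf := h.lt_top_of_mem f.2
    have hg := h.lt_top_of_mem g.2
    have := ENNReal.toReal_mono (ENNReal.mul_lt_top ENNReal.coe_lt_top
      (ENNReal.add_lt_top.2 ⟨hf, hg⟩)).ne (hκ f g)
    rw [ENNReal.toReal_mul, ENNReal.toReal_add hf.ne hg.ne] at this
    exact this

theorem qnorm_isComplete (h : IsFatouGauge ρ) : h.qnorm.IsComplete := by
  intro u hu
  obtain ⟨C, hC0, hC⟩ := h.toReal_coord_le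
  have hlt : ∀ m n, ρ ((u m : ℕ → 𝕜) - u n) < ⊤ := fun m n =>
    h.lt_top_of_mem (h.closureC00.sub_mem (u m).2 (u n).2)
  have hcoord : ∀ k, ∃ z, Tendsto (fun n => (u n : ℕ → 𝕜) k) atTop (𝓝 z) := fun k => by
    refine cauchySeq_tendsto_of_complete (Metric.cauchySeq_iff.2 fun ε hε => ?_)
    obtain ⟨n₀, hn₀⟩ := hu (ε / (C + 1)) (by positivity)
    refine ⟨n₀, fun m hm n hn => ?_⟩
    rw [dist_eq_norm]
    have h1 : ‖(u m : ℕ → 𝕜) k - (u n : ℕ → 𝕜) k‖ ≤ C * (ρ ((u m : ℕ → 𝕜) - u n)).toReal :=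
      hC _ (hlt m n) k
    have h2 : (ρ ((u m : ℕ → 𝕜) - u n)).toReal < ε / (C + 1) := hn₀ m hm n hn
    rw [lt_div_iff₀ (by positivity)] at h2
    have h3 : 0 ≤ (ρ ((u m : ℕ → 𝕜) - u n)).toReal := ENNReal.toReal_nonneg
    linarith
  choose z hz using hcoord
  have key : ∀ ε : NNReal, 0 < ε → ∃ n₀, ∀ m ≥ n₀, ρ ((u m : ℕ → 𝕜) - z) ≤ ε := by
    intro ε hε
    obtain ⟨n₀, hn₀⟩ := hu ε hε
    refine ⟨n₀, fun m hm => h.fatou (fun n => (u m : ℕ → 𝕜) - u (n + n₀)) _ _ (fun k => ?_)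
      fun n => ?_⟩
    · exact tendsto_const_nhds.sub ((hz k).comp (tendsto_add_atTop_nat n₀))
    · have h1 : (ρ ((u m : ℕ → 𝕜) - u (n + n₀))).toReal < ε := hn₀ m hm (n + n₀) (by omega)
      rw [← ENNReal.ofReal_coe_nnreal]
      exact (ENNReal.le_ofReal_iff_toReal_le (hlt _ _).ne ε.2).2 h1.le
  have hmem : z ∈ h.closureC00 := by
    intro ε hε
    obtain ⟨κ, hκ1, hκ⟩ := h.add_le
    have hκ0 : 0 < κ := one_pos.trans_le hκ1
    obtain ⟨n₀, hn₀⟩ := key (ε / (4 * κ)) (by positivity)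
    obtain ⟨g, hg⟩ := (u n₀).2 (ε / (4 * κ)) (by positivity)
    refine ⟨g, ?_⟩
    have e : z - ⇑g = -((u n₀ : ℕ → 𝕜) - z) + ((u n₀ : ℕ → 𝕜) - g) := by abel
    rw [e]
    refine (hκ _ _).trans_lt ?_
    rw [h.map_neg]
    have h1 : (κ : ENNReal) * (ρ ((u n₀ : ℕ → 𝕜) - z) + ρ ((u n₀ : ℕ → 𝕜) - g)) ≤
        ((κ * (ε / (4 * κ) + ε / (4 * κ)) : NNReal) : ENNReal) := by
      push_cast
      gcongr
      exact hn₀ n₀ le_rfl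
    refine h1.trans_lt ?_
    have h2 : κ * (ε / (4 * κ) + ε / (4 * κ)) = ε / 2 := by field_simp; ring
    rw [h2]
    exact_mod_cast NNReal.half_lt_self hε.ne'
  refine ⟨⟨z, hmem⟩, Metric.tendsto_atTop.2 fun ε hε => ?_⟩
  obtain ⟨n₀, hn₀⟩ := key (ε / 2).toNNReal (Real.toNNReal_pos.2 (half_pos hε))
  refine ⟨n₀, fun m hm => ?_⟩
  rw [Real.dist_0_eq_abs, abs_of_nonneg (h.qnorm.nonneg' _)]
  have h1 := ENNReal.toReal_mono ENNReal.coe_ne_top (hn₀ m hm)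
  rw [ENNReal.coe_toReal, Real.coe_toNNReal _ (half_pos hε).le] at h1
  have h2 : h.qnorm (u m - ⟨z, hmem⟩) ≤ ε / 2 := h1
  linarith

/-- The sequence space defined by a gauge. -/
def space (h : IsFatouGauge ρ) : SequenceSpace 𝕜 where
  carrier := h.closureC00
  qnorm := h.qnorm
  complete := h.qnorm_isComplete
  c00_mem := h.c00_mem
  dense f ε hε := by
    obtain ⟨g, hg⟩ := f.2 ε.toNNReal (Real.toNNReal_pos.2 hε)
    refine ⟨g, ?_⟩
    have := (ENNReal.toReal_lt_toReal (hg.trans ENNReal.coe_lt_top).ne ENNReal.coe_ne_top).2 hg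
    rw [ENNReal.coe_toReal, Real.coe_toNNReal _ hε.le] at this
    exact this
  coord_bounded n := by
    obtain ⟨C, -, hC⟩ := h.toReal_coord_le
    exact ⟨C, fun f => hC f (h.lt_top_of_mem f.2) n⟩

theorem space_norm00 (h : IsFatouGauge ρ) (f : ℕ →₀ 𝕜) : h.space.norm00 f = (ρ f).toReal := rfl

theorem space_isSymmetric (h : IsFatouGauge ρ) : h.space.IsSymmetric := by
  intro a ε π hε
  rw [h.space_norm00, h.space_norm00]
  congr 1
  have e : ∀ k, ‖(a.sum fun n c => Finsupp.single (π n) (ε n * c)) (π k)‖ = ‖a k‖ := fun k => by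
    rw [sum_single_perm_apply, norm_mul, hε, one_mul]
  refine le_antisymm (h.symm _ _ π e) (h.symm _ _ π.symm fun k => ?_)
  rw [← e (π.symm k)]
  simp

end IsFatouGauge

/-! ### The Lorentz and weak Lorentz gauges -/

/-- The norm of the Lorentz space `d₁(u)`, for a non-increasing weight `u`, in a form that is
visibly subadditive. -/
def lorentzGauge (u : ℕ → ℝ) (f : ℕ → 𝕜) : ENNReal :=
  ⨆ (n : ℕ) (p : ℕ → ℕ) (_ : Set.InjOn p (Finset.range n)),
    ∑ j ∈ Finset.range n, ‖f (p j)‖ₑ * ENNReal.ofReal (u j)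

theorem le_lorentzGauge (u : ℕ → ℝ) (f : ℕ → 𝕜) {n : ℕ} {p : ℕ → ℕ}
    (hp : Set.InjOn p (Finset.range n)) :
    ∑ j ∈ Finset.range n, ‖f (p j)‖ₑ * ENNReal.ofReal (u j) ≤ lorentzGauge u f :=
  le_iSup_of_le n (le_iSup_of_le p (le_iSup_of_le hp le_rfl))

theorem lorentzGauge_ind_le {u : ℕ → ℝ} (hu : Antitone u) (hu0 : ∀ n, 0 ≤ u n) (A : Finset ℕ) :
    lorentzGauge u (ind 𝕜 A) ≤ ENNReal.ofReal (∑ j ∈ Finset.range A.card, u j) := by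
  classical
  refine iSup_le fun n => iSup_le fun p => iSup_le fun hp => ?_
  set B := (Finset.range n).filter fun j => p j ∈ A
  have e : ∀ j, ‖ind 𝕜 A (p j)‖ₑ * ENNReal.ofReal (u j) =
      if p j ∈ A then ENNReal.ofReal (u j) else 0 := fun j => by
    rw [ind_apply]
    split_ifs <;> simp
  have hB : B.card ≤ A.card := Finset.card_le_card_of_injOn p
    (fun j hj => (Finset.mem_filter.1 hj).2)
    (hp.mono fun j hj => (Finset.mem_filter.1 hj).1)
  simp only [e]
  rw [← Finset.sum_filter, ← ENNReal.ofReal_sum_of_nonneg fun j _ => hu0 j]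
  refine ENNReal.ofReal_le_ofReal ((sum_le_sum_range_card hu B).trans ?_)
  refine Finset.sum_le_sum_of_subset_of_nonneg ?_ fun j _ _ => hu0 j
  intro j hj
  simp only [Finset.mem_range] at hj ⊢
  omega

theorem lorentzGauge_ind_range {u : ℕ → ℝ} (hu : Antitone u) (hu0 : ∀ n, 0 ≤ u n) (m : ℕ) :
    lorentzGauge u (ind 𝕜 (Finset.range m)) = ENNReal.ofReal (∑ j ∈ Finset.range m, u j) := by
  refine le_antisymm (by simpa using lorentzGauge_ind_le (𝕜 := 𝕜) hu hu0 (Finset.range m)) ?_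
  refine le_of_eq_of_le ?_ (le_lorentzGauge u _ (n := m) (p := id) (Set.injOn_id _))
  rw [ENNReal.ofReal_sum_of_nonneg fun j _ => hu0 j]
  refine Finset.sum_congr rfl fun j hj => ?_
  simp [ind_apply, Finset.mem_range.1 hj]

theorem isFatouGauge_lorentzGauge {u : ℕ → ℝ} (hu : Antitone u) (hu0 : ∀ n, 0 ≤ u n)
    (hpos : 0 < u 0) : IsFatouGauge (lorentzGauge (𝕜 := 𝕜) u) where
  smul_le c f := by
    refine iSup_le fun n => iSup_le fun p => iSup_le fun hp => ?_
    refine le_trans (le_of_eq ?_) (mul_le_mul_right (le_lorentzGauge u f hp) _)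
    rw [Finset.mul_sum]
    refine Finset.sum_congr rfl fun j _ => ?_
    rw [Pi.smul_apply, smul_eq_mul, enorm_mul, mul_assoc]
  add_le := by
    refine ⟨1, le_rfl, fun f g => ?_⟩
    rw [ENNReal.coe_one, one_mul]
    refine iSup_le fun n => iSup_le fun p => iSup_le fun hp => ?_
    refine le_trans ?_ (add_le_add (le_lorentzGauge u f hp) (le_lorentzGauge u g hp))
    rw [← Finset.sum_add_distrib]
    refine Finset.sum_le_sum fun j _ => ?_
    rw [← add_mul]
    exact mul_le_mul_left (enorm_add_le _ _) _
  fatou f g C hfg hC := by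
    refine iSup_le fun n => iSup_le fun p => iSup_le fun hp => ?_
    refine le_of_tendsto' (tendsto_finsetSum (Finset.range n) fun j _ =>
      ENNReal.Tendsto.mul_const (hfg (p j)).enorm (Or.inr ENNReal.ofReal_ne_top))
      fun i => (le_lorentzGauge u (f i) hp).trans (hC i)
  coord_le := by
    refine ⟨(u 0)⁻¹.toNNReal, fun f k => ?_⟩
    have h := le_lorentzGauge u f (n := 1) (p := fun _ => k) (by simp)
    rw [Finset.sum_range_one] at h
    refine le_trans (le_of_eq ?_) (mul_le_mul_right h _)
    rw [mul_left_comm, ← ENNReal.ofReal, ← ENNReal.ofReal_mul (by positivity),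
      inv_mul_cancel₀ hpos.ne', ENNReal.ofReal_one, mul_one]
  symm f g π h := by
    refine iSup_le fun n => iSup_le fun p => iSup_le fun hp => ?_
    refine le_trans (le_of_eq ?_) (le_lorentzGauge u f (n := n) (p := fun j => π.symm (p j))
      fun i hi j hj hij => hp hi hj (π.symm.injective hij))
    refine Finset.sum_congr rfl fun j _ => ?_
    have : ‖g (p j)‖ₑ = ‖f (π.symm (p j))‖ₑ := by
      rw [← ofReal_norm, ← ofReal_norm, ← h]
      simp
    rw [this]
  ind_lt k := (lorentzGauge_ind_le hu hu0 {k}).trans_lt ENNReal.ofReal_lt_top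

/-- The quasi-norm of the weak Lorentz space with primitive weight `Φ`: the least constant `C` with
`Φ_{|A|} t ≤ C` whenever `|f| ≥ t` on `A`. -/
def weakLorentzGauge (Φ : ℕ → ℝ) (f : ℕ → 𝕜) : ENNReal :=
  ⨆ (A : Finset ℕ) (t : NNReal) (_ : ∀ k ∈ A, t ≤ ‖f k‖₊), ENNReal.ofReal (Φ A.card) * t

theorem le_weakLorentzGauge (Φ : ℕ → ℝ) {f : ℕ → 𝕜} {A : Finset ℕ} {t : NNReal}
    (h : ∀ k ∈ A, t ≤ ‖f k‖₊) : ENNReal.ofReal (Φ A.card) * t ≤ weakLorentzGauge Φ f :=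
  le_iSup_of_le A (le_iSup_of_le t (le_iSup_of_le h le_rfl))

theorem weakLorentzGauge_ind {Φ : ℕ → ℝ} (hΦ : IsQuasiconcave Φ) (B : Finset ℕ) :
    weakLorentzGauge Φ (ind 𝕜 B) = ENNReal.ofReal (Φ B.card) := by
  refine le_antisymm (iSup_le fun A => iSup_le fun t => iSup_le fun h => ?_) ?_
  · rcases eq_or_ne t 0 with rfl | ht
    · simp
    have hAB : A ⊆ B := fun k hk => by
      by_contra hkB
      have := h k hk
      rw [ind_apply, if_neg hkB, nnnorm_zero] at this
      exact ht (le_antisymm this zero_le)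
    rcases A.eq_empty_or_nonempty with rfl | ⟨k, hk⟩
    · simp [hΦ.zero]
    have ht1 : t ≤ 1 := by
      have := h k hk
      rwa [ind_apply, if_pos (hAB hk), nnnorm_one] at this
    calc ENNReal.ofReal (Φ A.card) * t ≤ ENNReal.ofReal (Φ B.card) * 1 :=
          mul_le_mul' (ENNReal.ofReal_le_ofReal (hΦ.mono (Finset.card_le_card hAB)))
            (by exact_mod_cast ht1)
      _ = _ := mul_one _
  · have := le_weakLorentzGauge (𝕜 := 𝕜) Φ (f := ind 𝕜 B) (A := B) (t := 1) fun k hk => by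
      rw [ind_apply, if_pos hk, nnnorm_one]
    simpa using this

theorem isFatouGauge_weakLorentzGauge {Φ : ℕ → ℝ} (hΦ : IsQuasiconcave Φ) (hpos : 0 < Φ 1) :
    IsFatouGauge (weakLorentzGauge (𝕜 := 𝕜) Φ) where
  smul_le c f := by
    refine iSup_le fun A => iSup_le fun t => iSup_le fun h => ?_
    rcases eq_or_ne c 0 with rfl | hc
    · rcases A.eq_empty_or_nonempty with rfl | ⟨k, hk⟩
      · simp [hΦ.zero]
      · have := h k hk
        simp only [zero_smul, Pi.zero_apply, nnnorm_zero, nonpos_iff_eq_zero] at this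
        simp [this]
    have hc' : ‖c‖₊ ≠ 0 := nnnorm_ne_zero_iff.2 hc
    have h1 := le_weakLorentzGauge Φ (f := f) (A := A) (t := t / ‖c‖₊) fun k hk => by
      have := h k hk
      rw [Pi.smul_apply, smul_eq_mul, nnnorm_mul] at this
      rw [div_le_iff₀ (pos_iff_ne_zero.2 hc'), mul_comm]
      exact this
    refine le_trans (le_of_eq ?_) (mul_le_mul_right h1 _)
    rw [mul_left_comm, enorm_eq_nnnorm, ← ENNReal.coe_mul, mul_div_cancel₀ _ hc']
  add_le := by
    classical
    refine ⟨2, one_le_two, fun f g => ?_⟩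
    refine iSup_le fun A => iSup_le fun t => iSup_le fun h => ?_
    set A₁ := A.filter fun k => t / 2 ≤ ‖f k‖₊
    set A₂ := A.filter fun k => ¬ t / 2 ≤ ‖f k‖₊
    have h1 := le_weakLorentzGauge Φ (f := f) (A := A₁) (t := t / 2) fun k hk =>
      (Finset.mem_filter.1 hk).2
    have h2 := le_weakLorentzGauge Φ (f := g) (A := A₂) (t := t / 2) fun k hk => by
      obtain ⟨hkA, hk⟩ := Finset.mem_filter.1 hk
      have h3 := (h k hkA).trans (nnnorm_add_le (f k) (g k))
      rw [not_le] at hk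
      by_contra! h4
      have h5 := add_lt_add hk h4
      rw [add_halves] at h5
      exact h5.not_ge h3
    have hcard : A.card = A₁.card + A₂.card := (Finset.card_filter_add_card_filter_not _).symm
    calc ENNReal.ofReal (Φ A.card) * t
        ≤ (ENNReal.ofReal (Φ A₁.card) + ENNReal.ofReal (Φ A₂.card)) * t := by
          refine mul_le_mul_left ?_ _
          rw [hcard, ← ENNReal.ofReal_add (hΦ.nonneg _) (hΦ.nonneg _)]
          exact ENNReal.ofReal_le_ofReal (hΦ.add_le _ _)
      _ = ((2 : NNReal) : ENNReal) * (ENNReal.ofReal (Φ A₁.card) * ((t / 2 : NNReal) : ENNReal) +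
            ENNReal.ofReal (Φ A₂.card) * ((t / 2 : NNReal) : ENNReal)) := by
          rw [← add_mul, mul_left_comm, ← ENNReal.coe_mul, mul_div_cancel₀ _ two_ne_zero]
      _ ≤ _ := mul_le_mul_right (add_le_add h1 h2) _
  fatou f g C hfg hC := by
    refine iSup_le fun A => iSup_le fun t => iSup_le fun h => ?_
    rcases eq_or_ne t 0 with rfl | ht
    · simp
    have : (𝓝[<] t).NeBot := nhdsLT_neBot_of_exists_lt ⟨0, pos_iff_ne_zero.2 ht⟩
    refine le_of_tendsto (x := 𝓝[<] t) (ENNReal.Tendsto.const_mul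
      ((ENNReal.tendsto_coe.2 tendsto_id).mono_left nhdsWithin_le_nhds)
      (Or.inr ENNReal.ofReal_ne_top)) (eventually_nhdsWithin_of_forall fun s hs => ?_)
    have hev : ∀ᶠ n in atTop, ∀ k ∈ A, s ≤ ‖f n k‖₊ :=
      (Finset.eventually_all A).2 fun k hk => ((hfg k).nnnorm.eventually
        (lt_mem_nhds (lt_of_lt_of_le hs (h k hk)))).mono fun _ => le_of_lt
    obtain ⟨n, hn⟩ := hev.exists
    exact (le_weakLorentzGauge Φ hn).trans (hC n)
  coord_le := by
    refine ⟨(Φ 1)⁻¹.toNNReal, fun f k => ?_⟩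
    have h := le_weakLorentzGauge Φ (f := f) (A := {k}) (t := ‖f k‖₊) (by simp)
    rw [Finset.card_singleton] at h
    refine le_trans (le_of_eq ?_) (mul_le_mul_right h _)
    rw [← mul_assoc, ← ENNReal.ofReal, ← ENNReal.ofReal_mul (by positivity),
      inv_mul_cancel₀ hpos.ne', ENNReal.ofReal_one, one_mul, enorm_eq_nnnorm]
  symm f g π h := by
    refine iSup_le fun A => iSup_le fun t => iSup_le fun hA => ?_
    have h1 := le_weakLorentzGauge Φ (f := f) (A := A.map π.symm.toEmbedding) (t := t)
      fun k hk => by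
        obtain ⟨j, hj, rfl⟩ := Finset.mem_map.1 hk
        have h2 := hA j hj
        have h3 : ‖g j‖₊ = ‖f (π.symm j)‖₊ := by
          rw [← NNReal.coe_inj, coe_nnnorm, coe_nnnorm, ← h]
          simp
        rw [h3] at h2
        exact h2
    rwa [Finset.card_map] at h1
  ind_lt k := by
    rw [weakLorentzGauge_ind hΦ]
    exact ENNReal.ofReal_lt_top

/-! ### Squeeze-symmetric and truncation quasi-greedy bases -/

section General

variable {N : QuasiNorm 𝕜 X} {x : ℕ → X} {xs : ℕ → X →ₗ[𝕜] 𝕜}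

/-- In a squeeze, `‖1_{ε,A}‖ ≲ Λ_{|A|}`, while `t Λ_{|A|} ≲ ‖f‖` for `t` the least modulus of the
coefficients of `f` on `A`. -/
theorem IsSqueezeSymmetric.isTruncationQuasiGreedy (h : IsSqueezeSymmetric N x xs) :
    IsTruncationQuasiGreedy N x xs := by
  classical
  obtain ⟨S₁, S₂, hS₁, hS₂, ⟨C₁, h₁⟩, ⟨C₂, h₂⟩, c, C, hc, hcC⟩ := h
  obtain ⟨C₃, hC₃, h₃⟩ := hS₂.exists_mul_fundamental_le
  set D₁ := max C₁ 0
  refine ⟨D₁ * c⁻¹ * (C₃ * C₂), fun f A hA _ => ?_⟩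
  set ε : ℕ → 𝕜 := fun n => sgn (xs n f)
  set t := A.inf' hA fun n => ‖xs n f‖
  have ht : 0 ≤ t := Finset.le_inf' _ _ fun n _ => norm_nonneg _
  set g : ℕ →₀ 𝕜 := ∑ k ∈ A, Finsupp.single k (ε k)
  have hg : ∀ k, g k = if k ∈ A then ε k else 0 := fun k => by
    simp [g, Finsupp.finsetSum_apply, Finsupp.single_apply]
  have hgnorm : S₁.qnorm ⟨g, S₁.c00_mem g⟩ = fundamental S₁.norm00 A.card := by
    have e : S₁.qnorm00 g = S₁.qnorm00 (ind 𝕜 A) := hS₁.qnorm00.congr_norm fun k => by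
      rw [hg, ind_apply]
      split_ifs
      · rw [norm_sgn, norm_one]
      · rfl
    exact e.trans (hS₁.qnorm00.ind_eq A)
  -- the series of a finitely supported sequence is eventually constant
  have hN : N (signedSum x ε A) ≤ D₁ * fundamental S₁.norm00 A.card := by
    obtain ⟨y, hy, hy'⟩ := h₁ ⟨g, S₁.c00_mem g⟩
    have hlim : N.ConvergesTo (fun m => ∑ n ∈ Finset.range m, g n • x n) (signedSum x ε A) := by
      refine QuasiNorm.convergesTo_of_eventually_eq ?_
      obtain ⟨m₀, hm₀⟩ := A.exists_nat_subset_range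
      filter_upwards [eventually_ge_atTop m₀] with m hm
      rw [signedSum, ← Finset.sum_subset (hm₀.trans (Finset.range_mono hm))
        fun k _ hk => by rw [hg, if_neg hk, zero_smul]]
      exact Finset.sum_congr rfl fun k hk => by rw [hg, if_pos hk]
    rw [hlim.unique hy]
    refine hy'.trans ?_
    rw [hgnorm]
    exact mul_le_mul_of_nonneg_right (le_max_left _ _) (S₁.qnorm00.nonneg' _)
  obtain ⟨hmem, hle⟩ := h₂ f
  have h4 := h₃ A ⟨_, hmem⟩ t ht fun k hk => Finset.inf'_le _ hk
  have h5 : fundamental S₁.norm00 A.card ≤ c⁻¹ * fundamental S₂.norm00 A.card := by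
    rw [le_inv_mul_iff₀ hc]
    exact (hcC _ hA.card_pos).1
  calc t * N (signedSum x ε A)
      ≤ t * (D₁ * (c⁻¹ * fundamental S₂.norm00 A.card)) := by
        refine mul_le_mul_of_nonneg_left (hN.trans ?_) ht
        exact mul_le_mul_of_nonneg_left h5 (le_max_right _ _)
    _ = D₁ * c⁻¹ * (t * fundamental S₂.norm00 A.card) := by ring
    _ ≤ D₁ * c⁻¹ * (C₃ * (C₂ * N f)) := by
        refine mul_le_mul_of_nonneg_left (h4.trans ?_)
          (mul_nonneg (le_max_right _ _) (inv_nonneg.2 hc.le))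
        exact mul_le_mul_of_nonneg_left hle hC₃.le
    _ = _ := by ring

/-- Every non-empty `A ⊆ B` is a greedy set of `1_{ε,B}`. -/
theorem IsTruncationQuasiGreedy.isUCC (h : IsTruncationQuasiGreedy N x xs)
    (hx : IsBasisWithDual N x xs) : IsUCC N x := by
  classical
  obtain ⟨C, hC⟩ := h
  refine ⟨max C 0, fun A B hAB ε hε => ?_⟩
  have hN := N.nonneg' (signedSum x ε B)
  rcases A.eq_empty_or_nonempty with rfl | hA
  · simpa [signedSum, N.map_zero] using mul_nonneg (le_max_right C 0) hN
  have hxs : ∀ n, xs n (signedSum x ε B) = if n ∈ B then ε n else 0 := fun n => by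
    simp [signedSum, map_sum, hx.biorthogonal]
  have hA1 : ∀ n ∈ A, xs n (signedSum x ε B) = ε n := fun n hn => by rw [hxs, if_pos (hAB hn)]
  have h1 := hC (signedSum x ε B) A hA fun n hn k _ => by
    rw [hA1 n hn, hε, hxs]
    split_ifs
    · exact (hε k).le
    · simp
  have h2 : A.inf' hA (fun n => ‖xs n (signedSum x ε B)‖) = 1 := by
    refine le_antisymm ?_ (Finset.le_inf' _ _ fun n hn => by rw [hA1 n hn, hε])
    obtain ⟨n, hn⟩ := hA
    exact (Finset.inf'_le _ hn).trans_eq (by rw [hA1 n hn, hε])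
  have h3 : signedSum x (fun n => sgn (xs n (signedSum x ε B))) A = signedSum x ε A :=
    Finset.sum_congr rfl fun n hn => by
      have : sgn (ε n) = ε n := by
        rw [sgn, if_neg (norm_ne_zero_iff.1 (by rw [hε]; exact one_ne_zero)), hε]
        simp
      simp only [hA1 n hn, this]
  rw [h2, h3, one_mul] at h1
  exact h1.trans (mul_le_mul_of_nonneg_right (le_max_left _ _) hN)

theorem IsBasisWithDual.finite_support (hx : IsBasisWithDual N x xs) {g : X}
    (hg : g ∈ Submodule.span 𝕜 (Set.range x)) : {n | xs n g ≠ 0}.Finite := by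
  induction hg using Submodule.span_induction with
  | mem g hg =>
    obtain ⟨k, rfl⟩ := hg
    refine (Set.finite_singleton k).subset fun n hn => ?_
    by_contra hnk
    refine hn ?_
    rw [hx.biorthogonal, if_neg fun h => hnk h.symm]
  | zero => simp
  | add f g _ _ hf hg =>
    refine (hf.union hg).subset fun n hn => ?_
    by_contra h
    simp only [Set.mem_union, Set.mem_ofPred_eq, not_or, not_not] at h
    exact hn (by rw [map_add, h.1, h.2, add_zero])
  | smul c f _ hf =>
    refine hf.subset fun n hn h => hn ?_
    rw [map_smul, h, smul_zero]

theorem exists_dualNorm_le (hn : IsSemiNormalized N x) (hM : IsMBounded N x xs) :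
    ∃ B : ℝ, ∀ n, N.dualNorm (xs n) ≤ B := by
  obtain ⟨c, C, hc, h⟩ := hn
  obtain ⟨D, hD⟩ := hM
  refine ⟨D / c, fun n => ?_⟩
  rw [le_div_iff₀ hc, mul_comm]
  exact (mul_le_mul_of_nonneg_right (h n).1 (N.dualNorm_nonneg _)).trans (hD n)

end General

/-! ### The coefficients of a truncation quasi-greedy unit vector system -/

namespace Frame

variable {S : SequenceSpace 𝕜} {σ : ℕ → Finset ℕ} {b : ℕ → ℕ} {NX : QuasiNorm 𝕜 X}
  {x : ℕ → X} {NY : QuasiNorm 𝕜 Y} {ι : (ℕ →₀ 𝕜) →ₗ[𝕜] Y} {xs : ℕ → X →ₗ[𝕜] 𝕜}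

/-- For `g` in the span of `x`, the indices at which `J g` has coefficients at least as large as on
`σ_n` form a greedy set that contains `σ_n`. -/
theorem exists_dualNorm_le_of_isTruncationQuasiGreedy (F : Frame S σ b NX x NY ι)
    (hx : IsBasisWithDual NX x xs)
    (h : IsTruncationQuasiGreedy NY (unitVec ι) (F.dualVec xs))
    (hn : IsSemiNormalized NX x) : ∃ B : ℝ, ∀ n, NX.dualNorm (xs n) ≤ B := by
  classical
  obtain ⟨K, hK, hucc⟩ := (h.isUCC (F.isBasisWithDual hx)).exists_pos
  obtain ⟨C, hC⟩ := h
  obtain ⟨c, c', hc, hcx⟩ := hn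
  obtain ⟨C_J, hCJ, hJ⟩ := F.J_bounded.exists_pos
  set C' := max C 0
  have hC'0 : 0 ≤ C' := le_max_right _ _
  set D := c⁻¹ * (K * (C' * C_J))
  have hD : 0 ≤ D := by positivity
  have key : ∀ n, ∀ g ∈ Submodule.span 𝕜 (Set.range x), ‖xs n g‖ ≤ D * NX g := by
    intro n g hg
    rcases eq_or_ne (xs n g) 0 with h0 | h0
    · rw [h0, norm_zero]
      exact mul_nonneg hD (NX.nonneg' _)
    set Λ := fundamental S.norm00 (σ n).card
    have hΛ : 0 < Λ := fundamental_card_pos S F.partition n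
    set t := Λ⁻¹ * ‖xs n g‖ with ht
    have ht0 : 0 < t := mul_pos (inv_pos.2 hΛ) (norm_pos_iff.2 h0)
    have hblock : ∀ k ∈ σ n, F.dualVec xs k (F.J g) = (Λ : 𝕜)⁻¹ * xs n g := fun k hk => by
      rw [F.dualVec_J, (F.fibres _ _).1 hk]
    have hfin : {k | t ≤ ‖F.dualVec xs k (F.J g)‖}.Finite := by
      refine ((hx.finite_support hg).biUnion fun m _ => (σ m).finite_toSet).subset fun k hk => ?_
      refine Set.mem_biUnion (x := b k) (fun h1 => ?_) ((F.fibres _ _).2 rfl)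
      have h2 : t ≤ ‖F.dualVec xs k (F.J g)‖ := hk
      rw [F.dualVec_J, h1, mul_zero, norm_zero] at h2
      exact ht0.not_ge h2
    set A := hfin.toFinset
    have hA : ∀ k, k ∈ A ↔ t ≤ ‖F.dualVec xs k (F.J g)‖ := fun k => hfin.mem_toFinset
    have hσA : σ n ⊆ A := fun k hk => by
      rw [hA, hblock k hk, norm_mul, norm_inv, RCLike.norm_ofReal, abs_of_pos hΛ]
    have hAne : A.Nonempty := (F.partition.nonempty n).mono hσA
    set ε : ℕ → 𝕜 := fun k => sgn (F.dualVec xs k (F.J g))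
    have h1 := hC (F.J g) A hAne fun k hk j hj => by
      rw [hA] at hk hj
      exact (not_le.1 hj).le.trans hk
    have h2 : t * NY (signedSum (unitVec ι) ε A) ≤ C' * (C_J * NX g) := by
      refine (mul_le_mul_of_nonneg_right (Finset.le_inf' hAne _ fun k hk => (hA k).1 hk)
        (NY.nonneg' _)).trans (h1.trans ?_)
      exact mul_le_mul (le_max_left _ _) (hJ g) (NY.nonneg' _) hC'0
    have h3 : NY (signedSum (unitVec ι) ε (σ n)) = Λ * NX (x n) := by
      have e : signedSum (unitVec ι) ε (σ n) = sgn ((Λ : 𝕜)⁻¹ * xs n g) • ι (ind 𝕜 (σ n)) := by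
        rw [map_ind, Finset.smul_sum]
        exact Finset.sum_congr rfl fun k hk => by rw [← hblock k hk]
      rw [e, NY.smul', norm_sgn, one_mul, F.norm_ind]
    have h4 := hucc (σ n) A hσA ε fun k => norm_sgn _
    rw [h3] at h4
    have h5 : ‖xs n g‖ * c ≤ K * (C' * (C_J * NX g)) := by
      calc ‖xs n g‖ * c ≤ ‖xs n g‖ * NX (x n) :=
            mul_le_mul_of_nonneg_left (hcx n).1 (norm_nonneg _)
        _ = t * (Λ * NX (x n)) := by rw [ht]; field_simp
        _ ≤ t * (K * NY (signedSum (unitVec ι) ε A)) := mul_le_mul_of_nonneg_left h4 ht0.le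
        _ = K * (t * NY (signedSum (unitVec ι) ε A)) := by ring
        _ ≤ _ := mul_le_mul_of_nonneg_left h2 hK.le
    rw [← le_div_iff₀ hc] at h5
    refine h5.trans_eq ?_
    simp only [D]
    field_simp
  refine ⟨(QuasiNorm.scalar 𝕜).modulus * NX.modulus * D, fun n => ?_⟩
  have h1 := (QuasiNorm.scalar 𝕜).modulus_pos
  have h2 := NX.modulus_pos
  exact QuasiNorm.dualNorm_le (by positivity) fun g => QuasiNorm.BoundedMap.le_of_dense
    (M := QuasiNorm.scalar 𝕜) (hx.bounded n)
    (QuasiNorm.dense_span_of_closedSpan_eq_top hx.generates) hD (fun v => key n v v.2) g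

theorem isSemiNormalized_and_isMBounded_of_isTruncationQuasiGreedy (F : Frame S σ b NX x NY ι)
    (hS : S.IsSymmetric) (hSconv : S.qnorm.IsLocallyConvex) (hσ_card : ∀ n, 2 ≤ (σ n).card)
    (hx : IsBasisWithDual NX x xs)
    (h : IsTruncationQuasiGreedy NY (unitVec ι) (F.dualVec xs)) :
    IsSemiNormalized NX x ∧ IsMBounded NX x xs := by
  have hn := F.isSemiNormalized_of_isUCC hS hSconv hσ_card (h.isUCC (F.isBasisWithDual hx))
  obtain ⟨B, hB⟩ := F.exists_dualNorm_le_of_isTruncationQuasiGreedy hx h hn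
  obtain ⟨c, C, hc, hcC⟩ := id hn
  exact ⟨hn, C * B, fun n => mul_le_mul (hcC n).2 (hB n) (NX.dualNorm_nonneg _)
    ((NX.nonneg' _).trans (hcC n).2)⟩

end Frame

/-! ### The squeeze between the Lorentz and the weak Lorentz space -/

theorem toReal_sum_enorm_mul {u : ℕ → ℝ} (hu0 : ∀ n, 0 ≤ u n) (f : ℕ → 𝕜) (s : Finset ℕ) :
    (∑ j ∈ s, ‖f j‖ₑ * ENNReal.ofReal (u j)).toReal = ∑ j ∈ s, ‖f j‖ * u j := by
  rw [ENNReal.toReal_sum fun j _ => ENNReal.mul_ne_top enorm_ne_top ENNReal.ofReal_ne_top]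
  refine Finset.sum_congr rfl fun j _ => ?_
  rw [ENNReal.toReal_mul, toReal_enorm, ENNReal.toReal_ofReal (hu0 j)]

/-- The series transform is bounded on the closure of `c₀₀` for the Lorentz gauge. Far from the support
of a finitely supported approximation `g` of `a`, the partial sums of `a` and of `a - g` differ by a
constant, which gives the Cauchy property. -/
theorem exists_series_of_lorentzGauge {NY : QuasiNorm 𝕜 Y} {ι : (ℕ →₀ 𝕜) →ₗ[𝕜] Y} {u : ℕ → ℝ}
    {D : ℝ} (hD : 0 < D) (hu0 : ∀ n, 0 ≤ u n)
    (hupper : ∀ (f : ℕ → 𝕜) (n : ℕ) (p : ℕ → ℕ), Set.InjOn p (Finset.range n) →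
      (∀ i j, i ≤ j → j < n → ‖f (p j)‖ ≤ ‖f (p i)‖) →
      NY (∑ j ∈ Finset.range n, f (p j) • unitVec ι (p j)) ≤
        D * ∑ j ∈ Finset.range n, ‖f (p j)‖ * u j)
    (hNY : NY.IsComplete) (h : IsFatouGauge (lorentzGauge (𝕜 := 𝕜) u)) :
    ∃ C : ℝ, ∀ a : h.space.carrier, ∃ y : Y,
      NY.ConvergesTo (fun m => ∑ n ∈ Finset.range m, a.1 n • unitVec ι n) y ∧
        NY y ≤ C * h.space.qnorm a := by
  have hbound : ∀ (A : Finset ℕ) (f : h.space.carrier),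
      NY (∑ k ∈ A, f.1 k • unitVec ι k) ≤ D * h.space.qnorm f := by
    intro A f
    obtain ⟨p, hp, -, -, h1⟩ := norm_sum_unitVec_le hupper A f.1
    refine h1.trans (mul_le_mul_of_nonneg_left ?_ hD.le)
    rw [← toReal_sum_enorm_mul hu0 (fun j => f.1 (p j))]
    exact ENNReal.toReal_mono (h.lt_top_of_mem f.2).ne (le_lorentzGauge u f.1 hp)
  refine ⟨NY.modulus * D, fun a => ?_⟩
  have hcauchy : ∀ ε > 0, ∃ n₀, ∀ m ≥ n₀, ∀ n ≥ n₀,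
      NY (∑ k ∈ Finset.range m, a.1 k • unitVec ι k - ∑ k ∈ Finset.range n, a.1 k • unitVec ι k)
        < ε := by
    intro ε hε
    obtain ⟨g, hg⟩ := h.space.dense a (ε / D) (by positivity)
    obtain ⟨n₀, hn₀⟩ := g.support.exists_nat_subset_range
    have key : ∀ m n, n₀ ≤ n → n ≤ m →
        NY (∑ k ∈ Finset.range m, a.1 k • unitVec ι k -
          ∑ k ∈ Finset.range n, a.1 k • unitVec ι k) < ε := by
      intro m n hn hnm
      rw [← Finset.sum_Ico_eq_sub _ hnm]
      have e : ∑ k ∈ Finset.Ico n m, a.1 k • unitVec ι k =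
          ∑ k ∈ Finset.Ico n m, (a - ⟨g, h.space.c00_mem g⟩ : h.space.carrier).1 k •
            unitVec ι k := by
        refine Finset.sum_congr rfl fun k hk => ?_
        have : g k = 0 := by
          by_contra h0
          have := Finset.mem_range.1 (hn₀ (Finsupp.mem_support_iff.2 h0))
          have := (Finset.mem_Ico.1 hk).1
          omega
        change _ = (a.1 k - g k) • _
        rw [this, sub_zero]
      rw [e]
      refine (hbound _ _).trans_lt ?_
      rwa [lt_div_iff₀ hD, mul_comm] at hg
    refine ⟨n₀, fun m hm n hn => ?_⟩
    rcases le_total n m with h | h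
    · exact key m n hn h
    · rw [NY.sub_comm]
      exact key n m hm h
  obtain ⟨y, hy⟩ := hNY _ hcauchy
  refine ⟨y, hy, ?_⟩
  rw [mul_assoc]
  exact hy.le tendsto_const_nhds (Eventually.of_forall fun m => hbound (Finset.range m) a)

/-- The lower regularity property passes to equivalent sequences: it is iterated until the power of
two that is gained exceeds the constant of equivalence. -/
theorem HasLRP.congr {Γ Φ : ℕ → ℝ} {C : ℝ} (h : HasLRP Γ)
    (hΦ : ∀ m, Γ m ≤ Φ m ∧ Φ m ≤ C * Γ m) (hΓ : ∀ m, 0 ≤ Γ m) : HasLRP Φ := by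
  obtain ⟨c, hc, h⟩ := h
  have hpow : ∀ r m, 1 ≤ m → 2 ^ r * Γ m ≤ Γ (c ^ r * m) := fun r => by
    induction r with
    | zero => intro m _; simp
    | succ r ih =>
      intro m hm
      have h1 := ih m hm
      have h2 := h (c ^ r * m) (Nat.mul_pos (pow_pos hc r) hm)
      rw [pow_succ', pow_succ', mul_assoc, mul_assoc]
      linarith
  obtain ⟨r, hr⟩ := pow_unbounded_of_one_lt (2 * C) (one_lt_two (α := ℝ))
  refine ⟨c ^ r, pow_pos hc r, fun m hm => ?_⟩
  have h1 := hpow r m hm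
  have h2 := mul_le_mul_of_nonneg_right hr.le (hΓ m)
  have h3 := (hΦ m).2
  have h4 := (hΦ (c ^ r * m)).1
  linarith

namespace Frame

variable {S : SequenceSpace 𝕜} {σ : ℕ → Finset ℕ} {b : ℕ → ℕ} {NX : QuasiNorm 𝕜 X}
  {x : ℕ → X} {NY : QuasiNorm 𝕜 Y} {ι : (ℕ →₀ 𝕜) →ₗ[𝕜] Y} {xs : ℕ → X →ₗ[𝕜] 𝕜}

/-- The coefficient transform is bounded into the closure of `c₀₀` for the weak Lorentz gauge. -/
theorem exists_weakLorentzGauge_le (F : Frame S σ b NX x NY ι) (hx : IsBasisWithDual NX x xs)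
    {Φ : ℕ → ℝ} {D : ℝ}
    (hlower : ∀ (y : Y) (A : Finset ℕ) (t : ℝ), 0 ≤ t →
      (∀ k ∈ A, t ≤ ‖F.dualVec xs k y‖) → t * Φ A.card ≤ D * NY y) (hD : 0 < D)
    (h : IsFatouGauge (weakLorentzGauge (𝕜 := 𝕜) Φ)) :
    ∃ C : ℝ, ∀ y : Y, ∃ hmem : (fun k => F.dualVec xs k y) ∈ h.space.carrier,
      h.space.qnorm ⟨fun k => F.dualVec xs k y, hmem⟩ ≤ C * NY y := by
  have hle : ∀ y, weakLorentzGauge Φ (fun k => F.dualVec xs k y) ≤ ENNReal.ofReal (D * NY y) := by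
    intro y
    refine iSup_le fun A => iSup_le fun t => iSup_le fun ht => ?_
    have h1 := hlower y A t t.2 fun k hk => by exact_mod_cast ht k hk
    rw [← ENNReal.ofReal_coe_nnreal, mul_comm, ← ENNReal.ofReal_mul (NNReal.coe_nonneg t)]
    exact ENNReal.ofReal_le_ofReal h1
  refine ⟨D, fun y => ⟨fun ε hε => ?_, ?_⟩⟩
  · obtain ⟨f, hf⟩ := F.completion.dense y (ε / D) (div_pos hε hD)
    refine ⟨f, ?_⟩
    have e : (fun k => F.dualVec xs k y) - ⇑f = fun k => F.dualVec xs k (y - ι f) := by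
      funext k
      rw [Pi.sub_apply, map_sub, F.dualVec_ι hx]
    rw [e]
    refine (hle _).trans_lt ?_
    rw [← ENNReal.ofReal_coe_nnreal]
    refine (ENNReal.ofReal_lt_ofReal_iff hε).2 ?_
    rwa [lt_div_iff₀ hD, mul_comm] at hf
  · exact ENNReal.toReal_le_of_le_ofReal (mul_nonneg hD.le (NY.nonneg' _)) (hle y)

/-- The upper estimate provides the Lorentz space, the lower one the weak Lorentz space, and the lower
regularity property makes their fundamental functions equivalent. -/
theorem isSqueezeSymmetric (F : Frame S σ b NX x NY ι) (hS : S.IsSymmetric)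
    (hSconv : S.qnorm.IsLocallyConvex) (hXconv : NX.IsLocallyConvex)
    (hlrp : HasLRP (fundamental S.norm00)) (hx : IsBasisWithDual NX x xs)
    (hxn : IsSemiNormalized NX x) (hxM : IsMBounded NX x xs)
    {c : ℝ} (hM : ∀ n, ∑ k ∈ Finset.range (n + 1), ((σ k).card : ℝ) ≤ c * (σ n).card) :
    IsSqueezeSymmetric NY (unitVec ι) (F.dualVec xs) := by
  obtain ⟨Φ, K, hΦ, hK, hΦS⟩ :=
    hS.qnorm00.exists_isQuasiconcave_fundamental (S.qnorm00_isLocallyConvex hSconv)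
  obtain ⟨D₁, hD₁, hupper⟩ := F.exists_upper_lorentz hS hSconv hXconv hxn hM hΦ
    fun m => (hΦS m).1
  obtain ⟨D₂, hD₂, hlower⟩ := F.exists_lower_weakLorentz hS hx (exists_dualNorm_le hxn hxM) hM hΦ
    hK hΦS
  have hΦ1 : 0 < Φ 1 := (fundamental_pos S.qnorm00 le_rfl).trans_le (hΦS 1).1
  have hu0 := hΦ.weight_nonneg
  have hupos : 0 < IsQuasiconcave.weight Φ 0 := by simpa [IsQuasiconcave.weight] using hΦ1
  have h₁ := isFatouGauge_lorentzGauge (𝕜 := 𝕜) hΦ.weight_antitone hu0 hupos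
  have h₂ := isFatouGauge_weakLorentzGauge (𝕜 := 𝕜) hΦ hΦ1
  obtain ⟨r, hr, hΦlrp⟩ := hlrp.congr hΦS fun m => S.qnorm00.nonneg' _
  obtain ⟨L, hL, hLsum⟩ := hΦ.exists_sum_weight_le hr hΦlrp
  have e₁ : ∀ m, fundamental h₁.space.norm00 m =
      ∑ j ∈ Finset.range m, IsQuasiconcave.weight Φ j := fun m => by
    rw [fundamental, h₁.space_norm00, lorentzGauge_ind_range hΦ.weight_antitone hu0,
      ENNReal.toReal_ofReal (Finset.sum_nonneg fun j _ => hu0 j)]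
  have e₂ : ∀ m, fundamental h₂.space.norm00 m = Φ m := fun m => by
    rw [fundamental, h₂.space_norm00, weakLorentzGauge_ind hΦ, Finset.card_range,
      ENNReal.toReal_ofReal (hΦ.nonneg m)]
  refine ⟨h₁.space, h₂.space, h₁.space_isSymmetric, h₂.space_isSymmetric,
    exists_series_of_lorentzGauge hD₁ hu0 hupper F.completion.complete h₁,
    F.exists_weakLorentzGauge_le hx hlower hD₂ h₂, L⁻¹, 1, inv_pos.2 hL, fun m _ => ?_⟩
  rw [e₁, e₂, one_mul]
  exact ⟨(inv_mul_le_iff₀ hL).2 (hLsum m), hΦ.le_sum_weight m⟩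

end Frame

end Gauges

end DKK

end

open DKK in
theorem mainTheorem5 {𝕜 X Y : Type*} [RCLike 𝕜] [AddCommGroup X] [Module 𝕜 X]
    [AddCommGroup Y] [Module 𝕜 Y]
    -- a locally convex symmetric sequence space
    (S : SequenceSpace 𝕜) (hS : S.IsSymmetric) (hSconv : S.qnorm.IsLocallyConvex)
    -- an ordered partition
    (σ : ℕ → Finset ℕ) (hσ : IsOrderedPartition σ) (hσ_card : ∀ n, 2 ≤ (σ n).card)
    -- a linearly independent sequence that generates a quasi-Banach space
    (NX : QuasiNorm 𝕜 X) (hX : NX.IsComplete) (x : ℕ → X) (hx : LinearIndependent 𝕜 x)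
    (hx_gen : NX.closedSpan (Set.range x) = ⊤)
    -- the completion of `c₀₀`
    (NY : QuasiNorm 𝕜 Y) (ι : (ℕ →₀ 𝕜) →ₗ[𝕜] Y)
    (hY : IsCompletion (dkkNorm S.norm00 σ NX x) NY ι) :
    (IsBasis NY (unitVec ι) ↔ IsBasis NX x) ∧
    ∀ (xs : ℕ → X →ₗ[𝕜] 𝕜) (es : ℕ → Y →ₗ[𝕜] 𝕜),
      IsBasisWithDual NX x xs → IsBasisWithDual NY (unitVec ι) es →
      -- totality
      (IsTotalBasis NY (unitVec ι) ↔ IsTotalBasis NX x) ∧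
      -- the dual basis
      (∃ c C : ℝ, 0 < c ∧ ∀ a : ℕ →₀ 𝕜,
        c * dkkNorm S.dualNorm00 σ NX.dualNorm (dualBlocks S σ xs) a
            ≤ NY.dualNorm (a.sum fun k t => t • es k) ∧
        NY.dualNorm (a.sum fun k t => t • es k)
            ≤ C * dkkNorm S.dualNorm00 σ NX.dualNorm (dualBlocks S σ xs) a) ∧
      -- norms of the unit vectors
      (∃ c C : ℝ, 0 < c ∧ ∀ n, ∀ k ∈ σ n,
        c * max 1 (NX (x n) * fundamental S.norm00 (σ n).card / (σ n).card)
            ≤ NY (unitVec ι k) ∧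
        NY (unitVec ι k)
            ≤ C * max 1 (NX (x n) * fundamental S.norm00 (σ n).card / (σ n).card)) ∧
      -- norms of the coordinate functionals
      (∃ c C : ℝ, 0 < c ∧ ∀ n, ∀ k ∈ σ n,
        c * max 1 (NX.dualNorm (xs n) / fundamental S.norm00 (σ n).card)
            ≤ NY.dualNorm (es k) ∧
        NY.dualNorm (es k)
            ≤ C * max 1 (NX.dualNorm (xs n) / fundamental S.norm00 (σ n).card)) ∧
      -- semi-normalized and M-bounded
      (IsSemiNormalized NY (unitVec ι) ∧ IsMBounded NY (unitVec ι) es ↔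
        ∃ C : ℝ, ∀ n, NX (x n) ≤ C * ((σ n).card / fundamental S.norm00 (σ n).card) ∧
          NX.dualNorm (xs n) ≤ C * fundamental S.norm00 (σ n).card) ∧
      -- unconditionality parameters
      (∃ c : ℝ, 0 < c ∧ ∀ n, 1 ≤ n →
        ENNReal.ofReal c * ktilde NX x xs n
          ≤ ktilde NY (unitVec ι) es (∑ k ∈ Finset.range n, (σ k).card)) ∧
      -- Schauder decomposition
      (IsSchauderBasis NX x ↔
        IsSchauderDecomposition NY (fun n => NY.closedSpan (unitVec ι '' (σ n : Set ℕ)))) ∧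
      -- unconditionality for constant coefficients
      (IsUCC NY (unitVec ι) → IsSemiNormalized NX x) ∧
      -- the blocks `1_{σ_n}` are isometrically equivalent to an affinity of `x`
      (∃ t : ℕ → 𝕜, (∀ n, t n ≠ 0) ∧ ∀ a : ℕ →₀ 𝕜,
        NY (a.sum fun n c => c • ∑ k ∈ σ n, unitVec ι k) = NX (a.sum fun n c => c • t n • x n)) ∧
      -- embeddings
      (NX.IsLocallyConvex → IsSemiNormalized NX x → IsMBounded NX x xs →
        (∃ C : ℝ, ∀ n, 1 + ∑ k ∈ Finset.range n, ((σ k).card : ℝ) ≤ C * (σ n).card) →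
        (∃ C : ℝ, ∀ f : ℕ → 𝕜,
          MemLorentz 1 (fun n => fundamental S.norm00 (n + 1) / (n + 1)) f →
          ∃ y, NY.ConvergesTo (fun m => ∑ k ∈ Finset.range m, f k • unitVec ι k) y ∧
            (∀ k, es k y = f k) ∧
            ENNReal.ofReal (NY y) ≤ ENNReal.ofReal C *
              lorentzNorm 1 (fun n => fundamental S.norm00 (n + 1) / (n + 1)) f) ∧
        (∃ C : ℝ, ∀ y,
          MemWeakLorentz
            (fun n => fundamental S.norm00 (n + 1) - fundamental S.norm00 n) (fun k => es k y) ∧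
          weakLorentzNorm
              (fun n => fundamental S.norm00 (n + 1) - fundamental S.norm00 n) (fun k => es k y)
            ≤ ENNReal.ofReal (C * NY y)) ∧
        (IsTotalBasis NX x → Function.Injective (fun (y : Y) (k : ℕ) => es k y))) ∧
      -- squeeze-symmetry
      (NX.IsLocallyConvex → HasLRP (fundamental S.norm00) →
        (∃ C : ℝ, ∀ n, ∑ k ∈ Finset.range (n + 1), ((σ k).card : ℝ) ≤ C * (σ n).card) →
        List.TFAE [IsSqueezeSymmetric NY (unitVec ι) es,
          IsTruncationQuasiGreedy NY (unitVec ι) es,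
          IsSemiNormalized NX x ∧ IsMBounded NX x xs]) := by
  obtain ⟨b, hb⟩ := hσ.exists_isFibres
  obtain ⟨F⟩ := exists_frame hσ hb hX hx_gen hY
  refine ⟨F.isBasis_iff hx_gen, fun xs es hxs hes => ?_⟩
  obtain rfl : es = F.dualVec xs := hes.eq (F.isBasisWithDual hxs)
  refine ⟨F.isTotalBasis_iff hxs, F.exists_dualNorm_equiv hS hSconv hxs, ?_, ?_,
    F.semiNormalized_and_mBounded_iff hS hSconv hσ_card hxs, ?_,
    F.isSchauderBasis_iff hS hxs, F.isSemiNormalized_of_isUCC hS hSconv hσ_card,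
    F.exists_affinity, ?_, ?_⟩
  · obtain ⟨c, C, hc, -, h⟩ := F.exists_norm_unitVec hS hSconv hσ_card
    exact ⟨c, C, hc, h⟩
  · obtain ⟨c, C, hc, -, h⟩ := F.exists_norm_dualVec hS hSconv hσ_card hxs
    exact ⟨c, C, hc, h⟩
  · obtain ⟨c, hc, h⟩ := F.exists_ktilde_le xs
    exact ⟨c, hc, fun n _ => h n⟩
  · rintro hXconv hxn hxM ⟨C, hC⟩
    have hM : ∀ n, ∑ k ∈ Finset.range (n + 1), ((σ k).card : ℝ) ≤ (C + 1) * (σ n).card := by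
      intro n
      rw [Finset.sum_range_succ]
      linarith [hC n]
    obtain ⟨Φ, K, hΦ, hK, hΦS⟩ :=
      hS.qnorm00.exists_isQuasiconcave_fundamental (S.qnorm00_isLocallyConvex hSconv)
    refine ⟨?_, ?_, ?_⟩
    · obtain ⟨D, hD, hupper⟩ := F.exists_upper_lorentz hS hSconv hXconv hxn hM hΦ
        fun m => (hΦS m).1
      refine exists_lorentz_embedding hD hK (fun n => ?_) hΦ.weight_nonneg (fun n => ?_) hupper
        hY.complete hes
      · exact div_pos (fundamental_pos S.qnorm00 (by omega)) (by positivity)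
      · rw [IsQuasiconcave.weight, mul_div_assoc']
        exact div_le_div_of_nonneg_right (hΦS _).2 (by positivity)
    · obtain ⟨D, hD, hlower⟩ := F.exists_lower_weakLorentz hS hxs (exists_dualNorm_le hxn hxM) hM
        hΦ hK hΦS
      exact F.exists_weakLorentz_embedding hxs (fun m => (hΦS m).1) hD hlower
    · rintro ⟨ys, hys, hinj⟩
      rw [hys.eq hxs] at hinj
      exact F.injective_dualVec hinj
  · rintro hXconv hlrp ⟨C, hM⟩
    tfae_have 1 → 2 := fun h => h.isTruncationQuasiGreedy
    tfae_have 2 → 3 :=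
      F.isSemiNormalized_and_isMBounded_of_isTruncationQuasiGreedy hS hSconv hσ_card hxs
    tfae_have 3 → 1 := fun h => F.isSqueezeSymmetric hS hSconv hXconv hlrp hxs h.1 h.2 hM
    tfae_finish
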